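/- **Setting.** Let $(\Sigma,\theta)$ be a one-sided topological Markov chain over a countable alphabet $\mathcal W$ (no row or column of the transition matrix vanishes) which is topologically mixing and has big images and preimages, i.e. there is a finite $I\subset\mathcal W$ such that for every $v\in\mathcal W$ there are $\beta_1,\beta_2\in I$ with $v\beta_1$ and $\beta_2v$ admissible. For $0<r<1$ let $d_r(x,y)=r^{k}$, where $k$ is the number of initial letters on which $x$ and $y$ agree. Let $\varphi:\Sigma\to(0,\infty)$ be such that $\log\varphi$ is locally Hölder continuous, i.e. $\sup\{|\log\varphi(x)-\log\varphi(y)| : x_i=y_i \text{ for } i\le n\}\le C r^n$ for all $n\ge1$, and such that $\sup_{x}\sum_{\theta y=x}\varphi(y)<\infty$; put $\Phi_n=\prod_{k<n}\varphi\circ\theta^k$. For a word $v$ of length $n$, $\tau_v$ is the inverse branch $\theta^n([v])\to[v]$ of $\theta^n$. Let $G$ be a countable group, let $\psi:\Sigma\to G$ depend only on the first letter, and let $X=\Sigma\times G$, $T(x,g)=(\theta x,g\psi(x))$, $X_g=\Sigma\times\{g\}$; assume that the Markov chain $(X,T)$ is topologically transitive. Extend $d_r$ to $X$ by $d_r((x,g),(y,g))=d_r(x,y)$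 and $d_r((x,g),(y,h))=1$ for $g\ne h$, write $\varphi(x,g)=\varphi(x)$, and put $\mathcal L_\varphi f(z)=\sum_{Ty=z}\varphi(y)f(y)$. **Conformal measures.** Fix $\xi\in\Sigma$, and let $\mathcal Z^n=\mathcal L_\varphi^n(\mathbf 1_{X_{id}})(\xi,id)$ and $\rho=\limsup_n(\mathcal Z^n)^{1/n}$. A *weight* is a nondecreasing sequence $b_n\ge1$ with $b_n/b_{n+1}\to1$ such that $\mathcal P(s)=\sum_{n\ge1}s^{-n}b_n\mathcal Z^n$ is infinite for $0<s\le\rho$ and finite for $s>\rho$. For $s>\rho$ and $\zeta\in X$ let $m^s_\zeta$ be the measure with $\int f\,dm^s_\zeta=\mathcal P(s)^{-1}\sum_{n\ge1}b_ns^{-n}\mathcal L_\varphi^nf(\zeta)$. Assume property (C): for some weight and some $s_k\searrow\rho$, the measures $m^{s_k}_{(\xi,id)}|_{X_{id}}$ converge weakly to a probability measure. **Function spaces.** Let $C_n(f)$ be the infimum of all $C\ge0$ with $|f(z_1)-f(z_2)|\le C|f(z_1)|$ whenever $z_1,z_2$ lie in the same $X_g$ and agree in their first $n$ letters. For a measure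 $\nu_{\mathbf o}$ on $X$ let $$\mathcal C=\{f:X\to\mathbb R:\ \nu_{\mathbf o}(|f|)<\infty,\ \lim_nC_n(f)=0\}.$$ With the convention $0/0=1$ and $|a/0|=\infty$ for $a\ne0$, all suprema being over distinct points, let $$D_x(f)=\sup_{d_r(x,z)<1}\frac{|f(x)-f(z)|}{d_r(x,z)},\qquad LD(f)=\sup_{d_r(z_1,z_2)<1}\frac{|f(z_1)/f(z_2)-1|}{d_r(z_1,z_2)},$$ $$C_\varphi=\sup\Big\{\Big|\frac{\Phi_n(\tau_vx_1)}{\Phi_n(\tau_vx_2)}-1\Big|\Big/d_r(x_1,x_2):\ n\ge1,\ v\text{ a word of length }n,\ x_1,x_2\in\theta^n([v]),\ d_r(x_1,x_2)<1\Big\}.$$ Finally let $$\mathcal H^+=\{f:X\to[0,\infty):\ \mathcal L_\varphi f=\rho f,\ LD(f)<\infty\},$$ $$\mathcal H=\{f:X\to\mathbb R:\ \mathcal L_\varphi f=\rho f,\ \exists h\in\mathcal H^+\ \forall x\in X:\ D_x(f)\le h(x)\},$$ where $\mathcal L_\varphi f=\rho f$ includes that the series converges unconditionally at every point. **Theorem.**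 1. There are a weight $(b_n)$, a sequence $s_k\searrow\rho$ and measures $(\nu_z)_{z\in X}$ on $X$ such that, for all $z\in X$ and $g\in G$, $m^{s_k}_z|_{X_g}\to\nu_z|_{X_g}$ weakly. 2. Let $(b_n)$, $(s_k)$, $(\nu_z)$ be any such choice, let $\mathbf o\in X_{id}$ be any reference point, and define $\mathcal C$ by means of $\nu_{\mathbf o}$. Then every $\nu_z$ is finite on each $X_g$ and absolutely continuous with respect to $\nu_{\mathbf o}$. With $\mathbb K(\delta_z,y)=\frac{d\nu_z}{d\nu_{\mathbf o}}(y)$, for every $f\in\mathcal C$ and $z\in X$ the function $f$ is $\nu_z$-integrable, $\mathbb K(\delta_z,\cdot)f$ is $\nu_{\mathbf o}$-integrable, and $$\Theta(f)(z):=\int\mathbb K(\delta_z,y)f(y)\,d\nu_{\mathbf o}(y)=\nu_z(f).$$ Moreover $\Theta(f)\in\mathcal H$; that is, $\Theta:\mathcal C\to\mathcal H$ is well defined. 3. $C_\varphi<\infty$, and every $f\in\mathcal H$ with $f\ge0$ satisfies $LD(f)\le C_\varphi$; in particular $f\in\mathcal H^+$. -/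

import Mathlib

open MeasureTheory Filter Topology
open scoped ENNReal NNReal BoundedContinuousFunction

noncomputable section

namespace GroupExt

variable {W G : Type*}

/-! ### Topological Markov chains -/

/-- The one-sided topological Markov chain over the alphabet `W` whose transition matrix has
entry `1` at `(i, j)` exactly when `A i j`. Sequences are indexed from `0`. With `W` discrete,
the topology and the Borel structure are those generated by cylinders. -/
abbrev Chain (A : W → W → Prop) : Type _ := {x : ℕ → W // ∀ i, A (x i) (x (i + 1))}

/-- The shift map. -/
def shift {A : W → W → Prop} (x : Chain A) : Chain A :=
  ⟨fun i => x.1 (i + 1), fun i => x.2 (i + 1)⟩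

/-- No row and no column of the transition matrix vanishes. -/
def NoZeroLines (A : W → W → Prop) : Prop :=
  (∀ i, ∃ j, A i j) ∧ (∀ j, ∃ i, A i j)

/-- Topological mixing: for all letters `a, b`, the set `θⁿ [a] ∩ [b]` is nonempty for all
large `n`. -/
def TopMixing (A : W → W → Prop) : Prop :=
  ∀ a b : W, ∃ N : ℕ, ∀ n ≥ N,
    ((shift^[n]) '' {x : Chain A | x.1 0 = a} ∩ {x : Chain A | x.1 0 = b}).Nonempty

/-- Big images and big preimages. -/
def BigImagesPreimages (A : W → W → Prop) : Prop :=
  ∃ I : Finset W, ∀ v : W, ∃ β₁ ∈ I, ∃ β₂ ∈ I, A v β₁ ∧ A β₂ v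

/-- The metric `d_r (x, y) = r ^ k`, where `k` is the number of initial letters on which `x` and
`y` agree. -/
def dShift {A : W → W → Prop} (r : ℝ) (x y : Chain A) : ℝ :=
  open Classical in if x = y then 0 else r ^ PiNat.firstDiff x.1 y.1

/-! ### Potentials -/

/-- `V_n (log φ) ≪ rⁿ` for `n ≥ 1`. -/
def LogLocallyHolder {A : W → W → Prop} (r : ℝ) (φ : Chain A → ℝ) : Prop :=
  ∃ C : ℝ, ∀ n ≥ 1, ∀ x y : Chain A, (∀ i < n, x.1 i = y.1 i) →
    |Real.log (φ x) - Real.log (φ y)| ≤ C * r ^ n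

/-- `‖L_φ 1‖_∞ < ∞` for the Ruelle operator `L_φ f (x) = ∑_{θ y = x} φ y * f y` of the base. -/
def BoundedRuelleOne {A : W → W → Prop} (φ : Chain A → ℝ) : Prop :=
  ∃ M : ℝ≥0, ∀ x : Chain A,
    ∑' y : {y : Chain A // shift y = x}, ENNReal.ofReal (φ y.1) ≤ (M : ℝ≥0∞)

/-- `Φ_n = ∏_{k < n} φ ∘ θᵏ`. -/
def birkhoffProd {A : W → W → Prop} (φ : Chain A → ℝ) (n : ℕ) (x : Chain A) : ℝ :=
  ∏ k ∈ Finset.range n, φ (shift^[k] x)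

/-- `|a / b - 1|` as an extended nonnegative number, with `0 / 0 = 1` and `a / 0 = ∞` for
`a ≠ 0`. -/
def relDiff (a b : ℝ) : ℝ≥0∞ := ENNReal.ofReal |a - b| / ENNReal.ofReal |b|

/-- `C_φ = sup |Φ_n (τ_v x₁) / Φ_n (τ_v x₂) - 1| / d_r (x₁, x₂)`, the supremum being over all
words `v` of length `n ≥ 1` and all `x₁, x₂` in the domain of `τ_v` with `d_r (x₁, x₂) < 1`.
Here `y₁ = τ_v x₁` and `y₂ = τ_v x₂`: these are the pairs of points with the same first `n`
letters (namely `v`), and `x₁ = θⁿ y₁`, `x₂ = θⁿ y₂`. -/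
def distortionConst {A : W → W → Prop} (r : ℝ) (φ : Chain A → ℝ) : ℝ≥0∞ :=
  ⨆ (n : ℕ) (y₁ : Chain A) (y₂ : Chain A) (_ : 1 ≤ n) (_ : ∀ i < n, y₁.1 i = y₂.1 i)
    (_ : dShift r (shift^[n] y₁) (shift^[n] y₂) < 1),
    relDiff (birkhoffProd φ n y₁) (birkhoffProd φ n y₂) /
      ENNReal.ofReal (dShift r (shift^[n] y₁) (shift^[n] y₂))

/-! ### Group extensions -/

/-- The phase space `X = Σ × G` of the group extension. -/
abbrev Ext (A : W → W → Prop) (G : Type*) : Type _ := Chain A × G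

/-- The fibre `X_g`. -/
def fibre (A : W → W → Prop) (g : G) : Set (Ext A G) := {z | z.2 = g}

/-- The metric on `X`: `d_r` inside a fibre, `1` between different fibres. -/
def dExt {A : W → W → Prop} (r : ℝ) (z₁ z₂ : Ext A G) : ℝ :=
  open Classical in if z₁.2 = z₂.2 then dShift r z₁.1 z₂.1 else 1

/-- `C_n (f)`: the infimum of all `C ≥ 0` such that `|f z₁ - f z₂| ≤ C |f z₁|` whenever
`z₁, z₂` lie in the same fibre and in the same cylinder of length `n` (`∞` if there is none). -/
def oscConst {A : W → W → Prop} (n : ℕ) (f : Ext A G → ℝ) : ℝ≥0∞ :=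
  sInf {C : ℝ≥0∞ | ∀ z₁ z₂ : Ext A G, z₁.2 = z₂.2 → (∀ i < n, z₁.1.1 i = z₂.1.1 i) →
    ENNReal.ofReal |f z₁ - f z₂| ≤ C * ENNReal.ofReal |f z₁|}

/-- `D_x (f) = sup {|f x - f z| / d_r (x, z) : d_r (x, z) < 1}`. -/
def locLip {A : W → W → Prop} (r : ℝ) (f : Ext A G → ℝ) (x : Ext A G) : ℝ≥0∞ :=
  ⨆ (z : Ext A G) (_ : dExt r x z < 1),
    ENNReal.ofReal |f x - f z| / ENNReal.ofReal (dExt r x z)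

/-- `LD (f) = sup {|f z₁ / f z₂ - 1| / d_r (z₁, z₂) : d_r (z₁, z₂) < 1}`. -/
def logLip {A : W → W → Prop} (r : ℝ) (f : Ext A G → ℝ) : ℝ≥0∞ :=
  ⨆ (z₁ : Ext A G) (z₂ : Ext A G) (_ : dExt r z₁ z₂ < 1),
    relDiff (f z₁) (f z₂) / ENNReal.ofReal (dExt r z₁ z₂)

variable [Group G]

/-- The group extension `T (x, g) = (θ x, g ψ(x))`, where `ψ` depends on the first letter. -/
def extMap {A : W → W → Prop} (ψ : W → G) (z : Ext A G) : Ext A G :=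
  (shift z.1, z.2 * ψ (z.1.1 0))

/-- Topological transitivity of the Markov chain `(X, T)`. -/
def TopTransitiveExt (A : W → W → Prop) (ψ : W → G) : Prop :=
  ∀ (a b : W) (g h : G), ∃ n ≥ 1,
    (((extMap ψ)^[n]) '' {z : Ext A G | z.1.1 0 = a ∧ z.2 = g} ∩
      {z : Ext A G | z.1.1 0 = b ∧ z.2 = h}).Nonempty

/-- `f` satisfies `𝓛_φ f = t f`, where `𝓛_φ f (z) = ∑_{T y = z} φ y * f y` and the series
converges (unconditionally) at every point `z`. -/
def IsHarmonic {A : W → W → Prop} (ψ : W → G) (φ : Chain A → ℝ) (t : ℝ)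
    (f : Ext A G → ℝ) : Prop :=
  ∀ z : Ext A G, HasSum (fun y : {y : Ext A G // extMap ψ y = z} => φ y.1.1 * f y.1) (t * f z)

/-- `𝓩ⁿ(ξ) = ∑ Φ_n (x)` over all `x` with `θⁿ x = ξ` and `ψ_n (x) = id`, that is, with
`Tⁿ (x, id) = (ξ, id)`. -/
def returnSum {A : W → W → Prop} (ψ : W → G) (φ : Chain A → ℝ) (ξ : Chain A) (n : ℕ) : ℝ≥0∞ :=
  ∑' x : {x : Chain A // (extMap ψ)^[n] (x, 1) = (ξ, 1)}, ENNReal.ofReal (birkhoffProd φ n x.1)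

/-- `ρ = limsup_n (𝓩ⁿ(ξ))^{1/n}`. -/
def specRad {A : W → W → Prop} (ψ : W → G) (φ : Chain A → ℝ) (ξ : Chain A) : ℝ :=
  (limsup (fun n : ℕ => returnSum ψ φ ξ n ^ (1 / (n : ℝ))) atTop).toReal

/-- The space `𝓗⁺` of nonnegative `ρ`-harmonic functions `f` with `LD (f) < ∞`. -/
def harmonicPos {A : W → W → Prop} (ψ : W → G) (φ : Chain A → ℝ) (r : ℝ) (ξ : Chain A) :
    Set (Ext A G → ℝ) :=
  {f | (∀ z, 0 ≤ f z) ∧ IsHarmonic ψ φ (specRad ψ φ ξ) f ∧ logLip r f < ⊤}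

/-- The space `𝓗` of `ρ`-harmonic functions `f` such that `D_x (f) ≤ h x` for all `x`, for some
`h ∈ 𝓗⁺`. -/
def harmonicLip {A : W → W → Prop} (ψ : W → G) (φ : Chain A → ℝ) (r : ℝ) (ξ : Chain A) :
    Set (Ext A G → ℝ) :=
  {f | IsHarmonic ψ φ (specRad ψ φ ξ) f ∧
    ∃ h ∈ harmonicPos ψ φ r ξ, ∀ x, locLip r f x ≤ ENNReal.ofReal (h x)}

/-! ### The conformal measures -/

/-- `𝓟(t) = ∑_{n ≥ 1} t⁻ⁿ b_n 𝓩ⁿ(ξ)`. -/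
def poincareSeries {A : W → W → Prop} (ψ : W → G) (φ : Chain A → ℝ) (ξ : Chain A)
    (b : ℕ → ℝ) (t : ℝ) : ℝ≥0∞ :=
  ∑' n : ℕ, ENNReal.ofReal (b (n + 1) * t⁻¹ ^ (n + 1)) * returnSum ψ φ ξ (n + 1)

/-- A nondecreasing sequence `b_n ≥ 1` with `b_n / b_{n+1} → 1` for which `𝓟(t)` diverges for
`t ≤ ρ` and converges for `t > ρ`. -/
structure IsWeight {A : W → W → Prop} (ψ : W → G) (φ : Chain A → ℝ) (ξ : Chain A)
    (b : ℕ → ℝ) : Prop where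
  mono : Monotone b
  one_le : ∀ n, 1 ≤ b n
  ratio : Tendsto (fun n => b n / b (n + 1)) atTop (𝓝 1)
  diverges : ∀ t : ℝ, 0 < t → t ≤ specRad ψ φ ξ → poincareSeries ψ φ ξ b t = ⊤
  converges : ∀ t : ℝ, specRad ψ φ ξ < t → poincareSeries ψ φ ξ b t < ⊤

/-- `s_k ↘ ρ`. -/
structure DecreasesTo (s : ℕ → ℝ) (t : ℝ) : Prop where
  anti : Antitone s
  gt : ∀ k, t < s k
  lim : Tendsto s atTop (𝓝 t)

variable [MeasurableSpace W] [MeasurableSpace G]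

/-- The measure `m^t_ζ = 𝓟(t)⁻¹ ∑_{n ≥ 1} t⁻ⁿ b_n ∑_{Tⁿ y = ζ} Φ_n (y) δ_y`, that is,
`∫ f dm^t_ζ = 𝓟(t)⁻¹ ∑_{n ≥ 1} t⁻ⁿ b_n 𝓛ⁿ_φ f (ζ)`. -/
def approxMeasure {A : W → W → Prop} (ψ : W → G) (φ : Chain A → ℝ) (ξ : Chain A)
    (b : ℕ → ℝ) (t : ℝ) (ζ : Ext A G) : Measure (Ext A G) :=
  (poincareSeries ψ φ ξ b t)⁻¹ • Measure.sum fun n : ℕ =>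
    ENNReal.ofReal (b (n + 1) * t⁻¹ ^ (n + 1)) •
      Measure.sum fun y : {y : Ext A G // (extMap ψ)^[n + 1] y = ζ} =>
        ENNReal.ofReal (birkhoffProd φ (n + 1) y.1.1) • Measure.dirac y.1

variable [TopologicalSpace W] [TopologicalSpace G]

/-- Property (C): for some weight `b` and some `s_k ↘ ρ`, the restrictions to `X_id` of the
measures `m^{s_k}_{(ξ, id)}` converge weakly to a probability measure. -/
def PropertyC {A : W → W → Prop} (ψ : W → G) (φ : Chain A → ℝ) (ξ : Chain A) : Prop :=
  ∃ (b : ℕ → ℝ) (s : ℕ → ℝ) (m : Measure (Ext A G)),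
    IsWeight ψ φ ξ b ∧ DecreasesTo s (specRad ψ φ ξ) ∧ IsProbabilityMeasure m ∧
    ∀ f : Ext A G →ᵇ ℝ≥0,
      Tendsto (fun k => ∫⁻ y in fibre A (1 : G), f y ∂(approxMeasure ψ φ ξ b (s k) (ξ, 1)))
        atTop (𝓝 (∫⁻ y, f y ∂m))

/-- `ν = (ν_ζ)` is the family of the limits `ν_ζ = lim_k m^{s_k}_ζ` for `ζ ∈ X`, where `b` is a
weight and `s_k ↘ ρ`; convergence means weak convergence on each fibre `X_g`. -/
structure IsLimitFamily {A : W → W → Prop} (ψ : W → G) (φ : Chain A → ℝ) (ξ : Chain A)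
    (b s : ℕ → ℝ) (ν : Ext A G → Measure (Ext A G)) : Prop where
  weight : IsWeight ψ φ ξ b
  decreases : DecreasesTo s (specRad ψ φ ξ)
  conv : ∀ (ζ : Ext A G) (g : G) (f : Ext A G →ᵇ ℝ≥0),
    Tendsto (fun k => ∫⁻ y in fibre A g, f y ∂(approxMeasure ψ φ ξ b (s k) ζ))
      atTop (𝓝 (∫⁻ y in fibre A g, f y ∂(ν ζ)))

/-- The space `𝓒`: functions `f` with `ν_o (|f|) < ∞` and `C_n (f) → 0`. -/
def logUnifCont {A : W → W → Prop} (νo : Measure (Ext A G)) : Set (Ext A G → ℝ) :=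
  {f | ∫⁻ y, ENNReal.ofReal |f y| ∂νo < ⊤ ∧ Tendsto (fun n => oscConst n f) atTop (𝓝 0)}

/-- The kernel `K(δ_z, y) = (dν_z / dν_o) (y)`. -/
def martinKernel {A : W → W → Prop} (ν : Ext A G → Measure (Ext A G)) (o z y : Ext A G) : ℝ :=
  ((ν z).rnDeriv (ν o) y).toReal

/-- `Θ(f)(z) = ∫ K(δ_z, y) f(y) dν_o(y)`. -/
def Theta {A : W → W → Prop} (ν : Ext A G → Measure (Ext A G)) (o : Ext A G)
    (f : Ext A G → ℝ) (z : Ext A G) : ℝ :=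
  ∫ y, martinKernel ν o z y * f y ∂(ν o)

end GroupExt

end

set_option linter.unusedSectionVars false

noncomputable section

namespace GroupExt

/-! ### Splicing orbits -/

section Splice

variable {W G : Type*} {A : W → W → Prop}

/-! Everything rests on one comparison. Since ψ reads only the first letter, replacing the tail `x`
of an n-step preimage of `(x, e)` by another admissible tail `x'` keeps the group coordinates. This
injects preimages of one point into preimages of another (`tsum_preimage_le`), and bounded
distortion costs a factor exp(C rᵏ) when the tails share k letters (`HasDistortion.ruelle_le`). One
orbit supplied by transitivity joins any two points, and monotonicity of the weight absorbs the time
shift. The outcome is a Harnack inequality for the averages `avg`. Sets depending on N letters can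
be compared only in terms with index at least N; the discarded terms stay bounded while the Poincaré
series tends to infinity, so they vanish in the limit. Hence any two limit measures dominate each
other up to a constant, and the constant tends to 1 as the points approach each other within a
fibre.

Harmonicity of z ↦ ν_z(f) is the integrated form of ∑ φ(y) ν_y = ρ ν_ζ over T y = ζ
(`IsLimitFamily.sum_smul_eq`). One inequality is Fatou. The other needs that no mass escapes through
infinitely many last letters. Big preimages and transitivity let the last letter of an orbit be
moved to its beginning (`HasDistortion.exists_last_le_first`), so the escaping mass is dominated by
the mass of first letters seen from `(ξ, 1)`, whose tails are small because the limit there is a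
finite measure on `X_id`. The local Lipschitz bound for z ↦ ν_z(f) comes from the Harnack constants
near 1, with majorant a multiple of z ↦ ν_z(|f|).

For existence, Harnack bounds all cluster values on cylinder sets by translates of the measure from
property (C), which makes them countably additive. A diagonal subsequence converges at a dense set
of points, and the Harnack constants near 1 carry convergence to every point.

For the bound on `LD`, a nonnegative harmonic f equals ρ⁻ⁿ 𝓛ⁿ f. Between matched preimages the
branch weights contribute the factor 1 + C_φ d, while the variation of f is at most a power of r
times the harmonic majorant h; after averaging this error is still that power of r times h(x), and
tends to 0 (`IsHarmonic.le_mul_of_locLip_le`). -/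

theorem shift_iterate_apply (n : ℕ) (x : Chain A) (i : ℕ) :
    (shift^[n] x).1 i = x.1 (i + n) := by
  induction n generalizing x with
  | zero => rfl
  | succ n ih =>
    rw [Function.iterate_succ_apply, ih]
    change x.1 (i + n + 1) = _
    rw [add_assoc]

/-- The point whose first `n + 1` letters are those of `y`, followed by `x`. -/
def splice (n : ℕ) (y x : Chain A) (h : A (y.1 n) (x.1 0)) : Chain A :=
  ⟨fun i => if i ≤ n then y.1 i else x.1 (i - (n + 1)), by
    intro i
    rcases lt_trichotomy i n with hi | rfl | hi
    · simpa [hi.le, Nat.succ_le_of_lt hi] using y.2 i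
    · simpa using h
    · obtain ⟨j, rfl⟩ := Nat.exists_eq_add_of_lt hi
      have h1 : ¬ n + j + 1 ≤ n := by omega
      have h2 : ¬ n + j + 1 + 1 ≤ n := by omega
      simp only [h1, h2, if_false]
      convert x.2 j using 2 <;> omega⟩

theorem splice_apply_of_le {n i : ℕ} {y x : Chain A} (h : A (y.1 n) (x.1 0)) (hi : i ≤ n) :
    (splice n y x h).1 i = y.1 i := by
  simp [splice, hi]

theorem shift_iterate_splice {n : ℕ} {y x : Chain A} (h : A (y.1 n) (x.1 0)) :
    shift^[n + 1] (splice n y x h) = x := by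
  apply Subtype.ext
  funext i
  rw [shift_iterate_apply]
  have h1 : ¬ i + (n + 1) ≤ n := by omega
  simp [splice, h1]

theorem eq_of_shift_iterate_eq {n : ℕ} {x y : Chain A} (h : ∀ i < n, x.1 i = y.1 i)
    (hs : shift^[n] x = shift^[n] y) : x = y := by
  apply Subtype.ext
  funext i
  rcases lt_or_ge i n with hi | hi
  · exact h i hi
  · have := shift_iterate_apply n x (i - n)
    rw [hs, shift_iterate_apply, Nat.sub_add_cancel hi] at this
    exact this.symm

variable [Group G] {ψ : W → G}

theorem extMap_iterate_fst (n : ℕ) (z : Ext A G) :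
    ((extMap ψ)^[n] z).1 = shift^[n] z.1 := by
  induction n generalizing z with
  | zero => rfl
  | succ n ih => rw [Function.iterate_succ_apply, ih]; rfl

theorem extMap_iterate_snd_congr (n : ℕ) {z z' : Ext A G} (h2 : z.2 = z'.2)
    (h : ∀ i < n, z.1.1 i = z'.1.1 i) :
    ((extMap ψ)^[n] z).2 = ((extMap ψ)^[n] z').2 := by
  induction n generalizing z z' with
  | zero => exact h2
  | succ n ih =>
    rw [Function.iterate_succ_apply, Function.iterate_succ_apply]
    refine ih ?_ fun i hi => h (i + 1) (by omega)
    change z.2 * ψ (z.1.1 0) = z'.2 * ψ (z'.1.1 0)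
    rw [h2, h 0 (by omega)]

/-- Left translation by `g` on the group coordinate. -/
def translate (g : G) (z : Ext A G) : Ext A G := (z.1, g * z.2)

/-- The cocycle multiplies on the right, so left translations are symmetries of the extension. They
reduce statements about any fibre to `X_id`. -/
theorem extMap_iterate_translate (g : G) (n : ℕ) (z : Ext A G) :
    (extMap ψ)^[n] (translate g z) = translate g ((extMap ψ)^[n] z) := by
  refine Function.Commute.iterate_left (f := extMap ψ) (fun z => ?_) n z
  simp [extMap, translate, mul_assoc]

/-- Left translation as a permutation of the phase space. -/
def translateEquiv (A : W → W → Prop) (g : G) : Ext A G ≃ Ext A G where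
  toFun := translate g
  invFun := translate g⁻¹
  left_inv z := by simp [translate]
  right_inv z := by simp [translate]

theorem extMap_iterate_splice {n : ℕ} {y : Ext A G} {x : Chain A}
    (h : A (y.1.1 n) (x.1 0)) :
    (extMap ψ)^[n + 1] (splice n y.1 x h, y.2) = (x, ((extMap ψ)^[n + 1] y).2) := by
  refine Prod.ext ?_ ?_
  · rw [extMap_iterate_fst]
    exact shift_iterate_splice h
  · exact extMap_iterate_snd_congr _ rfl fun i hi => splice_apply_of_le h (by omega)

/-- Transitivity only produces an orbit ending in the cylinder of `x 0`; splicing `x` onto its word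
makes the orbit end exactly at `x`. -/
theorem TopTransitiveExt.exists_path (htrans : TopTransitiveExt A ψ) (a : W) (g h : G)
    (x : Chain A) :
    ∃ (n : ℕ) (q : Chain A), q.1 0 = a ∧ (extMap ψ)^[n + 1] (q, g) = (x, h) := by
  obtain ⟨n, hn, z', ⟨z, ⟨hza, hzg⟩, rfl⟩, hb, hh⟩ := htrans a (x.1 0) g h
  obtain ⟨m, rfl⟩ := Nat.exists_eq_add_of_le' hn
  have hadm : A (z.1.1 m) (x.1 0) := by
    have h1 := z.1.2 m
    have h2 : z.1.1 (m + 1) = x.1 0 := by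
      rw [extMap_iterate_fst, shift_iterate_apply, zero_add] at hb
      exact hb
    rwa [h2] at h1
  refine ⟨m, splice m z.1 x hadm, ?_, ?_⟩
  · rw [splice_apply_of_le hadm (Nat.zero_le _), hza]
  · rw [← hzg, extMap_iterate_splice hadm]
    exact Prod.ext rfl hh

/-- Sums over the preimages of two points `(x, e)` and `(x', e)` are compared by replacing the
tail `x` with `x'`. -/
theorem tsum_preimage_le (n : ℕ) {x x' : Chain A} {e : G} (w w' : Ext A G → ℝ≥0∞)
    (hA : ∀ y, (extMap ψ)^[n + 1] y = (x, e) → w y ≠ 0 → A (y.1.1 n) (x'.1 0))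
    (H : ∀ y y', (extMap ψ)^[n + 1] y = (x, e) → (extMap ψ)^[n + 1] y' = (x', e) →
      y.2 = y'.2 → (∀ i < n + 1, y.1.1 i = y'.1.1 i) → w y ≤ w' y') :
    ∑' y : {y : Ext A G // (extMap ψ)^[n + 1] y = (x, e)}, w y.1 ≤
      ∑' y : {y : Ext A G // (extMap ψ)^[n + 1] y = (x', e)}, w' y.1 := by
  -- Only preimages of nonzero weight need an admissible splice, so a cutoff in `w` can select the
  -- branches that fit `x'`.
  let S : Set {y : Ext A G // (extMap ψ)^[n + 1] y = (x, e)} := {y | w y.1 ≠ 0}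
  have hadm (y : S) : A (y.1.1.1.1 n) (x'.1 0) := hA y.1.1 y.1.2 y.2
  let ι : S → {y : Ext A G // (extMap ψ)^[n + 1] y = (x', e)} := fun y =>
    ⟨(splice n y.1.1.1 x' (hadm y), y.1.1.2), by
      rw [extMap_iterate_splice (hadm y), y.1.2]⟩
  have hι (y : S) : ∀ i < n + 1, y.1.1.1.1 i = (ι y).1.1.1 i := fun i hi =>
    (splice_apply_of_le (hadm y) (by omega)).symm
  have hinj : Function.Injective ι := by
    intro y y' hyy
    refine Subtype.ext (Subtype.ext (Prod.ext ?_ ?_))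
    · refine eq_of_shift_iterate_eq (n := n + 1) (fun i hi => ?_) ?_
      · rw [hι y i hi, hι y' i hi, hyy]
      · rw [← extMap_iterate_fst (ψ := ψ), ← extMap_iterate_fst (ψ := ψ), y.1.2, y'.1.2]
    · exact congrArg (fun u => u.1.2) hyy
  have hsupp : Function.support (fun y : {y : Ext A G // (extMap ψ)^[n + 1] y = (x, e)} =>
      w y.1) ⊆ S := fun y hy => hy
  rw [← tsum_subtype_eq_of_support_subset hsupp]
  calc ∑' y : S, w y.1.1 ≤ ∑' y : S, w' (ι y).1 :=
        ENNReal.tsum_le_tsum fun y => H _ _ y.1.2 (ι y).2 rfl (hι y)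
    _ ≤ _ := ENNReal.tsum_comp_le_tsum_of_injective hinj
        (fun y : {y : Ext A G // (extMap ψ)^[n + 1] y = (x', e)} => w' y.1)

end Splice

/-! ### Iterates of the Ruelle operator on extended nonnegative functions -/

section Ruelle

variable {W G : Type*} [Group G] {A : W → W → Prop} {ψ : W → G} {φ : Chain A → ℝ}

theorem birkhoffProd_add (m n : ℕ) (x : Chain A) :
    birkhoffProd φ (m + n) x = birkhoffProd φ n x * birkhoffProd φ m (shift^[n] x) := by
  rw [add_comm m n, birkhoffProd, Finset.prod_range_add]
  congr 1
  refine Finset.prod_congr rfl fun i _ => ?_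
  rw [add_comm n i, Function.iterate_add_apply]

theorem birkhoffProd_one (x : Chain A) : birkhoffProd φ 1 x = φ x := by
  simp [birkhoffProd]

theorem birkhoffProd_pos (hφ : ∀ x, 0 < φ x) (n : ℕ) (x : Chain A) : 0 < birkhoffProd φ n x :=
  Finset.prod_pos fun _ _ => hφ _

variable (ψ φ) in
/-- `𝓛ⁿ F (ζ) = ∑_{Tⁿ y = ζ} Φ_n (y) F (y)`. -/
def ruelle (n : ℕ) (F : Ext A G → ℝ≥0∞) (ζ : Ext A G) : ℝ≥0∞ :=
  ∑' y : {y : Ext A G // (extMap ψ)^[n] y = ζ}, ENNReal.ofReal (birkhoffProd φ n y.1.1) * F y.1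

theorem ruelle_mono (n : ℕ) {F F' : Ext A G → ℝ≥0∞} (h : ∀ y, F y ≤ F' y) (ζ : Ext A G) :
    ruelle ψ φ n F ζ ≤ ruelle ψ φ n F' ζ :=
  ENNReal.tsum_le_tsum fun y => by gcongr; exact h _

theorem ruelle_const_mul (n : ℕ) (c : ℝ≥0∞) (F : Ext A G → ℝ≥0∞) (ζ : Ext A G) :
    ruelle ψ φ n (fun y => c * F y) ζ = c * ruelle ψ φ n F ζ := by
  rw [ruelle, ruelle, ← ENNReal.tsum_mul_left]
  exact tsum_congr fun y => mul_left_comm _ _ _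

theorem ruelle_tsum {ι : Type*} (n : ℕ) (F : ι → Ext A G → ℝ≥0∞) (ζ : Ext A G) :
    ruelle ψ φ n (fun y => ∑' i, F i y) ζ = ∑' i, ruelle ψ φ n (F i) ζ := by
  simp only [ruelle, ← ENNReal.tsum_mul_left]
  exact ENNReal.tsum_comm

theorem ruelle_finset_sum {ι : Type*} (I : Finset ι) (n : ℕ) (F : ι → Ext A G → ℝ≥0∞)
    (ζ : Ext A G) :
    ruelle ψ φ n (fun y => ∑ i ∈ I, F i y) ζ = ∑ i ∈ I, ruelle ψ φ n (F i) ζ := by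
  simp only [ruelle, Finset.mul_sum]
  exact Summable.tsum_finsetSum fun _ _ => ENNReal.summable

theorem ruelle_add (hφ : ∀ x, 0 < φ x) (m n : ℕ) (F : Ext A G → ℝ≥0∞) (ζ : Ext A G) :
    ruelle ψ φ (m + n) F ζ = ruelle ψ φ m (ruelle ψ φ n F) ζ := by
  -- Preimages under m + n steps are grouped according to their image after n steps.
  let E : (Σ u : {u : Ext A G // (extMap ψ)^[m] u = ζ}, {y : Ext A G // (extMap ψ)^[n] y = u.1}) ≃
      {y : Ext A G // (extMap ψ)^[m + n] y = ζ} :=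
    { toFun := fun p => ⟨p.2.1, by rw [Function.iterate_add_apply, p.2.2, p.1.2]⟩
      invFun := fun y => ⟨⟨(extMap ψ)^[n] y.1, by
        rw [← Function.iterate_add_apply]; exact y.2⟩, ⟨y.1, rfl⟩⟩
      left_inv := by
        rintro ⟨⟨u, hu⟩, ⟨y, hy⟩⟩
        obtain rfl : (extMap ψ)^[n] y = u := hy
        rfl
      right_inv := fun y => rfl }
  rw [ruelle, ← E.tsum_eq, ENNReal.tsum_sigma', ruelle]
  refine tsum_congr fun u => ?_
  rw [ruelle, ← ENNReal.tsum_mul_left]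
  refine tsum_congr fun y => ?_
  change ENNReal.ofReal (birkhoffProd φ (m + n) y.1.1) * F y.1 = _
  rw [birkhoffProd_add, ← extMap_iterate_fst (ψ := ψ), y.2,
    ENNReal.ofReal_mul (birkhoffProd_pos hφ _ _).le]
  ring

theorem mul_le_ruelle (n : ℕ) (F : Ext A G → ℝ≥0∞) {q ζ : Ext A G}
    (h : (extMap ψ)^[n] q = ζ) :
    ENNReal.ofReal (birkhoffProd φ n q.1) * F q ≤ ruelle ψ φ n F ζ :=
  ENNReal.le_tsum (f := fun y : {y : Ext A G // (extMap ψ)^[n] y = ζ} =>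
    ENNReal.ofReal (birkhoffProd φ n y.1.1) * F y.1) ⟨q, h⟩

/-- Keeping a single branch through `q` moves the base point from `q` to `ζ` at the price of p extra
steps. -/
theorem mul_ruelle_le_ruelle (hφ : ∀ x, 0 < φ x) (n p : ℕ) (F : Ext A G → ℝ≥0∞) {q ζ : Ext A G}
    (h : (extMap ψ)^[p] q = ζ) :
    ENNReal.ofReal (birkhoffProd φ p q.1) * ruelle ψ φ n F q ≤ ruelle ψ φ (n + p) F ζ := by
  rw [add_comm, ruelle_add hφ]
  exact mul_le_ruelle p _ h

theorem ruelle_translate (g : G) (n : ℕ) (F : Ext A G → ℝ≥0∞) (ζ : Ext A G) :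
    ruelle ψ φ n F (translate g ζ) = ruelle ψ φ n (fun y => F (translate g y)) ζ := by
  let E : {y : Ext A G // (extMap ψ)^[n] y = ζ} ≃
      {y : Ext A G // (extMap ψ)^[n] y = translate g ζ} :=
    (translateEquiv A g).subtypeEquiv fun y => by
      change _ ↔ (extMap ψ)^[n] (translateEquiv A g y) = translateEquiv A g ζ
      rw [show (extMap ψ)^[n] (translateEquiv A g y) = translateEquiv A g ((extMap ψ)^[n] y) from
        extMap_iterate_translate g n y, EmbeddingLike.apply_eq_iff_eq]
  rw [ruelle, ← E.tsum_eq]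
  rfl

/-- The group coordinate of a preimage is determined by its base point, so the bound on the base
passes to the extension. -/
theorem ruelle_one_le {M : ℝ≥0} (hφ : ∀ x, 0 < φ x)
    (hM : ∀ x : Chain A,
      ∑' y : {y : Chain A // shift y = x}, ENNReal.ofReal (φ y.1) ≤ (M : ℝ≥0∞))
    (n : ℕ) (ζ : Ext A G) : ruelle ψ φ n (fun _ => 1) ζ ≤ (M : ℝ≥0∞) ^ n := by
  have h1 (ζ : Ext A G) : ruelle ψ φ 1 (fun _ => 1) ζ ≤ (M : ℝ≥0∞) := by
    refine le_trans (le_of_eq_of_le ?_ (ENNReal.tsum_comp_le_tsum_of_injective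
      (f := fun y : {y : Ext A G // (extMap ψ)^[1] y = ζ} =>
        (⟨y.1.1, congrArg Prod.fst y.2⟩ : {y : Chain A // shift y = ζ.1})) ?_
        (fun y => ENNReal.ofReal (φ y.1)))) (hM ζ.1)
    · simp only [ruelle, birkhoffProd_one, mul_one]
    · intro y y' h
      have h1 : y.1.1 = y'.1.1 := congrArg Subtype.val h
      have h2 : y.1.2 * ψ (y.1.1.1 0) = ζ.2 := congrArg Prod.snd y.2
      have h3 : y'.1.2 * ψ (y'.1.1.1 0) = ζ.2 := congrArg Prod.snd y'.2
      refine Subtype.ext (Prod.ext h1 ?_)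
      rw [← h1, ← h2] at h3
      exact (mul_right_cancel h3).symm
  induction n generalizing ζ with
  | zero =>
    have h2 : ruelle ψ φ 0 (fun _ => 1) ζ = ∑' y : {y : Ext A G // y = ζ}, 1 := by
      simp [ruelle, birkhoffProd]
    rw [h2, tsum_fintype]
    simp
  | succ n ih =>
    rw [ruelle_add hφ, pow_succ]
    calc ruelle ψ φ n (ruelle ψ φ 1 fun _ => 1) ζ
        ≤ ruelle ψ φ n (fun _ => (M : ℝ≥0∞) * 1) ζ :=
          ruelle_mono n (fun y => by simpa using h1 y) ζ
      _ = M * ruelle ψ φ n (fun _ => 1) ζ := ruelle_const_mul _ _ _ _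
      _ ≤ M * (M : ℝ≥0∞) ^ n := by gcongr; exact ih ζ
      _ = _ := mul_comm _ _

open Classical in
theorem returnSum_eq_ruelle (ξ : Chain A) (n : ℕ) :
    returnSum ψ φ ξ n = ruelle ψ φ n ((fibre A (1 : G)).indicator 1) (ξ, 1) := by
  let S : Set {y : Ext A G // (extMap ψ)^[n] y = (ξ, 1)} := {y | y.1.2 = 1}
  have hsupp : Function.support (fun y : {y : Ext A G // (extMap ψ)^[n] y = (ξ, 1)} =>
      ENNReal.ofReal (birkhoffProd φ n y.1.1) * (fibre A (1 : G)).indicator 1 y.1) ⊆ S := by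
    intro y hy
    by_contra h
    refine hy ?_
    have : y.1 ∉ fibre A (1 : G) := h
    simp [this]
  let E : {x : Chain A // (extMap ψ)^[n] (x, 1) = (ξ, 1)} ≃ S :=
    { toFun := fun x => ⟨⟨(x.1, 1), x.2⟩, rfl⟩
      invFun := fun y => ⟨y.1.1.1, by
        have h : (y.1.1.1, (1 : G)) = y.1.1 := Prod.ext rfl y.2.symm
        rw [h]; exact y.1.2⟩
      left_inv := fun x => rfl
      right_inv := fun y => Subtype.ext (Subtype.ext (Prod.ext rfl y.2.symm)) }
  rw [ruelle, ← tsum_subtype_eq_of_support_subset hsupp, ← E.tsum_eq, returnSum]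
  refine tsum_congr fun x => ?_
  have : (x.1, (1 : G)) ∈ fibre A (1 : G) := rfl
  change _ = ENNReal.ofReal (birkhoffProd φ n x.1) * (fibre A (1 : G)).indicator 1 (x.1, (1 : G))
  simp [this]

end Ruelle

/-! ### Bounded distortion -/

section Distortion

variable {W : Type*} {A : W → W → Prop} {φ : Chain A → ℝ} {r C : ℝ}

/-- Bounded distortion: `Φ_n (y) ≤ exp (C rᵏ) Φ_n (y')` if `y, y'` share `n + k` letters. -/
def HasDistortion (φ : Chain A → ℝ) (r C : ℝ) : Prop :=
  0 ≤ C ∧ ∀ (n k : ℕ) (y y' : Chain A), (∀ i < n + k, y.1 i = y'.1 i) →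
    birkhoffProd φ n y ≤ Real.exp (C * r ^ k) * birkhoffProd φ n y'

theorem LogLocallyHolder.exists_hasDistortion (hφ : ∀ x, 0 < φ x) (hr₀ : 0 < r) (hr₁ : r < 1)
    (hHol : LogLocallyHolder r φ) : ∃ C, HasDistortion φ r C := by
  obtain ⟨C₀, hC₀⟩ := hHol
  have h1r : 0 < 1 - r := by linarith
  refine ⟨|C₀| / (1 - r), by positivity, ?_⟩
  set C := |C₀| / (1 - r) with hC
  have hK : |C₀| = C * (1 - r) := by rw [hC]; field_simp
  have hC0 : 0 ≤ C := by positivity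
  -- The factor 1 - rⁿ is the partial sum of the geometric series of Hölder errors; carrying it
  -- makes the induction on n close.
  suffices h : ∀ (n k : ℕ) (y y' : Chain A), (∀ i < n + k, y.1 i = y'.1 i) →
      birkhoffProd φ n y ≤ Real.exp (C * r ^ k * (1 - r ^ n)) * birkhoffProd φ n y' by
    intro n k y y' hy
    refine (h n k y y' hy).trans ?_
    have h0 := (birkhoffProd_pos hφ n y').le
    refine mul_le_mul_of_nonneg_right (Real.exp_le_exp.2 ?_) h0
    have : 0 ≤ C * r ^ k * r ^ n := by positivity
    linarith
  intro n
  induction n with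
  | zero => intro k y y' _; simp [birkhoffProd]
  | succ n ih =>
    intro k y y' hy
    rw [add_comm n 1, add_comm 1 n, add_comm n 1] at *
    have h1 : φ y ≤ Real.exp (C * (1 - r) * r ^ (1 + n + k)) * φ y' := by
      have h2 := hC₀ (1 + n + k) (by omega) y y' hy
      have h3 : Real.log (φ y) ≤ C * (1 - r) * r ^ (1 + n + k) + Real.log (φ y') := by
        have h4 : C₀ * r ^ (1 + n + k) ≤ |C₀| * r ^ (1 + n + k) := by
          gcongr
          exact le_abs_self _
        rw [hK] at h4
        linarith [le_abs_self (Real.log (φ y) - Real.log (φ y'))]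
      calc φ y = Real.exp (Real.log (φ y)) := (Real.exp_log (hφ y)).symm
        _ ≤ Real.exp (C * (1 - r) * r ^ (1 + n + k) + Real.log (φ y')) := Real.exp_le_exp.2 h3
        _ = _ := by rw [Real.exp_add, Real.exp_log (hφ y')]
    have h2 : birkhoffProd φ n (shift y) ≤
        Real.exp (C * r ^ k * (1 - r ^ n)) * birkhoffProd φ n (shift y') :=
      ih k _ _ fun i hi => hy (i + 1) (by omega)
    have h3 (x : Chain A) : birkhoffProd φ (1 + n) x = φ x * birkhoffProd φ n (shift x) := by
      rw [add_comm, birkhoffProd_add, birkhoffProd_one]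
      rfl
    rw [h3, h3]
    calc φ y * birkhoffProd φ n (shift y)
        ≤ (Real.exp (C * (1 - r) * r ^ (1 + n + k)) * φ y') *
          (Real.exp (C * r ^ k * (1 - r ^ n)) * birkhoffProd φ n (shift y')) := by
          have := (birkhoffProd_pos hφ n (shift y)).le
          have := (hφ y').le
          gcongr
      _ = Real.exp (C * (1 - r) * r ^ (1 + n + k) + C * r ^ k * (1 - r ^ n)) *
          (φ y' * birkhoffProd φ n (shift y')) := by rw [Real.exp_add]; ring
      _ ≤ _ := by
          have := (hφ y').le
          have := (birkhoffProd_pos hφ n (shift y')).le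
          gcongr
          have h5 : r ^ (1 + n) = r * r ^ n := by rw [pow_add, pow_one]
          have h6 : C * (1 - r) * r ^ (1 + n + k) = C * (1 - r) * r ^ k * r ^ n * r := by
            rw [pow_add, h5]; ring
          rw [h5, h6]
          have h7 : 0 ≤ C * (1 - r) * r ^ k * r ^ n := by positivity
          nlinarith

theorem HasDistortion.ofReal_le (hD : HasDistortion φ r C) {n k : ℕ} {y y' : Chain A}
    (h : ∀ i < n + k, y.1 i = y'.1 i) :
    ENNReal.ofReal (birkhoffProd φ n y) ≤
      ENNReal.ofReal (Real.exp (C * r ^ k)) * ENNReal.ofReal (birkhoffProd φ n y') := by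
  rw [← ENNReal.ofReal_mul (Real.exp_pos _).le]
  exact ENNReal.ofReal_le_ofReal (hD.2 n k y y' h)

theorem dShift_self (x : Chain A) : dShift r x x = 0 := by simp [dShift]

theorem dShift_comm (x y : Chain A) : dShift r x y = dShift r y x := by
  by_cases h : x = y
  · rw [h]
  · simp only [dShift, h, Ne.symm h, if_false, PiNat.firstDiff_comm x.1 y.1]

theorem exists_agree_of_dShift_lt_one {x y : Chain A} (hne : x ≠ y) (h : dShift r x y < 1) :
    ∃ k, 1 ≤ k ∧ (∀ i < k, x.1 i = y.1 i) ∧ dShift r x y = r ^ k := by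
  have h1 : dShift r x y = r ^ PiNat.firstDiff x.1 y.1 := by simp [dShift, hne]
  refine ⟨PiNat.firstDiff x.1 y.1, ?_, fun i hi => PiNat.apply_eq_of_lt_firstDiff hi, h1⟩
  by_contra h0
  have : PiNat.firstDiff x.1 y.1 = 0 := by omega
  rw [h1, this, pow_zero] at h
  exact lt_irrefl _ h

theorem dShift_le_of_agree (hr₀ : 0 < r) (hr₁ : r < 1) {x y : Chain A} {k : ℕ}
    (h : ∀ i < k, x.1 i = y.1 i) : dShift r x y ≤ r ^ k := by
  by_cases hxy : x = y
  · subst hxy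
    rw [dShift_self]
    positivity
  · have hne : x.1 ≠ y.1 := fun h => hxy (Subtype.ext h)
    have h2 : k ≤ PiNat.firstDiff x.1 y.1 := by
      by_contra h0
      exact PiNat.apply_firstDiff_ne hne (h _ (by omega))
    simp only [dShift, hxy, if_false]
    exact pow_le_pow_of_le_one hr₀.le hr₁.le h2

theorem dShift_pos (hr₀ : 0 < r) {x y : Chain A} (h : x ≠ y) : 0 < dShift r x y := by
  simp only [dShift, h, if_false]
  positivity

/-- One-sided comparisons in both directions give a relative error with the same constant: the
larger of the two deviations is measured against the smaller number. Hence only upper bounds have to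
be proved elsewhere. -/
theorem abs_sub_le_mul_of_le {a b κ : ℝ} (hκ : 0 ≤ κ) (h₁ : a ≤ (1 + κ) * b)
    (h₂ : b ≤ (1 + κ) * a) : |a - b| ≤ κ * b := by
  rw [abs_le]
  refine ⟨?_, by linarith⟩
  rcases le_total a b with hab | hab
  · have : κ * a ≤ κ * b := by gcongr
    linarith
  · linarith

theorem exp_le_one_add_mul {t C : ℝ} (h₀ : 0 ≤ t) (h₁ : t ≤ 1) (hC : 0 ≤ C) :
    Real.exp (C * t) ≤ 1 + C * Real.exp C * t := by
  have h1 : 1 - C * t ≤ Real.exp (-(C * t)) := by linarith [Real.add_one_le_exp (-(C * t))]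
  have h2 : Real.exp (C * t) * Real.exp (-(C * t)) = 1 := by
    rw [← Real.exp_add, add_neg_cancel, Real.exp_zero]
  have h3 : Real.exp (C * t) ≤ Real.exp C := Real.exp_le_exp.2 (by nlinarith)
  have h4 := Real.exp_pos (C * t)
  have h5 : Real.exp (C * t) * (1 - C * t) ≤ 1 := by
    exact (mul_le_mul_of_nonneg_left h1 h4.le).trans_eq h2
  have h6 : Real.exp (C * t) * (C * t) ≤ Real.exp C * (C * t) := by gcongr
  linarith

theorem HasDistortion.distortionConst_lt_top (hφ : ∀ x, 0 < φ x) (hr₀ : 0 < r) (hr₁ : r < 1)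
    (hD : HasDistortion φ r C) : distortionConst r φ < ⊤ := by
  refine lt_of_le_of_lt ?_ (ENNReal.ofReal_lt_top (r := C * Real.exp C))
  simp only [distortionConst, iSup_le_iff]
  intro n y₁ y₂ hn hag hd
  -- Coincident points enter the supremum harmlessly: the numerator is 0, and 0 / 0 = 0 in `ℝ≥0∞`.
  by_cases hne : shift^[n] y₁ = shift^[n] y₂
  · obtain rfl := eq_of_shift_iterate_eq hag hne
    simp [relDiff]
  obtain ⟨k, hk, hagk, hdk⟩ := exists_agree_of_dShift_lt_one hne hd
  have hag' : ∀ i < n + k, y₁.1 i = y₂.1 i := by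
    intro i hi
    rcases lt_or_ge i n with h | h
    · exact hag i h
    · have := hagk (i - n) (by omega)
      rwa [shift_iterate_apply, shift_iterate_apply, Nat.sub_add_cancel h] at this
  have hp₁ := birkhoffProd_pos hφ n y₁
  have hp₂ := birkhoffProd_pos hφ n y₂
  have hexp := exp_le_one_add_mul (pow_nonneg hr₀.le k) (pow_le_one₀ hr₀.le hr₁.le) hD.1
  have h1 : |birkhoffProd φ n y₁ - birkhoffProd φ n y₂| ≤
      C * Real.exp C * r ^ k * birkhoffProd φ n y₂ := by
    have hC := hD.1
    refine abs_sub_le_mul_of_le (by positivity) ?_ ?_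
    · exact (hD.2 n k _ _ hag').trans (by gcongr)
    · exact (hD.2 n k _ _ fun i hi => (hag' i hi).symm).trans (by gcongr)
  rw [hdk, relDiff, abs_of_pos hp₂]
  have hrk : 0 < r ^ k := by positivity
  refine ENNReal.div_le_of_le_mul (ENNReal.div_le_of_le_mul ?_)
  rw [← ENNReal.ofReal_mul (by have := hD.1; positivity),
    ← ENNReal.ofReal_mul (by have := hD.1; positivity)]
  exact ENNReal.ofReal_le_ofReal h1

/-- The sharp constant is used here instead of that of `HasDistortion`, because the final bound on
`LD` is exactly `distortionConst`. -/
theorem ofReal_birkhoffProd_le_distortionConst (hφ : ∀ x, 0 < φ x) {n : ℕ}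
    (hn : 1 ≤ n) {y₁ y₂ : Chain A} (hag : ∀ i < n, y₁.1 i = y₂.1 i)
    (hd : dShift r (shift^[n] y₁) (shift^[n] y₂) < 1)
    (hd0 : 0 < dShift r (shift^[n] y₁) (shift^[n] y₂)) :
    ENNReal.ofReal (birkhoffProd φ n y₁) ≤ (1 + distortionConst r φ *
      ENNReal.ofReal (dShift r (shift^[n] y₁) (shift^[n] y₂))) *
        ENNReal.ofReal (birkhoffProd φ n y₂) := by
  set d := dShift r (shift^[n] y₁) (shift^[n] y₂) with hdd
  have h1 : relDiff (birkhoffProd φ n y₁) (birkhoffProd φ n y₂) / ENNReal.ofReal d ≤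
      distortionConst r φ := by
    simp only [distortionConst]
    exact le_iSup_of_le n (le_iSup_of_le y₁ (le_iSup_of_le y₂ (le_iSup_of_le hn
      (le_iSup_of_le hag (le_iSup_of_le hd le_rfl)))))
  have hp₂ := birkhoffProd_pos hφ n y₂
  rw [ENNReal.div_le_iff (by simpa using hd0) ENNReal.ofReal_ne_top, relDiff,
    abs_of_pos hp₂, ENNReal.div_le_iff (by simpa using hp₂) ENNReal.ofReal_ne_top] at h1
  calc ENNReal.ofReal (birkhoffProd φ n y₁)
      ≤ ENNReal.ofReal (birkhoffProd φ n y₂ + |birkhoffProd φ n y₁ - birkhoffProd φ n y₂|) :=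
        ENNReal.ofReal_le_ofReal (by
          linarith [le_abs_self (birkhoffProd φ n y₁ - birkhoffProd φ n y₂)])
    _ = ENNReal.ofReal (birkhoffProd φ n y₂) +
          ENNReal.ofReal |birkhoffProd φ n y₁ - birkhoffProd φ n y₂| :=
        ENNReal.ofReal_add hp₂.le (abs_nonneg _)
    _ ≤ _ := by rw [add_mul, one_mul]; gcongr

end Distortion

/-! ### Comparison of sums over preimages of different points -/

section Comparison

variable {W G : Type*} [Group G] {A : W → W → Prop} {ψ : W → G} {φ : Chain A → ℝ} {r C : ℝ}

theorem adm_of_extMap_iterate_eq {n : ℕ} {y : Ext A G} {x x' : Chain A} {e : G}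
    (h : (extMap ψ)^[n + 1] y = (x, e)) (h0 : x.1 0 = x'.1 0) : A (y.1.1 n) (x'.1 0) := by
  have h1 := y.1.2 n
  have h2 : y.1.1 (n + 1) = x.1 0 := by
    have := shift_iterate_apply (n + 1) y.1 0
    rw [← extMap_iterate_fst (ψ := ψ), h, zero_add] at this
    exact this.symm
  rwa [h2, h0] at h1

theorem agree_add_of_extMap_iterate_eq {n k : ℕ} {y y' : Ext A G} {x x' : Chain A} {e e' : G}
    (h : (extMap ψ)^[n] y = (x, e)) (h' : (extMap ψ)^[n] y' = (x', e'))
    (hag : ∀ i < n, y.1.1 i = y'.1.1 i) (hk : ∀ i < k, x.1 i = x'.1 i) :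
    ∀ i < n + k, y.1.1 i = y'.1.1 i := by
  intro i hi
  rcases lt_or_ge i n with h0 | h0
  · exact hag i h0
  · have h1 := shift_iterate_apply n y.1 (i - n)
    have h2 := shift_iterate_apply n y'.1 (i - n)
    rw [← extMap_iterate_fst (ψ := ψ), h, Nat.sub_add_cancel h0] at h1
    rw [← extMap_iterate_fst (ψ := ψ), h', Nat.sub_add_cancel h0] at h2
    rw [← h1, ← h2]
    exact hk _ (by omega)

/-- A shared first letter makes every splice admissible, and matched preimages then share n + 1 + k
letters. Taking `F` and `F'` separately allows any pair comparable on points with n + 1 common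
letters. -/
theorem HasDistortion.ruelle_le (hD : HasDistortion φ r C) (n : ℕ) {k : ℕ} (hk : 1 ≤ k)
    {x x' : Chain A} (hag : ∀ i < k, x.1 i = x'.1 i) (e : G) {F F' : Ext A G → ℝ≥0∞}
    (hF : ∀ y y' : Ext A G, y.2 = y'.2 → (∀ i < n + 1, y.1.1 i = y'.1.1 i) → F y ≤ F' y') :
    ruelle ψ φ (n + 1) F (x, e) ≤
      ENNReal.ofReal (Real.exp (C * r ^ k)) * ruelle ψ φ (n + 1) F' (x', e) := by
  rw [← ruelle_const_mul]
  refine tsum_preimage_le n (fun y => ENNReal.ofReal (birkhoffProd φ (n + 1) y.1) * F y)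
    (fun y => ENNReal.ofReal (birkhoffProd φ (n + 1) y.1) *
      (ENNReal.ofReal (Real.exp (C * r ^ k)) * F' y))
    (fun y hy _ => adm_of_extMap_iterate_eq hy (hag 0 hk)) fun y y' hy hy' h2 hn => ?_
  calc _ ≤ (ENNReal.ofReal (Real.exp (C * r ^ k)) *
        ENNReal.ofReal (birkhoffProd φ (n + 1) y'.1)) * F' y' := by
        gcongr
        · exact hD.ofReal_le (agree_add_of_extMap_iterate_eq hy hy' hn hag)
        · exact hF y y' h2 hn
    _ = _ := by ring

/-- Sums over the preimages of an arbitrary point are dominated by sums over the preimages of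
finitely many points, one in each big image. -/
theorem HasDistortion.ruelle_le_sum (hD : HasDistortion φ r C) {I : Finset W}
    (hI : ∀ v, ∃ β ∈ I, A v β) (q : W → Chain A) (hq : ∀ β, (q β).1 0 = β) (n : ℕ)
    (x : Chain A) (e : G) {F : Ext A G → ℝ≥0∞} (hF : ∀ y y' : Ext A G, y.2 = y'.2 → F y = F y') :
    ruelle ψ φ (n + 1) F (x, e) ≤
      ∑ β ∈ I, ENNReal.ofReal (Real.exp C) * ruelle ψ φ (n + 1) F (q β, e) := by
  classical
  have key (β : W) : ruelle ψ φ (n + 1) (fun y => if A (y.1.1 n) β then F y else 0) (x, e) ≤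
      ENNReal.ofReal (Real.exp C) * ruelle ψ φ (n + 1) F (q β, e) := by
    rw [← ruelle_const_mul]
    refine tsum_preimage_le n
      (fun y => ENNReal.ofReal (birkhoffProd φ (n + 1) y.1) *
        (if A (y.1.1 n) β then F y else 0))
      (fun y => ENNReal.ofReal (birkhoffProd φ (n + 1) y.1) *
        (ENNReal.ofReal (Real.exp C) * F y)) (fun y _ hy0 => ?_) fun y y' _ _ h2 hn => ?_
    · rw [hq]
      by_contra h
      simp [h] at hy0
    · have h1 := hD.ofReal_le (n := n + 1) (k := 0) hn
      rw [pow_zero, mul_one] at h1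
      calc _ ≤ (ENNReal.ofReal (Real.exp C) *
            ENNReal.ofReal (birkhoffProd φ (n + 1) y'.1)) * F y' := by
            gcongr
            split_ifs
            · exact (hF y y' h2).le
            · exact zero_le
        _ = _ := by ring
  calc ruelle ψ φ (n + 1) F (x, e)
      ≤ ruelle ψ φ (n + 1) (fun y => ∑ β ∈ I, if A (y.1.1 n) β then F y else 0) (x, e) := by
        refine ruelle_mono _ (fun y => ?_) _
        obtain ⟨β, hβ, hA⟩ := hI (y.1.1 n)
        refine le_trans ?_ (Finset.single_le_sum
          (f := fun β => if A (y.1.1 n) β then F y else 0) (fun _ _ => zero_le) hβ)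
        simp [hA]
    _ = ∑ β ∈ I, ruelle ψ φ (n + 1) (fun y => if A (y.1.1 n) β then F y else 0) (x, e) :=
        ruelle_finset_sum _ _ _ _
    _ ≤ _ := Finset.sum_le_sum fun β _ => key β

/-- Up to a constant and a bounded change of time, `𝓛ⁿ F (x, e)` is dominated by its value at
`(ξ, e)`, uniformly in `x` and `e`, if `F` depends on the fibre only. -/
theorem HasDistortion.exists_ruelle_le_sum_base (hφ : ∀ x, 0 < φ x) (hD : HasDistortion φ r C)
    (hbip : BigImagesPreimages A) (htrans : TopTransitiveExt A ψ) (ξ : Chain A) :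
    ∃ (I : Finset W) (p : W → ℕ) (K : W → ℝ≥0∞), (∀ β, K β ≠ ⊤) ∧
      ∀ (n : ℕ) (x : Chain A) (e : G) (F : Ext A G → ℝ≥0∞),
        (∀ y y' : Ext A G, y.2 = y'.2 → F y = F y') →
        ruelle ψ φ (n + 1) F (x, e) ≤
          ∑ β ∈ I, K β * ruelle ψ φ (n + 1 + p β) F (ξ, e) := by
  obtain ⟨I, hI⟩ := hbip
  choose p q hq0 hq using fun β : W => htrans.exists_path β 1 1 ξ
  have hpos (β : W) : ENNReal.ofReal (birkhoffProd φ (p β + 1) (q β)) ≠ 0 := by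
    simpa using birkhoffProd_pos hφ _ _
  refine ⟨I, fun β => p β + 1, fun β => ENNReal.ofReal (Real.exp C) *
    (ENNReal.ofReal (birkhoffProd φ (p β + 1) (q β)))⁻¹, fun β => ?_, fun n x e F hF => ?_⟩
  · exact ENNReal.mul_ne_top ENNReal.ofReal_ne_top (ENNReal.inv_ne_top.2 (hpos β))
  refine (hD.ruelle_le_sum (fun v => ?_) q hq0 n x e hF).trans (Finset.sum_le_sum fun β _ => ?_)
  · obtain ⟨β₁, h₁, _, _, h, _⟩ := hI v
    exact ⟨β₁, h₁, h⟩
  · rw [mul_assoc]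
    gcongr
    rw [← ENNReal.mul_le_iff_le_inv (hpos β) ENNReal.ofReal_ne_top]
    refine mul_ruelle_le_ruelle hφ (n + 1) (p β + 1) F (q := (q β, e)) ?_
    -- The connecting path is chosen in `X_id` and translated by `e`, which keeps the constants
    -- independent of `e`.
    have := extMap_iterate_translate (ψ := ψ) e (p β + 1) (q β, 1)
    rw [hq] at this
    simpa [translate] using this

/-- Weights of the last step into `ζ` are dominated by weights of first steps, with a bounded
change of time. -/
theorem HasDistortion.exists_last_le_first (hφ : ∀ x, 0 < φ x) (hD : HasDistortion φ r C)
    (hbip : BigImagesPreimages A) (htrans : TopTransitiveExt A ψ) (ζ : Ext A G) (g : G) :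
    ∃ (I : Finset W) (p : W → ℕ) (K : W → ℝ≥0∞), (∀ β, K β ≠ ⊤) ∧
      ∀ (S : Set W) (y : Ext A G),
        ruelle ψ φ 1 ({u : Ext A G | u.1.1 0 ∈ S ∧ u.2 * y.2 = g}.indicator 1) ζ ≤
          ∑ β ∈ I, K β *
            ruelle ψ φ (p β) ({u : Ext A G | u.1.1 0 ∈ S ∧ u.2 = 1}.indicator 1) y := by
  classical
  obtain ⟨I, hI⟩ := hbip
  obtain ⟨x, h⟩ := ζ
  choose _ z hz0 _ using fun β : W => htrans.exists_path β 1 1 x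
  -- The path starts with the first letter of `x` and stops just before reading β; the factor (ψ
  -- β)⁻¹ makes the group coordinate equal to `g` once β is read.
  choose m q hq0 hq using fun β : W => htrans.exists_path (x.1 0) h (g * (ψ β)⁻¹) (z β)
  have hqβ (β : W) : (q β).1 (m β + 1) = β := by
    have := shift_iterate_apply (m β + 1) (q β) 0
    have h1 := extMap_iterate_fst (ψ := ψ) (m β + 1) (q β, h)
    rw [hq] at h1
    rw [← h1, zero_add, hz0] at this
    exact this.symm
  have hqg (β : W) : ((extMap ψ)^[m β + 1 + 1] (q β, h)).2 = g := by
    rw [Function.iterate_succ_apply', hq]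
    simp [extMap, hz0]
  have hpos (β : W) : ENNReal.ofReal (birkhoffProd φ (m β + 1 + 1) (q β)) ≠ 0 := by
    simpa using birkhoffProd_pos hφ _ _
  refine ⟨I, fun β => 1 + (m β + 1 + 1), fun β => ENNReal.ofReal (Real.exp (C * r ^ 1)) *
    ((ENNReal.ofReal (birkhoffProd φ (m β + 1 + 1) (q β)))⁻¹ *
      ENNReal.ofReal (Real.exp (C * r ^ 0))), fun β => ?_, fun S y => ?_⟩
  · exact ENNReal.mul_ne_top ENNReal.ofReal_ne_top
      (ENNReal.mul_ne_top (ENNReal.inv_ne_top.2 (hpos β)) ENNReal.ofReal_ne_top)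
  obtain ⟨_, _, β, hβ, _, hAβ⟩ := hI (y.1.1 0)
  refine le_trans ?_ (Finset.single_le_sum (fun _ _ => zero_le) hβ)
  have hadm : A ((q β).1 (m β + 1)) (y.1.1 0) := by rwa [hqβ]
  -- The point `v` reads the path up to β and continues as `y`. It begins like `x`, so a first step
  -- into `x` can be redirected into `v`; translating by `y.2 * g⁻¹` makes the orbit end at `y` and
  -- turns the constraint `u.2 * y.2 = g` into `u.2 = 1`.
  set v := splice (m β + 1) (q β) y.1 hadm with hv
  have hvT : (extMap ψ)^[m β + 1 + 1] (translate (y.2 * g⁻¹) (v, h)) = y := by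
    have h1 := extMap_iterate_splice (ψ := ψ) (n := m β + 1) (y := (q β, h)) (x := y.1) hadm
    rw [hqg] at h1
    rw [extMap_iterate_translate, hv, h1]
    simp [translate]
  have hv0 : ∀ i < 1, x.1 i = v.1 i := by
    intro i hi
    obtain rfl : i = 0 := by omega
    rw [hv, splice_apply_of_le hadm (Nat.zero_le _), hq0]
  have hqv : ∀ i < m β + 1 + 1 + 0, (q β).1 i = v.1 i := fun i hi =>
    (splice_apply_of_le hadm (by omega)).symm
  have htr (u : Ext A G) : ({u : Ext A G | u.1.1 0 ∈ S ∧ u.2 = 1}.indicator 1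
      (translate (y.2 * g⁻¹) u) : ℝ≥0∞) =
      {u : Ext A G | u.1.1 0 ∈ S ∧ u.2 * y.2 = g}.indicator 1 u := by
    have : y.2 * g⁻¹ * u.2 = 1 ↔ u.2 * y.2 = g := by
      constructor
      · intro h
        rw [eq_inv_of_mul_eq_one_right h]
        group
      · rintro rfl
        group
    simp [Set.indicator_apply, translate, this]
  have h1 : ruelle ψ φ 1 ({u : Ext A G | u.1.1 0 ∈ S ∧ u.2 * y.2 = g}.indicator 1) (x, h) ≤
      ENNReal.ofReal (Real.exp (C * r ^ 1)) *
        ruelle ψ φ 1 ({u : Ext A G | u.1.1 0 ∈ S ∧ u.2 = 1}.indicator 1)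
          (translate (y.2 * g⁻¹) (v, h)) := by
    rw [ruelle_translate]
    simp only [htr]
    refine hD.ruelle_le 0 le_rfl hv0 h fun u u' h2 h0 => ?_
    have : u.1.1 0 = u'.1.1 0 := h0 0 (by omega)
    simp [Set.indicator_apply, h2, this]
  refine h1.trans ?_
  simp only [mul_assoc]
  gcongr
  rw [← ENNReal.mul_le_iff_le_inv (hpos β) ENNReal.ofReal_ne_top]
  calc _ ≤ ENNReal.ofReal (Real.exp (C * r ^ 0)) *
        (ENNReal.ofReal (birkhoffProd φ (m β + 1 + 1) v) * _) := by
        rw [← mul_assoc]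
        gcongr
        exact hD.ofReal_le hqv
    _ ≤ _ := by
        gcongr
        exact mul_ruelle_le_ruelle hφ 1 (m β + 1 + 1) _ hvT

end Comparison

/-! ### Positivity of the spectral radius -/

section SpecRad

variable {W G : Type*} [Group G] {A : W → W → Prop} {ψ : W → G} {φ : Chain A → ℝ} {r C : ℝ}

/-- Returns to `B` can be concatenated, so a uniform lower bound for one return is multiplicative.
-/
theorem pow_mul_indicator_le_ruelle (hφ : ∀ x, 0 < φ x) {p : ℕ} {c : ℝ≥0∞} {B : Set (Ext A G)}
    (h : ∀ z ∈ B, c ≤ ruelle ψ φ p (B.indicator 1) z) (k : ℕ) :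
    ∀ z ∈ B, c ^ k ≤ ruelle ψ φ (k * p) (B.indicator 1) z := by
  classical
  induction k with
  | zero =>
    intro z hz
    have := mul_le_ruelle (φ := φ) (ψ := ψ) 0 (B.indicator 1) (q := z) (ζ := z) rfl
    simpa [birkhoffProd, hz] using this
  | succ k ih =>
    intro z hz
    rw [pow_succ, add_mul, one_mul, add_comm (k * p), ruelle_add hφ]
    calc c ^ k * c ≤ c ^ k * ruelle ψ φ p (B.indicator 1) z := by gcongr; exact h z hz
      _ = ruelle ψ φ p (fun y => c ^ k * B.indicator 1 y) z := (ruelle_const_mul _ _ _ _).symm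
      _ ≤ _ := by
        refine ruelle_mono _ (fun y => ?_) _
        by_cases hy : y ∈ B
        · simpa [hy] using ih y hy
        · simp [hy]

theorem returnSum_le {M : ℝ≥0} (hφ : ∀ x, 0 < φ x)
    (hM : ∀ x : Chain A,
      ∑' y : {y : Chain A // shift y = x}, ENNReal.ofReal (φ y.1) ≤ (M : ℝ≥0∞))
    (ξ : Chain A) (n : ℕ) : returnSum ψ φ ξ n ≤ (M : ℝ≥0∞) ^ n := by
  classical
  rw [returnSum_eq_ruelle]
  exact (ruelle_mono n (fun y => Set.indicator_le_self' (fun _ _ => zero_le) y) _).trans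
    (ruelle_one_le hφ hM n _)

/-- A single loop based in the cylinder of `ξ 0` has, by distortion, a weight bounded below from
every point of that cylinder; repeating it gives exponential growth along multiples of its length.
-/
theorem HasDistortion.specRad_pos {M : ℝ≥0} (hφ : ∀ x, 0 < φ x) (hD : HasDistortion φ r C)
    (hM : ∀ x : Chain A,
      ∑' y : {y : Chain A // shift y = x}, ENNReal.ofReal (φ y.1) ≤ (M : ℝ≥0∞))
    (htrans : TopTransitiveExt A ψ) (ξ : Chain A) : 0 < specRad ψ φ ξ := by
  classical
  obtain ⟨p, q, hq0, hq⟩ := htrans.exists_path (ξ.1 0) 1 1 ξ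
  set B : Set (Ext A G) := {u | u.1.1 0 = ξ.1 0 ∧ u.2 = 1} with hB
  set c : ℝ≥0∞ := (ENNReal.ofReal (Real.exp (C * r ^ 1)))⁻¹ *
    ENNReal.ofReal (birkhoffProd φ (p + 1) q) with hc
  have hexp : ENNReal.ofReal (Real.exp (C * r ^ 1)) ≠ 0 := by
    simpa using Real.exp_pos _
  have hc0 : c ≠ 0 := by
    refine mul_ne_zero (ENNReal.inv_ne_zero.2 ENNReal.ofReal_ne_top) ?_
    simpa using birkhoffProd_pos hφ _ _
  have hstep : ∀ z ∈ B, c ≤ ruelle ψ φ (p + 1) (B.indicator 1) z := by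
    rintro ⟨x, e⟩ ⟨hx, rfl : e = 1⟩
    have hqB : (q, (1 : G)) ∈ B := ⟨hq0, rfl⟩
    have h1 := mul_le_ruelle (φ := φ) (p + 1) (B.indicator 1) hq
    rw [Set.indicator_of_mem hqB, Pi.one_apply, mul_one] at h1
    have h2 := hD.ruelle_le (ψ := ψ) p (k := 1) le_rfl (x := ξ) (x' := x)
      (fun i hi => by obtain rfl : i = 0 := by omega
                      exact hx.symm) 1 (F := B.indicator 1) (F' := B.indicator 1)
      (fun y y' h2 h0 => by
        have : y.1.1 0 = y'.1.1 0 := h0 0 (by omega)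
        simp [Set.indicator_apply, hB, h2, this])
    rw [hc, mul_comm, ← div_eq_mul_inv]
    exact ENNReal.div_le_of_le_mul' (h1.trans h2)
  have hξB : (ξ, (1 : G)) ∈ B := ⟨rfl, rfl⟩
  have hret (k : ℕ) : c ^ k ≤ returnSum ψ φ ξ (k * (p + 1)) := by
    rw [returnSum_eq_ruelle]
    refine (pow_mul_indicator_le_ruelle hφ hstep k _ hξB).trans (ruelle_mono _ (fun y => ?_) _)
    exact Set.indicator_le_indicator_of_subset (fun y hy => hy.2) (fun _ => zero_le) y
  have hlow : c ^ (1 / ((p : ℝ) + 1)) ≤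
      limsup (fun n : ℕ => returnSum ψ φ ξ n ^ (1 / (n : ℝ))) atTop := by
    refine le_limsup_of_frequently_le ?_
    refine frequently_atTop.2 fun n => ⟨(n + 1) * (p + 1), by nlinarith, ?_⟩
    refine le_trans (le_of_eq ?_) (ENNReal.rpow_le_rpow (hret (n + 1)) (by positivity))
    rw [← ENNReal.rpow_natCast, ← ENNReal.rpow_mul]
    congr 1
    push_cast
    field_simp
  -- Finiteness is needed as well, since `toReal` would send an infinite limsup to 0.
  have hup : limsup (fun n : ℕ => returnSum ψ φ ξ n ^ (1 / (n : ℝ))) atTop ≤ M := by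
    refine limsup_le_of_le (h := ?_)
    filter_upwards [eventually_ge_atTop 1] with n hn
    have hn0 : (n : ℝ) ≠ 0 := by positivity
    refine (ENNReal.rpow_le_rpow (returnSum_le hφ hM ξ n) (by positivity)).trans (le_of_eq ?_)
    rw [← ENNReal.rpow_natCast, ← ENNReal.rpow_mul, mul_one_div_cancel hn0, ENNReal.rpow_one]
  refine ENNReal.toReal_pos (ne_of_gt (lt_of_lt_of_le ?_ hlow))
    (ne_top_of_le_ne_top ENNReal.coe_ne_top hup)
  refine ENNReal.rpow_pos (pos_iff_ne_zero.2 hc0) ?_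
  exact ENNReal.mul_ne_top (ENNReal.inv_ne_top.2 hexp) ENNReal.ofReal_ne_top

end SpecRad

/-! ### Nonnegative harmonic functions -/

section Harmonic

variable {W G : Type*} {A : W → W → Prop} {φ : Chain A → ℝ} {r C : ℝ}

theorem dExt_of_snd_eq {z₁ z₂ : Ext A G} (h : z₁.2 = z₂.2) :
    dExt r z₁ z₂ = dShift r z₁.1 z₂.1 := by
  simp [dExt, h]

theorem snd_eq_of_dExt_lt_one {z₁ z₂ : Ext A G} (h : dExt r z₁ z₂ < 1) : z₁.2 = z₂.2 := by
  by_contra hne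
  simp [dExt, hne] at h

theorem logLip_le_of_le_mul (hr₀ : 0 < r) {f : Ext A G → ℝ} (hf : ∀ z, 0 ≤ f z) (hC : 0 ≤ C)
    (h : ∀ (x x' : Chain A) (e : G), x ≠ x' → dShift r x x' < 1 →
      f (x, e) ≤ (1 + C * dShift r x x') * f (x', e)) :
    logLip r f ≤ ENNReal.ofReal C := by
  simp only [logLip, iSup_le_iff]
  rintro ⟨x, e⟩ ⟨x', e'⟩ hd
  obtain rfl : e = e' := snd_eq_of_dExt_lt_one hd
  rw [dExt_of_snd_eq (z₁ := (x, e)) (z₂ := (x', e)) rfl] at hd ⊢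
  by_cases hne : x = x'
  · subst hne
    simp [relDiff]
  have hd0 := dShift_pos hr₀ hne
  have h1 : |f (x, e) - f (x', e)| ≤ C * dShift r x x' * f (x', e) :=
    abs_sub_le_mul_of_le (by positivity) (h x x' e hne hd)
      (by rw [dShift_comm]; exact h x' x e (Ne.symm hne) (by rwa [dShift_comm]))
  rw [relDiff, abs_of_nonneg (hf _)]
  refine ENNReal.div_le_of_le_mul (ENNReal.div_le_of_le_mul ?_)
  rw [← ENNReal.ofReal_mul hC, ← ENNReal.ofReal_mul (by positivity)]
  exact ENNReal.ofReal_le_ofReal h1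

theorem ofReal_sub_le_of_locLip_le (hr₀ : 0 < r) {f : Ext A G → ℝ} {y y' : Ext A G} {H : ℝ≥0∞}
    (h : locLip r f y ≤ H) (h2 : y.2 = y'.2) (hd : dShift r y.1 y'.1 < 1) :
    ENNReal.ofReal |f y - f y'| ≤ H * ENNReal.ofReal (dShift r y.1 y'.1) := by
  by_cases hne : y.1 = y'.1
  · obtain rfl : y = y' := Prod.ext hne h2
    simp
  have hd0 := dShift_pos hr₀ hne
  have hdE := dExt_of_snd_eq (r := r) h2
  have h1 : ENNReal.ofReal |f y - f y'| / ENNReal.ofReal (dExt r y y') ≤ H := by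
    refine le_trans ?_ h
    simp only [locLip]
    exact le_iSup_of_le y' (le_iSup_of_le (by rwa [hdE]) le_rfl)
  rwa [hdE, ENNReal.div_le_iff (by simpa using hd0) ENNReal.ofReal_ne_top] at h1

variable [Group G] {ψ : W → G}

/-- Nonnegativity turns the unconditional real series into sums in `ℝ≥0∞`, where iteration needs no
summability. -/
theorem IsHarmonic.ruelle_ofReal {t : ℝ} {f : Ext A G → ℝ} (hφ : ∀ x, 0 < φ x) (ht : 0 ≤ t)
    (hf : ∀ z, 0 ≤ f z) (hfh : IsHarmonic ψ φ t f) (n : ℕ) (z : Ext A G) :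
    ruelle ψ φ n (fun y => ENNReal.ofReal (f y)) z = ENNReal.ofReal (t ^ n * f z) := by
  have h1 (z : Ext A G) : ruelle ψ φ 1 (fun y => ENNReal.ofReal (f y)) z =
      ENNReal.ofReal t * ENNReal.ofReal (f z) := by
    rw [← ENNReal.ofReal_mul ht, ← (hfh z).tsum_eq,
      ENNReal.ofReal_tsum_of_nonneg (fun y => mul_nonneg (hφ _).le (hf _)) (hfh z).summable]
    refine tsum_congr fun y => ?_
    rw [birkhoffProd_one, ENNReal.ofReal_mul (hφ _).le]
  induction n generalizing z with
  | zero =>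
    have h2 : ruelle ψ φ 0 (fun y => ENNReal.ofReal (f y)) z =
        ∑' y : {y : Ext A G // y = z}, ENNReal.ofReal (f y.1) := by
      simp [ruelle, birkhoffProd]
    rw [h2, tsum_eq_single (⟨z, rfl⟩ : {y : Ext A G // y = z})
      fun y hy => absurd (Subtype.ext y.2) hy, pow_zero, one_mul]
  | succ n ih =>
    have h3 : ruelle ψ φ 1 (fun y => ENNReal.ofReal (f y)) =
        fun z => ENNReal.ofReal t * ENNReal.ofReal (f z) := funext h1
    rw [ruelle_add hφ, h3, ruelle_const_mul, ih, ← ENNReal.ofReal_mul ht]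
    congr 1
    ring

/-- After n + 1 backward steps matched preimages are within r^(n + 1 + k), so replacing f(y) by
f(y') costs r^(n + 1 + k) h(y). Harmonicity of `h` prevents this error from growing when it is
summed and normalised, and only the distortion of the branches survives as n → ∞. -/
theorem IsHarmonic.le_mul_of_locLip_le {t : ℝ} {f h : Ext A G → ℝ} (hφ : ∀ x, 0 < φ x)
    (hr₀ : 0 < r) (hr₁ : r < 1) (ht : 0 < t) (hCφ : distortionConst r φ ≠ ⊤)
    (hf : ∀ z, 0 ≤ f z) (hfh : IsHarmonic ψ φ t f)
    (hh : ∀ z, 0 ≤ h z) (hhh : IsHarmonic ψ φ t h)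
    (hlip : ∀ z, locLip r f z ≤ ENNReal.ofReal (h z))
    {x x' : Chain A} (e : G) (hne : x ≠ x') (hd : dShift r x x' < 1) :
    f (x, e) ≤ (1 + (distortionConst r φ).toReal * dShift r x x') * f (x', e) := by
  obtain ⟨k, hk, hag, hdk⟩ := exists_agree_of_dShift_lt_one hne hd
  set κ : ℝ≥0∞ := distortionConst r φ * ENNReal.ofReal (dShift r x x') with hκ
  set D := (distortionConst r φ).toReal with hDdef
  have hd0 := dShift_pos hr₀ hne
  have hκD : 1 + κ = ENNReal.ofReal (1 + D * dShift r x x') := by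
    rw [ENNReal.ofReal_add zero_le_one (by positivity), ENNReal.ofReal_one,
      ENNReal.ofReal_mul (by positivity), ENNReal.ofReal_toReal hCφ]
  have hstep (n : ℕ) : f (x, e) ≤ (1 + D * dShift r x x') * f (x', e) +
      r ^ (n + 1 + k) * h (x, e) := by
    set ε : ℝ≥0∞ := ENNReal.ofReal (r ^ (n + 1 + k)) with hε
    -- The error is evaluated at `y`, not at the matched `y'`, so it is subtracted on the left
    -- (truncated) and added back in `h2`.
    have h1 : ruelle ψ φ (n + 1)
        (fun y => ENNReal.ofReal (f y) - ε * ENNReal.ofReal (h y)) (x, e) ≤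
        (1 + κ) * ruelle ψ φ (n + 1) (fun y => ENNReal.ofReal (f y)) (x', e) := by
      rw [← ruelle_const_mul]
      refine tsum_preimage_le n (fun y => ENNReal.ofReal (birkhoffProd φ (n + 1) y.1) *
          (ENNReal.ofReal (f y) - ε * ENNReal.ofReal (h y)))
        (fun y => ENNReal.ofReal (birkhoffProd φ (n + 1) y.1) *
          ((1 + κ) * ENNReal.ofReal (f y)))
        (fun y hy _ => adm_of_extMap_iterate_eq hy (hag 0 hk)) fun y y' hy hy' h2 hn => ?_
      have hagy := agree_add_of_extMap_iterate_eq hy hy' hn hag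
      have hy1 : shift^[n + 1] y.1 = x := by rw [← extMap_iterate_fst (ψ := ψ), hy]
      have hy1' : shift^[n + 1] y'.1 = x' := by rw [← extMap_iterate_fst (ψ := ψ), hy']
      have hdy := dShift_le_of_agree hr₀ hr₁ hagy
      have hdy1 : dShift r y.1 y'.1 < 1 :=
        hdy.trans_lt (pow_lt_one₀ hr₀.le hr₁ (by omega))
      have hΦ := ofReal_birkhoffProd_le_distortionConst (r := r) hφ (Nat.le_add_left 1 n) hn
        (by rwa [hy1, hy1']) (by rwa [hy1, hy1'])
      rw [hy1, hy1'] at hΦ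
      have hff : ENNReal.ofReal (f y) - ε * ENNReal.ofReal (h y) ≤ ENNReal.ofReal (f y') := by
        rw [tsub_le_iff_right]
        calc ENNReal.ofReal (f y) ≤ ENNReal.ofReal (f y' + |f y - f y'|) :=
              ENNReal.ofReal_le_ofReal (by linarith [le_abs_self (f y - f y')])
          _ = ENNReal.ofReal (f y') + ENNReal.ofReal |f y - f y'| :=
              ENNReal.ofReal_add (hf _) (abs_nonneg _)
          _ ≤ _ := by
              gcongr
              refine (ofReal_sub_le_of_locLip_le hr₀ (hlip y) h2 hdy1).trans ?_
              rw [mul_comm]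
              gcongr
              exact ENNReal.ofReal_le_ofReal hdy
      calc _ ≤ ((1 + κ) * ENNReal.ofReal (birkhoffProd φ (n + 1) y'.1)) *
            ENNReal.ofReal (f y') := mul_le_mul' hΦ hff
        _ = _ := by ring
    have h2 : ruelle ψ φ (n + 1) (fun y => ENNReal.ofReal (f y)) (x, e) ≤
        ruelle ψ φ (n + 1) (fun y => ENNReal.ofReal (f y) - ε * ENNReal.ofReal (h y)) (x, e) +
          ε * ruelle ψ φ (n + 1) (fun y => ENNReal.ofReal (h y)) (x, e) := by
      rw [← ruelle_const_mul, ruelle, ruelle, ruelle, ← ENNReal.tsum_add]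
      refine ENNReal.tsum_le_tsum fun y => ?_
      rw [← mul_add]
      gcongr
      exact le_tsub_add
    have h3 := h2.trans (add_le_add_left h1 _)
    rw [hfh.ruelle_ofReal hφ ht.le hf, hfh.ruelle_ofReal hφ ht.le hf,
      hhh.ruelle_ofReal hφ ht.le hh, hκD, hε] at h3
    have ht1 : 0 < t ^ (n + 1) := by positivity
    have hfx' := hf (x', e)
    have hhx := hh (x, e)
    rw [← ENNReal.ofReal_mul (by positivity), ← ENNReal.ofReal_mul (by positivity),
      ← ENNReal.ofReal_add (by positivity) (by positivity),
      ENNReal.ofReal_le_ofReal_iff (by positivity)] at h3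
    refine le_of_mul_le_mul_left (h3.trans (le_of_eq ?_)) ht1
    ring
  have hlim : Tendsto (fun n : ℕ => (1 + D * dShift r x x') * f (x', e) +
      r ^ (n + 1 + k) * h (x, e)) atTop
      (𝓝 ((1 + D * dShift r x x') * f (x', e) + 0 * h (x, e))) := by
    refine tendsto_const_nhds.add (Tendsto.mul_const _ ?_)
    refine (tendsto_pow_atTop_nhds_zero_of_lt_one hr₀.le hr₁).comp ?_
    exact tendsto_atTop_mono (fun n => (by omega : n ≤ n + 1 + k)) tendsto_id
  rw [zero_mul, add_zero] at hlim
  exact ge_of_tendsto' hlim hstep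

theorem logLip_le_distortionConst (hφ : ∀ x, 0 < φ x) (hr₀ : 0 < r) (hr₁ : r < 1) {ξ : Chain A}
    (hρ : 0 < specRad ψ φ ξ) (hCφ : distortionConst r φ < ⊤) {f : Ext A G → ℝ}
    (hf : f ∈ harmonicLip ψ φ r ξ) (hf0 : ∀ z, 0 ≤ f z) :
    logLip r f ≤ distortionConst r φ ∧ f ∈ harmonicPos ψ φ r ξ := by
  obtain ⟨hfh, h, ⟨hh0, hhh, _⟩, hlip⟩ := hf
  have h1 : logLip r f ≤ distortionConst r φ := by
    rw [← ENNReal.ofReal_toReal hCφ.ne]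
    exact logLip_le_of_le_mul hr₀ hf0 ENNReal.toReal_nonneg fun x x' e hne hd =>
      hfh.le_mul_of_locLip_le hφ hr₀ hr₁ hρ hCφ.ne hf0 hh0 hhh hlip e hne hd
  exact ⟨h1, hf0, hfh, h1.trans_lt hCφ⟩

end Harmonic

/-! ### Averages with respect to the approximating measures -/

section Cylinders

variable {W G : Type*} {A : W → W → Prop}

/-- Sets depending on the fibre and on the first `N` letters. -/
def IsCyl (N : ℕ) (E : Set (Ext A G)) : Prop :=
  ∀ z z' : Ext A G, z.2 = z'.2 → (∀ i < N, z.1.1 i = z'.1.1 i) → z ∈ E → z' ∈ E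

theorem IsCyl.indicator_le {N : ℕ} {E : Set (Ext A G)} (hE : IsCyl N E) {z z' : Ext A G}
    (h2 : z.2 = z'.2) (h : ∀ i < N, z.1.1 i = z'.1.1 i) :
    (E.indicator 1 z : ℝ≥0∞) ≤ E.indicator 1 z' := by
  classical
  by_cases hz : z ∈ E
  · simp [hz, hE z z' h2 h hz]
  · simp [hz]

end Cylinders

section Average

variable {W G : Type*} [Group G] {A : W → W → Prop} {ψ : W → G} {φ : Chain A → ℝ} {ξ : Chain A}
  {b : ℕ → ℝ} {r C : ℝ} {M : ℝ≥0}

/-- The standing assumptions on the group extension, the potential and the weight. -/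
structure IsRegular (ψ : W → G) (φ : Chain A → ℝ) (ξ : Chain A) (b : ℕ → ℝ) (r C : ℝ)
    (M : ℝ≥0) : Prop where
  pos : ∀ x, 0 < φ x
  r_pos : 0 < r
  r_lt_one : r < 1
  dist : HasDistortion φ r C
  tsum_le : ∀ x : Chain A,
    ∑' y : {y : Chain A // shift y = x}, ENNReal.ofReal (φ y.1) ≤ (M : ℝ≥0∞)
  bip : BigImagesPreimages A
  trans : TopTransitiveExt A ψ
  weight : IsWeight ψ φ ξ b

theorem IsRegular.specRad_pos (hS : IsRegular ψ φ ξ b r C M) : 0 < specRad ψ φ ξ :=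
  hS.dist.specRad_pos hS.pos hS.tsum_le hS.trans ξ

variable (ψ φ ξ b) in
/-- The integral of `F` with respect to `m^t_ζ`. -/
def avg (t : ℝ) (F : Ext A G → ℝ≥0∞) (ζ : Ext A G) : ℝ≥0∞ :=
  (poincareSeries ψ φ ξ b t)⁻¹ *
    ∑' n : ℕ, ENNReal.ofReal (b (n + 1) * t⁻¹ ^ (n + 1)) * ruelle ψ φ (n + 1) F ζ

theorem avg_mono (t : ℝ) {F F' : Ext A G → ℝ≥0∞} (h : ∀ y, F y ≤ F' y) (ζ : Ext A G) :
    avg ψ φ ξ b t F ζ ≤ avg ψ φ ξ b t F' ζ := by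
  unfold avg
  gcongr
  exact ruelle_mono _ h _

theorem avg_const_mul (t : ℝ) (c : ℝ≥0∞) (F : Ext A G → ℝ≥0∞) (ζ : Ext A G) :
    avg ψ φ ξ b t (fun y => c * F y) ζ = c * avg ψ φ ξ b t F ζ := by
  simp only [avg, ruelle_const_mul, mul_left_comm _ c, ENNReal.tsum_mul_left]

theorem avg_tsum {ι : Type*} (t : ℝ) (F : ι → Ext A G → ℝ≥0∞) (ζ : Ext A G) :
    avg ψ φ ξ b t (fun y => ∑' i, F i y) ζ = ∑' i, avg ψ φ ξ b t (F i) ζ := by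
  simp only [avg]
  rw [ENNReal.tsum_mul_left, ENNReal.tsum_comm]
  congr 1
  refine tsum_congr fun n => ?_
  rw [ruelle_tsum, ENNReal.tsum_mul_left]

theorem avg_finset_sum {ι : Type*} (I : Finset ι) (t : ℝ) (F : ι → Ext A G → ℝ≥0∞)
    (ζ : Ext A G) :
    avg ψ φ ξ b t (fun y => ∑ i ∈ I, F i y) ζ = ∑ i ∈ I, avg ψ φ ξ b t (F i) ζ := by
  have h := avg_tsum (ψ := ψ) (φ := φ) (ξ := ξ) (b := b) t (fun i : I => F i.1) ζ
  simp only [tsum_fintype] at h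
  rw [← Finset.sum_coe_sort I (fun i => avg ψ φ ξ b t (F i) ζ), ← h]
  congr 1
  funext y
  exact (Finset.sum_coe_sort I (fun i => F i y)).symm

theorem avg_translate (g : G) (t : ℝ) (F : Ext A G → ℝ≥0∞) (ζ : Ext A G) :
    avg ψ φ ξ b t F (translate g ζ) = avg ψ φ ξ b t (fun y => F (translate g y)) ζ := by
  simp only [avg, ruelle_translate]

/-- Fubini: the sum over last steps is exchanged with the average over starting points. -/
theorem ruelle_avg_comm (p : ℕ) (t : ℝ) (H : Ext A G → Ext A G → ℝ≥0∞) (ζ z : Ext A G) :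
    ruelle ψ φ p (fun u => avg ψ φ ξ b t (H u) z) ζ =
      avg ψ φ ξ b t (fun y => ruelle ψ φ p (fun u => H u y) ζ) z := by
  simp only [ruelle.eq_1 (n := p)]
  rw [avg_tsum]
  exact tsum_congr fun u => (avg_const_mul _ _ _ _).symm

/-- Because `b` is nondecreasing, delaying by p steps costs only the factor tᵖ. -/
theorem coeff_le_mul_coeff (hb : Monotone b) {t : ℝ} (ht : 0 < t) (n p : ℕ) :
    ENNReal.ofReal (b n * t⁻¹ ^ n) ≤
      ENNReal.ofReal (t ^ p) * ENNReal.ofReal (b (n + p) * t⁻¹ ^ (n + p)) := by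
  rw [← ENNReal.ofReal_mul (by positivity)]
  refine ENNReal.ofReal_le_ofReal ?_
  have h2 : t ^ p * (b (n + p) * t⁻¹ ^ (n + p)) = b (n + p) * t⁻¹ ^ n := by
    rw [pow_add, inv_pow, inv_pow]
    field_simp
  rw [h2]
  gcongr
  exact hb (Nat.le_add_right n p)

theorem IsRegular.series_shift_le (hS : IsRegular ψ φ ξ b r C M) {t : ℝ} (ht : 0 < t) (p : ℕ)
    (F : Ext A G → ℝ≥0∞) (ζ : Ext A G) :
    (poincareSeries ψ φ ξ b t)⁻¹ * ∑' n : ℕ,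
      ENNReal.ofReal (b (n + 1) * t⁻¹ ^ (n + 1)) * ruelle ψ φ (n + 1 + p) F ζ ≤
      ENNReal.ofReal (t ^ p) * avg ψ φ ξ b t F ζ := by
  rw [avg, mul_left_comm]
  gcongr
  rw [← ENNReal.tsum_mul_left]
  calc _ ≤ ∑' n : ℕ, ENNReal.ofReal (t ^ p) *
        (ENNReal.ofReal (b (n + p + 1) * t⁻¹ ^ (n + p + 1)) * ruelle ψ φ (n + p + 1) F ζ) := by
        refine ENNReal.tsum_le_tsum fun n => ?_
        have := coeff_le_mul_coeff hS.weight.mono ht (n + 1) p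
        rw [← mul_assoc, add_right_comm n p 1]
        gcongr
    _ ≤ _ := ENNReal.tsum_comp_le_tsum_of_injective (add_left_injective p) (fun n : ℕ =>
        ENNReal.ofReal (t ^ p) *
          (ENNReal.ofReal (b (n + 1) * t⁻¹ ^ (n + 1)) * ruelle ψ φ (n + 1) F ζ))

theorem IsRegular.avg_ruelle_le (hS : IsRegular ψ φ ξ b r C M) {t : ℝ} (ht : 0 < t) (p : ℕ)
    (F : Ext A G → ℝ≥0∞) (ζ : Ext A G) :
    avg ψ φ ξ b t (ruelle ψ φ p F) ζ ≤ ENNReal.ofReal (t ^ p) * avg ψ φ ξ b t F ζ := by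
  refine le_trans (le_of_eq ?_) (hS.series_shift_le ht p F ζ)
  simp only [avg, ruelle_add hS.pos]

theorem ruelle_avg (hφ : ∀ x, 0 < φ x) (t : ℝ) (p : ℕ) (F : Ext A G → ℝ≥0∞) (ζ : Ext A G) :
    ruelle ψ φ p (avg ψ φ ξ b t F) ζ = (poincareSeries ψ φ ξ b t)⁻¹ * ∑' n : ℕ,
      ENNReal.ofReal (b (n + 1) * t⁻¹ ^ (n + 1)) * ruelle ψ φ (n + 1 + p) F ζ := by
  have h (y : Ext A G) : avg ψ φ ξ b t F y = (poincareSeries ψ φ ξ b t)⁻¹ * ∑' n : ℕ,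
      ENNReal.ofReal (b (n + 1) * t⁻¹ ^ (n + 1)) * ruelle ψ φ (n + 1) F y := rfl
  rw [funext h, ruelle_const_mul, ruelle_tsum]
  congr 1
  refine tsum_congr fun n => ?_
  rw [ruelle_const_mul, add_comm (n + 1) p, ruelle_add hφ]

theorem IsRegular.ruelle_avg_le (hS : IsRegular ψ φ ξ b r C M) {t : ℝ} (ht : 0 < t) (p : ℕ)
    (F : Ext A G → ℝ≥0∞) (ζ : Ext A G) :
    ruelle ψ φ p (avg ψ φ ξ b t F) ζ ≤ ENNReal.ofReal (t ^ p) * avg ψ φ ξ b t F ζ :=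
  (ruelle_avg hS.pos t p F ζ).le.trans (hS.series_shift_le ht p F ζ)

theorem IsRegular.mul_avg_le_avg (hS : IsRegular ψ φ ξ b r C M) {t : ℝ} (ht : 0 < t) (p : ℕ)
    (F : Ext A G → ℝ≥0∞) {q ζ : Ext A G} (h : (extMap ψ)^[p] q = ζ) :
    ENNReal.ofReal (birkhoffProd φ p q.1) * avg ψ φ ξ b t F q ≤
      ENNReal.ofReal (t ^ p) * avg ψ φ ξ b t F ζ :=
  (mul_le_ruelle p _ h).trans (hS.ruelle_avg_le ht p F ζ)

/-- Since t ≥ ρ > 0, the first coefficients are bounded uniformly in `t`. Division by the diverging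
Poincaré series later removes these terms. -/
theorem IsRegular.exists_term_bound (hS : IsRegular ψ φ ξ b r C M) (N : ℕ) :
    ∃ R : ℝ≥0∞, R ≠ ⊤ ∧ ∀ t : ℝ, specRad ψ φ ξ ≤ t → ∀ (F : Ext A G → ℝ≥0∞) (ζ : Ext A G),
      (∀ y, F y ≤ 1) → ∑ n ∈ Finset.range N,
        ENNReal.ofReal (b (n + 1) * t⁻¹ ^ (n + 1)) * ruelle ψ φ (n + 1) F ζ ≤ R := by
  have hρ := hS.specRad_pos
  refine ⟨∑ n ∈ Finset.range N, ENNReal.ofReal (b (n + 1) * (specRad ψ φ ξ)⁻¹ ^ (n + 1)) *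
    (M : ℝ≥0∞) ^ (n + 1), ?_, fun t ht F ζ hF => Finset.sum_le_sum fun n _ => ?_⟩
  · exact ENNReal.sum_ne_top.2 fun n _ => ENNReal.mul_ne_top ENNReal.ofReal_ne_top
      (ENNReal.pow_ne_top ENNReal.coe_ne_top)
  · have hb := hS.weight.one_le (n + 1)
    have hb0 : 0 ≤ b (n + 1) := by linarith
    gcongr
    · have : 0 < t := hρ.trans_le ht
      positivity
    · exact (ruelle_mono _ hF _).trans (ruelle_one_le hS.pos hS.tsum_le _ _)

theorem tsum_le_sum_range_add {X Y : ℕ → ℝ≥0∞} (N : ℕ) (h : ∀ n, N ≤ n → X n ≤ Y n) :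
    ∑' n, X n ≤ ∑ n ∈ Finset.range N, X n + ∑' n, Y n := by
  rw [← (ENNReal.summable (f := fun n => X (n + N))).sum_add_tsum_nat_add']
  refine add_le_add le_rfl ?_
  exact (ENNReal.tsum_le_tsum fun n => h _ (Nat.le_add_left N n)).trans
    (ENNReal.tsum_comp_le_tsum_of_injective (add_left_injective N) Y)

/-- Averages are compared up to finitely many terms of the series. -/
theorem IsRegular.exists_avg_le_add (hS : IsRegular ψ φ ξ b r C M) (N : ℕ) :
    ∃ R : ℝ≥0∞, R ≠ ⊤ ∧ ∀ t : ℝ, specRad ψ φ ξ ≤ t →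
      ∀ (F F' : Ext A G → ℝ≥0∞) (z z' : Ext A G) (c : ℝ≥0∞), (∀ y, F y ≤ 1) →
        (∀ n, N ≤ n → ruelle ψ φ (n + 1) F z ≤ c * ruelle ψ φ (n + 1) F' z') →
        avg ψ φ ξ b t F z ≤ (poincareSeries ψ φ ξ b t)⁻¹ * R + c * avg ψ φ ξ b t F' z' := by
  obtain ⟨R, hR, hbound⟩ := hS.exists_term_bound N
  refine ⟨R, hR, fun t ht F F' z z' c hF h => ?_⟩
  rw [avg, avg, mul_left_comm, ← mul_add]
  gcongr
  rw [← ENNReal.tsum_mul_left]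
  refine (tsum_le_sum_range_add (Y := fun n => c * (ENNReal.ofReal (b (n + 1) * t⁻¹ ^ (n + 1)) *
    ruelle ψ φ (n + 1) F' z')) N fun n hn => ?_).trans ?_
  · rw [mul_left_comm]
    gcongr
    exact h n hn
  · gcongr
    exact hbound t ht F z hF

/-- Almost invariance of the averages under the Ruelle operator. -/
theorem IsRegular.exists_mul_avg_le (hS : IsRegular ψ φ ξ b r C M) (t₀ : ℝ) {c : ℝ} (hc : 1 < c) :
    ∃ R : ℝ≥0∞, R ≠ ⊤ ∧ ∀ t : ℝ, specRad ψ φ ξ ≤ t → t ≤ t₀ →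
      ∀ (F : Ext A G → ℝ≥0∞) (ζ : Ext A G), (∀ y, F y ≤ 1) →
        ENNReal.ofReal t * avg ψ φ ξ b t F ζ ≤ (poincareSeries ψ φ ξ b t)⁻¹ * R +
          ENNReal.ofReal c * ruelle ψ φ 1 (avg ψ φ ξ b t F) ζ := by
  have hc0 : 0 < c := by linarith
  -- This is where b_n / b_{n+1} → 1 enters: from some index on, advancing the weight by one step
  -- costs at most the factor `c`. Earlier terms go into `R`.
  have hev : ∀ᶠ n in atTop, c⁻¹ < b n / b (n + 1) :=
    hS.weight.ratio.eventually (lt_mem_nhds (inv_lt_one_of_one_lt₀ hc))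
  obtain ⟨N, hN⟩ := eventually_atTop.1 hev
  obtain ⟨R, hR, hbound⟩ := hS.exists_term_bound (N + 1)
  refine ⟨ENNReal.ofReal t₀ * R, ENNReal.mul_ne_top ENNReal.ofReal_ne_top hR,
    fun t ht ht₀ F ζ hF => ?_⟩
  have ht0 : 0 < t := hS.specRad_pos.trans_le ht
  rw [ruelle_avg hS.pos, avg, mul_left_comm, mul_left_comm (ENNReal.ofReal c), ← mul_add]
  gcongr
  set Y : ℕ → ℝ≥0∞ := fun n =>
    ENNReal.ofReal (b (n + 1) * t⁻¹ ^ (n + 1)) * ruelle ψ φ (n + 1) F ζ with hY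
  set Z : ℕ → ℝ≥0∞ := fun n =>
    ENNReal.ofReal (b (n + 1) * t⁻¹ ^ (n + 1)) * ruelle ψ φ (n + 1 + 1) F ζ with hZ
  have hYZ (n : ℕ) (hn : N ≤ n + 1) : ENNReal.ofReal t * Y (n + 1) ≤ ENNReal.ofReal c * Z n := by
    simp only [hY, hZ]
    rw [← mul_assoc, ← mul_assoc, ← ENNReal.ofReal_mul ht0.le, ← ENNReal.ofReal_mul hc0.le]
    refine mul_le_mul' (ENNReal.ofReal_le_ofReal ?_) le_rfl
    have h2 := (hN (n + 1) hn).le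
    have hb1 := hS.weight.one_le (n + 1)
    have hb2 := hS.weight.one_le (n + 1 + 1)
    rw [le_div_iff₀ (by linarith), inv_mul_le_iff₀ hc0] at h2
    have h3 : t * (b (n + 1 + 1) * t⁻¹ ^ (n + 1 + 1)) = b (n + 1 + 1) * t⁻¹ ^ (n + 1) := by
      rw [pow_succ t⁻¹ (n + 1)]
      field_simp
    rw [h3, ← mul_assoc]
    gcongr
  have hsum : ∑' n, Y n ≤ ∑ n ∈ Finset.range (N + 1), Y n + ∑' n, Y (n + (N + 1)) :=
    (ENNReal.summable (f := fun n => Y (n + (N + 1)))).sum_add_tsum_nat_add'.ge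
  calc ENNReal.ofReal t * ∑' n, Y n
      ≤ ENNReal.ofReal t * (∑ n ∈ Finset.range (N + 1), Y n + ∑' n, Y (n + (N + 1))) := by
        gcongr
    _ = ENNReal.ofReal t * ∑ n ∈ Finset.range (N + 1), Y n +
        ∑' n, ENNReal.ofReal t * Y (n + N + 1) := by
        rw [mul_add, ← ENNReal.tsum_mul_left]
        rfl
    _ ≤ ENNReal.ofReal t₀ * R + ∑' n, ENNReal.ofReal c * Z (n + N) := by
        refine add_le_add ?_ (ENNReal.tsum_le_tsum fun n => hYZ (n + N) (by omega))
        gcongr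
        exact hbound t ht F ζ hF
    _ ≤ ENNReal.ofReal t₀ * R + ∑' n, ENNReal.ofReal c * Z n := by
        refine add_le_add le_rfl ?_
        exact ENNReal.tsum_comp_le_tsum_of_injective (add_left_injective N)
          (fun n => ENNReal.ofReal c * Z n)
    _ = _ := by rw [ENNReal.tsum_mul_left]

theorem indicator_one_le_one {α : Type*} (E : Set α) (y : α) :
    (E.indicator 1 y : ℝ≥0∞) ≤ 1 :=
  Set.indicator_le_self' (fun _ _ => zero_le) y

/-- Matched preimages share at least N letters once n ≥ N, so both or neither lie in `E`. The
remainder `R` depends on N alone, and the main factor not even on N. -/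
theorem IsRegular.exists_avg_le_of_agree (hS : IsRegular ψ φ ξ b r C M) (N : ℕ) :
    ∃ R : ℝ≥0∞, R ≠ ⊤ ∧ ∀ t : ℝ, specRad ψ φ ξ ≤ t → ∀ E : Set (Ext A G), IsCyl N E →
      ∀ (k : ℕ) (x x' : Chain A) (e : G), 1 ≤ k → (∀ i < k, x.1 i = x'.1 i) →
        avg ψ φ ξ b t (E.indicator 1) (x, e) ≤ (poincareSeries ψ φ ξ b t)⁻¹ * R +
          ENNReal.ofReal (Real.exp (C * r ^ k)) * avg ψ φ ξ b t (E.indicator 1) (x', e) := by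
  obtain ⟨R, hR, h⟩ := hS.exists_avg_le_add N
  refine ⟨R, hR, fun t ht E hE k x x' e hk hag =>
    h t ht _ _ _ _ _ (indicator_one_le_one E) fun n hn => ?_⟩
  exact hS.dist.ruelle_le n hk hag e fun y y' h2 hy =>
    hE.indicator_le h2 fun i hi => hy i (by omega)

/-- Harnack inequality for the approximating measures. -/
theorem IsRegular.exists_avg_le_mul (hS : IsRegular ψ φ ξ b r C M) (t₀ : ℝ) (z z' : Ext A G) :
    ∃ K : ℝ≥0∞, K ≠ ⊤ ∧ ∀ N : ℕ, ∃ R : ℝ≥0∞, R ≠ ⊤ ∧ ∀ t : ℝ, specRad ψ φ ξ ≤ t → t ≤ t₀ →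
      ∀ E : Set (Ext A G), IsCyl N E →
        avg ψ φ ξ b t (E.indicator 1) z ≤ (poincareSeries ψ φ ξ b t)⁻¹ * R +
          K * avg ψ φ ξ b t (E.indicator 1) z' := by
  obtain ⟨x, e⟩ := z
  obtain ⟨x', e'⟩ := z'
  obtain ⟨p, q, hq0, hq⟩ := hS.trans.exists_path (x.1 0) e e' x'
  have hpos : ENNReal.ofReal (birkhoffProd φ (p + 1) q) ≠ 0 := by
    simpa using birkhoffProd_pos hS.pos _ _
  -- `K` is fixed before N: only then does the limiting inequality hold on all cylinder sets with
  -- one constant and pass to measures.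
  refine ⟨ENNReal.ofReal (Real.exp (C * r ^ 1)) *
    ((ENNReal.ofReal (birkhoffProd φ (p + 1) q))⁻¹ * ENNReal.ofReal (t₀ ^ (p + 1))), ?_,
    fun N => ?_⟩
  · exact ENNReal.mul_ne_top ENNReal.ofReal_ne_top
      (ENNReal.mul_ne_top (ENNReal.inv_ne_top.2 hpos) ENNReal.ofReal_ne_top)
  obtain ⟨R, hR, h⟩ := hS.exists_avg_le_of_agree N
  refine ⟨R, hR, fun t ht ht₀ E hE => (h t ht E hE 1 x q e le_rfl fun i hi => ?_).trans ?_⟩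
  · obtain rfl : i = 0 := by omega
    exact hq0.symm
  · have ht0 : 0 < t := hS.specRad_pos.trans_le ht
    rw [mul_assoc, mul_assoc]
    gcongr
    rw [← ENNReal.mul_le_iff_le_inv hpos ENNReal.ofReal_ne_top]
    refine (hS.mul_avg_le_avg ht0 (p + 1) _ hq).trans ?_
    gcongr

/-- The mass of the last steps outside of a finite set of letters is dominated by the mass of the
first letters. -/
theorem IsRegular.exists_ruelle_avg_le (hS : IsRegular ψ φ ξ b r C M) (t₀ : ℝ) (ζ : Ext A G)
    (g : G) :
    ∃ K : ℝ≥0∞, K ≠ ⊤ ∧ ∀ t : ℝ, 0 < t → t ≤ t₀ → ∀ S : Set W,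
      ruelle ψ φ 1 ({u : Ext A G | u.1.1 0 ∈ S}.indicator
        (avg ψ φ ξ b t ((fibre A g).indicator 1))) ζ ≤
      K * avg ψ φ ξ b t ({u : Ext A G | u.1.1 0 ∈ S ∧ u.2 = 1}.indicator 1) (ξ, 1) := by
  classical
  obtain ⟨I, p, K, hK, h⟩ := hS.dist.exists_ruelle_le_sum_base hS.pos hS.bip hS.trans ξ
  obtain ⟨I', p', K', hK', h'⟩ :=
    hS.dist.exists_last_le_first hS.pos hS.bip hS.trans ζ g
  refine ⟨(∑ β ∈ I, K β * ENNReal.ofReal (t₀ ^ p β)) *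
    ∑ β ∈ I', K' β * ENNReal.ofReal (t₀ ^ p' β), ?_, fun t ht ht₀ S => ?_⟩
  · exact ENNReal.mul_ne_top
      (ENNReal.sum_ne_top.2 fun β _ => ENNReal.mul_ne_top (hK β) ENNReal.ofReal_ne_top)
      (ENNReal.sum_ne_top.2 fun β _ => ENNReal.mul_ne_top (hK' β) ENNReal.ofReal_ne_top)
  -- Big images replace the base point of `u` by ξ, with a constant independent of `u`.
  have h1 (u : Ext A G) : avg ψ φ ξ b t ((fibre A g).indicator 1) u ≤
      (∑ β ∈ I, K β * ENNReal.ofReal (t₀ ^ p β)) *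
        avg ψ φ ξ b t ((fibre A g).indicator 1) (ξ, u.2) := by
    calc avg ψ φ ξ b t ((fibre A g).indicator 1) u
        ≤ (poincareSeries ψ φ ξ b t)⁻¹ * ∑' n : ℕ,
            ENNReal.ofReal (b (n + 1) * t⁻¹ ^ (n + 1)) *
              ∑ β ∈ I, K β * ruelle ψ φ (n + 1 + p β) ((fibre A g).indicator 1) (ξ, u.2) := by
          unfold avg
          gcongr with n
          refine h n u.1 u.2 _ fun y y' h2 => ?_
          simp [Set.indicator_apply, fibre, h2]
      _ = ∑ β ∈ I, K β * ((poincareSeries ψ φ ξ b t)⁻¹ * ∑' n : ℕ,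
            ENNReal.ofReal (b (n + 1) * t⁻¹ ^ (n + 1)) *
              ruelle ψ φ (n + 1 + p β) ((fibre A g).indicator 1) (ξ, u.2)) := by
          simp only [Finset.mul_sum]
          rw [Summable.tsum_finsetSum fun _ _ => ENNReal.summable, Finset.mul_sum]
          refine Finset.sum_congr rfl fun β _ => ?_
          simp only [mul_left_comm _ (K β), ENNReal.tsum_mul_left]
      _ ≤ ∑ β ∈ I, K β * (ENNReal.ofReal (t₀ ^ p β) *
            avg ψ φ ξ b t ((fibre A g).indicator 1) (ξ, u.2)) := by
          refine Finset.sum_le_sum fun β _ => mul_le_mul' le_rfl ?_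
          refine (hS.series_shift_le ht (p β) _ _).trans ?_
          gcongr
      _ = _ := by simp only [Finset.sum_mul, mul_assoc]
  -- Translating to `(ξ, 1)` leaves `u` only in the constraint on the group coordinates, so that the
  -- two sums can be exchanged.
  have h2 (u : Ext A G) : avg ψ φ ξ b t ((fibre A g).indicator 1) (ξ, u.2) =
      avg ψ φ ξ b t ({y : Ext A G | u.2 * y.2 = g}.indicator 1) (ξ, 1) := by
    have h3 : ((ξ, u.2) : Ext A G) = translate u.2 (ξ, 1) := by simp [translate]
    rw [h3, avg_translate]
    rfl
  calc _ ≤ ruelle ψ φ 1 (fun u => (∑ β ∈ I, K β * ENNReal.ofReal (t₀ ^ p β)) *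
        avg ψ φ ξ b t (fun y => {u : Ext A G | u.1.1 0 ∈ S ∧ u.2 * y.2 = g}.indicator 1 u)
          (ξ, 1)) ζ := by
        refine ruelle_mono _ (fun u => ?_) _
        by_cases hu : u.1.1 0 ∈ S
        · rw [Set.indicator_of_mem (by exact hu)]
          refine (h1 u).trans ?_
          rw [h2]
          gcongr
          refine avg_mono t (fun y => le_of_eq ?_) _
          simp [Set.indicator_apply, hu]
        · rw [Set.indicator_of_notMem (by exact hu)]
          exact zero_le
    _ = (∑ β ∈ I, K β * ENNReal.ofReal (t₀ ^ p β)) * avg ψ φ ξ b t (fun y =>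
        ruelle ψ φ 1 ({u : Ext A G | u.1.1 0 ∈ S ∧ u.2 * y.2 = g}.indicator 1) ζ) (ξ, 1) := by
        rw [ruelle_const_mul, ruelle_avg_comm]
    _ ≤ (∑ β ∈ I, K β * ENNReal.ofReal (t₀ ^ p β)) * avg ψ φ ξ b t (fun y =>
        ∑ β ∈ I', K' β * ruelle ψ φ (p' β)
          ({u : Ext A G | u.1.1 0 ∈ S ∧ u.2 = 1}.indicator 1) y) (ξ, 1) := by
        gcongr
        exact avg_mono t (h' S) _
    _ = (∑ β ∈ I, K β * ENNReal.ofReal (t₀ ^ p β)) * ∑ β ∈ I', K' β *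
        avg ψ φ ξ b t (ruelle ψ φ (p' β)
          ({u : Ext A G | u.1.1 0 ∈ S ∧ u.2 = 1}.indicator 1)) (ξ, 1) := by
        rw [avg_finset_sum]
        simp only [avg_const_mul]
    _ ≤ (∑ β ∈ I, K β * ENNReal.ofReal (t₀ ^ p β)) * ∑ β ∈ I', K' β *
        (ENNReal.ofReal (t₀ ^ p' β) *
          avg ψ φ ξ b t ({u : Ext A G | u.1.1 0 ∈ S ∧ u.2 = 1}.indicator 1) (ξ, 1)) := by
        gcongr with β
        refine (hS.avg_ruelle_le ht (p' β) _ _).trans ?_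
        gcongr
    _ = _ := by simp only [Finset.sum_mul, mul_assoc]

theorem IsRegular.returnSum_ne_top (hS : IsRegular ψ φ ξ b r C M) (n : ℕ) :
    returnSum ψ φ ξ n ≠ ⊤ :=
  ne_top_of_le_ne_top (ENNReal.pow_ne_top ENNReal.coe_ne_top)
    (returnSum_le hS.pos hS.tsum_le ξ n)

theorem IsRegular.poincareSeries_ne_zero (hS : IsRegular ψ φ ξ b r C M) {t : ℝ} (ht : 0 < t) :
    poincareSeries ψ φ ξ b t ≠ 0 := by
  obtain ⟨p, q, -, hq⟩ := hS.trans.exists_path (ξ.1 0) 1 1 ξ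
  intro h
  rw [poincareSeries, ENNReal.tsum_eq_zero] at h
  have h1 := h p
  have hb := hS.weight.one_le (p + 1)
  have hc : ENNReal.ofReal (b (p + 1) * t⁻¹ ^ (p + 1)) ≠ 0 := by
    have : 0 < b (p + 1) * t⁻¹ ^ (p + 1) := by positivity
    simpa using this
  have h2 : returnSum ψ φ ξ (p + 1) = 0 := (mul_eq_zero.1 h1).resolve_left hc
  rw [returnSum, ENNReal.tsum_eq_zero] at h2
  have h3 := h2 ⟨q, hq⟩
  rw [ENNReal.ofReal_eq_zero] at h3
  exact absurd h3 (not_le.2 (birkhoffProd_pos hS.pos _ _))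

/-- Divergence at ρ gives an arbitrarily large finite partial sum, and finite partial sums are
continuous in `t`. -/
theorem IsRegular.tendsto_poincareSeries (hS : IsRegular ψ φ ξ b r C M) {s : ℕ → ℝ}
    (hs : DecreasesTo s (specRad ψ φ ξ)) :
    Tendsto (fun k => poincareSeries ψ φ ξ b (s k)) atTop (𝓝 ⊤) := by
  have hρ := hS.specRad_pos
  rw [ENNReal.tendsto_nhds_top_iff_nnreal]
  intro x
  have hdiv := hS.weight.diverges _ hρ le_rfl
  have hx : (x : ℝ≥0∞) < poincareSeries ψ φ ξ b (specRad ψ φ ξ) := by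
    rw [hdiv]
    exact ENNReal.coe_lt_top
  rw [poincareSeries, ENNReal.tsum_eq_iSup_nat] at hx
  obtain ⟨N, hN⟩ := lt_iSup_iff.1 hx
  have hlim : Tendsto (fun k => ∑ n ∈ Finset.range N,
      ENNReal.ofReal (b (n + 1) * (s k)⁻¹ ^ (n + 1)) * returnSum ψ φ ξ (n + 1)) atTop
      (𝓝 (∑ n ∈ Finset.range N, ENNReal.ofReal (b (n + 1) * (specRad ψ φ ξ)⁻¹ ^ (n + 1)) *
        returnSum ψ φ ξ (n + 1))) := by
    refine tendsto_finsetSum _ fun n _ => ?_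
    refine ENNReal.Tendsto.mul_const ?_ (Or.inr (hS.returnSum_ne_top _))
    exact ENNReal.tendsto_ofReal (((hs.lim.inv₀ hρ.ne').pow _).const_mul _)
  filter_upwards [hlim.eventually (lt_mem_nhds hN)] with k hk
  exact hk.trans_le (ENNReal.sum_le_tsum _)

theorem IsRegular.tendsto_inv_mul (hS : IsRegular ψ φ ξ b r C M) {s : ℕ → ℝ}
    (hs : DecreasesTo s (specRad ψ φ ξ)) {R : ℝ≥0∞} (hR : R ≠ ⊤) :
    Tendsto (fun k => (poincareSeries ψ φ ξ b (s k))⁻¹ * R) atTop (𝓝 0) := by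
  have h1 := (hS.tendsto_poincareSeries hs).inv
  rw [ENNReal.inv_top] at h1
  simpa using ENNReal.Tendsto.mul_const h1 (Or.inr hR)

theorem IsRegular.avg_fibre_base (hS : IsRegular ψ φ ξ b r C M) {t : ℝ}
    (ht : specRad ψ φ ξ < t) :
    avg ψ φ ξ b t ((fibre A (1 : G)).indicator 1) (ξ, 1) = 1 := by
  have h : poincareSeries ψ φ ξ b t = ∑' n : ℕ, ENNReal.ofReal (b (n + 1) * t⁻¹ ^ (n + 1)) *
      ruelle ψ φ (n + 1) ((fibre A (1 : G)).indicator 1) (ξ, 1) := by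
    simp only [poincareSeries, returnSum_eq_ruelle]
  rw [avg, ← h]
  exact ENNReal.inv_mul_cancel (hS.poincareSeries_ne_zero (hS.specRad_pos.trans ht))
    (hS.weight.converges t ht).ne

end Average

/-! ### Measures on the phase space and sets depending on finitely many letters -/

section Topology

variable {W : Type*} {A : W → W → Prop} [TopologicalSpace W] [DiscreteTopology W]

instance instSecondCountableChain [Countable W] : SecondCountableTopology (Chain A) :=
  inferInstanceAs (SecondCountableTopology {x : ℕ → W | ∀ i, A (x i) (x (i + 1))})

instance instMetrizableChain : TopologicalSpace.MetrizableSpace (Chain A) :=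
  inferInstanceAs (TopologicalSpace.MetrizableSpace {x : ℕ → W | ∀ i, A (x i) (x (i + 1))})

end Topology

section Cyl

variable {W G : Type*} {A : W → W → Prop}

theorem IsCyl.compl {N : ℕ} {E : Set (Ext A G)} (hE : IsCyl N E) : IsCyl N Eᶜ :=
  fun z z' h2 h hz hz' => hz (hE z' z h2.symm (fun i hi => (h i hi).symm) hz')

theorem IsCyl.mono {N N' : ℕ} (hN : N ≤ N') {E : Set (Ext A G)} (hE : IsCyl N E) : IsCyl N' E :=
  fun z z' h2 h hz => hE z z' h2 (fun i hi => h i (hi.trans_le hN)) hz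

theorem IsCyl.inter {N : ℕ} {E F : Set (Ext A G)} (hE : IsCyl N E) (hF : IsCyl N F) :
    IsCyl N (E ∩ F) :=
  fun z z' h2 h hz => ⟨hE z z' h2 h hz.1, hF z z' h2 h hz.2⟩

theorem IsCyl.union {N : ℕ} {E F : Set (Ext A G)} (hE : IsCyl N E) (hF : IsCyl N F) :
    IsCyl N (E ∪ F) :=
  fun z z' h2 h hz => hz.imp (hE z z' h2 h) (hF z z' h2 h)

theorem isCyl_fibre (N : ℕ) (g : G) : IsCyl N (fibre A g) :=
  fun _ _ h2 _ hz => h2.symm.trans hz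

/-- The largest set depending on the first `N` letters contained in `U`. -/
def cylInterior (N : ℕ) (U : Set (Ext A G)) : Set (Ext A G) :=
  {z | ∀ z' : Ext A G, z.2 = z'.2 → (∀ i < N, z.1.1 i = z'.1.1 i) → z' ∈ U}

theorem isCyl_cylInterior (N : ℕ) (U : Set (Ext A G)) : IsCyl N (cylInterior N U) :=
  fun _ _ h2 h hz z'' h2' h' => hz z'' (h2.trans h2') fun i hi => (h i hi).trans (h' i hi)

theorem cylInterior_subset (N : ℕ) (U : Set (Ext A G)) : cylInterior N U ⊆ U :=
  fun z hz => hz z rfl fun _ _ => rfl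

theorem cylInterior_mono (U : Set (Ext A G)) : Monotone fun N => cylInterior N U :=
  fun _ _ hN _ hz z' h2 h => hz z' h2 fun i hi => h i (hi.trans_le hN)

variable [TopologicalSpace W] [DiscreteTopology W] [TopologicalSpace G] [DiscreteTopology G]

theorem eventually_agree (N : ℕ) (z : Ext A G) :
    ∀ᶠ z' in 𝓝 z, z.2 = z'.2 ∧ ∀ i < N, z.1.1 i = z'.1.1 i := by
  refine Filter.Eventually.and ?_ ?_
  · have h : IsOpen {z' : Ext A G | z'.2 ∈ ({z.2} : Set G)} :=
      (isOpen_discrete {z.2}).preimage continuous_snd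
    filter_upwards [h.mem_nhds rfl] with z' hz' using hz'.symm
  · have h (i : ℕ) : ∀ᶠ z' in 𝓝 z, z.1.1 i = z'.1.1 i := by
      have hc : Continuous fun z' : Ext A G => z'.1.1 i :=
        (continuous_apply i).comp (continuous_subtype_val.comp continuous_fst)
      filter_upwards [((isOpen_discrete {z.1.1 i}).preimage hc).mem_nhds rfl] with z' hz'
        using Eq.symm hz'
    simpa using (Filter.eventually_all_finset (Finset.range N)).2 fun i _ => h i

theorem IsCyl.isOpen {N : ℕ} {E : Set (Ext A G)} (hE : IsCyl N E) : IsOpen E := by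
  refine isOpen_iff_mem_nhds.2 fun z hz => ?_
  filter_upwards [eventually_agree N z] with z' hz' using hE z z' hz'.1 hz'.2 hz

theorem IsCyl.isClopen {N : ℕ} {E : Set (Ext A G)} (hE : IsCyl N E) : IsClopen E :=
  ⟨⟨hE.compl.isOpen⟩, hE.isOpen⟩

theorem exists_cylinder_subset {z : Ext A G} {U : Set (Ext A G)} (hU : U ∈ 𝓝 z) :
    ∃ N, z ∈ cylInterior N U := by
  rw [nhds_prod_eq, Filter.mem_prod_iff] at hU
  obtain ⟨V, hV, V', hV', hsub⟩ := hU
  rw [nhds_subtype_eq_comap, Filter.mem_comap] at hV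
  obtain ⟨V₁, hV₁, hsub₁⟩ := hV
  rw [nhds_pi, Filter.mem_pi] at hV₁
  obtain ⟨I, hI, t, ht, hsub₂⟩ := hV₁
  obtain ⟨N, hN⟩ := hI.bddAbove
  refine ⟨N + 1, fun z' h2 h => hsub ⟨hsub₁ (hsub₂ fun i hi => ?_), ?_⟩⟩
  · rw [← h i (Nat.lt_succ_of_le (hN hi))]
    exact mem_of_mem_nhds (ht i)
  · rw [← h2]
    exact mem_of_mem_nhds hV'

theorem iUnion_cylInterior {U : Set (Ext A G)} (hU : IsOpen U) :
    ⋃ N, cylInterior N U = U := by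
  refine subset_antisymm (Set.iUnion_subset fun N => cylInterior_subset N U) fun z hz => ?_
  exact Set.mem_iUnion.2 (exists_cylinder_subset (hU.mem_nhds hz))

variable [Countable W] [Countable G] [MeasurableSpace W] [DiscreteMeasurableSpace W]
  [MeasurableSpace G] [DiscreteMeasurableSpace G]

theorem IsCyl.measurableSet {N : ℕ} {E : Set (Ext A G)} (hE : IsCyl N E) : MeasurableSet E :=
  hE.isOpen.measurableSet

theorem measurableSet_fibre (g : G) : MeasurableSet (fibre A g) :=
  (isCyl_fibre 0 g).measurableSet

theorem measure_eq_tsum_fibre (μ : Measure (Ext A G)) {B : Set (Ext A G)} (hB : MeasurableSet B) :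
    μ B = ∑' g : G, μ (B ∩ fibre A g) := by
  rw [← measure_iUnion ?_ fun g => hB.inter (measurableSet_fibre g)]
  · congr 1
    ext z
    simp [fibre]
  · intro g g' hne
    refine Set.disjoint_left.2 fun z hz hz' => hne ?_
    exact (hz.2 : z.2 = g).symm.trans hz'.2

/-- Domination of measures may be checked on sets depending on finitely many letters. -/
theorem measure_le_of_isCyl {μ μ' : Measure (Ext A G)} {c : ℝ≥0∞} (hc : c ≠ ⊤)
    (hμ' : ∀ g, μ' (fibre A g) < ⊤)
    (h : ∀ (g : G) (N : ℕ) (E : Set (Ext A G)), IsCyl N E → E ⊆ fibre A g → μ E ≤ c * μ' E) :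
    μ ≤ c • μ' := by
  have hopen (g : G) (U : Set (Ext A G)) (hU : IsOpen U) :
      μ (U ∩ fibre A g) ≤ c * μ' (U ∩ fibre A g) := by
    have hUg : IsOpen (U ∩ fibre A g) := hU.inter (isCyl_fibre 0 g).isOpen
    rw [← iUnion_cylInterior hUg, (cylInterior_mono _).measure_iUnion,
      (cylInterior_mono _).measure_iUnion, ENNReal.mul_iSup]
    exact iSup_mono fun N => h g N _ (isCyl_cylInterior N _)
      ((cylInterior_subset N _).trans Set.inter_subset_right)
  refine Measure.le_iff.2 fun B hB => ?_
  rw [measure_eq_tsum_fibre μ hB, measure_eq_tsum_fibre (c • μ') hB]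
  refine ENNReal.tsum_le_tsum fun g => ?_
  have : IsFiniteMeasure (μ'.restrict (fibre A g)) :=
    ⟨by rw [Measure.restrict_apply_univ]; exact hμ' g⟩
  have h1 : μ' (B ∩ fibre A g) = μ'.restrict (fibre A g) B := (Measure.restrict_apply hB).symm
  -- Outer regularity of the finite restriction to a fibre reduces Borel sets to open sets, and
  -- these are increasing unions of cylinder interiors.
  rw [Measure.smul_apply, smul_eq_mul, h1,
    Set.measure_eq_iInf_isOpen B (μ'.restrict (fibre A g))]
  rcases eq_or_ne c 0 with rfl | hc0
  · refine le_of_le_of_eq ((measure_mono (Set.inter_subset_inter_left _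
      (Set.subset_univ B))).trans (hopen g _ isOpen_univ)) (by simp)
  simp only [ENNReal.mul_iInf_of_ne hc0 hc]
  refine le_iInf fun U => le_iInf fun hBU => le_iInf fun hU => ?_
  rw [Measure.restrict_apply hU.measurableSet]
  exact (measure_mono (Set.inter_subset_inter_left _ hBU)).trans (hopen g U hU)

theorem sigmaFinite_of_fibre {μ : Measure (Ext A G)} (h : ∀ g, μ (fibre A g) < ⊤) :
    SigmaFinite μ := by
  refine Measure.sigmaFinite_of_countable (Set.countable_range (fibre A (G := G)))
    (Set.forall_mem_range.2 h) ?_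
  ext z
  simp [fibre]

end Cyl

/-! ### The limit measures -/

section Integrals

variable {X : Type*} [MeasurableSpace X] {μ μ' : Measure X}

theorem integral_le_mul_of_le_smul {c : ℝ} (hc : 0 ≤ c) (h : μ ≤ ENNReal.ofReal c • μ')
    {f : X → ℝ} (hf : 0 ≤ f) (hfi : Integrable f μ') : ∫ y, f y ∂μ ≤ c * ∫ y, f y ∂μ' := by
  have h1 := integral_mono_measure h (ae_of_all _ hf) (hfi.smul_measure ENNReal.ofReal_ne_top)
  rwa [integral_smul_measure, ENNReal.toReal_ofReal hc, smul_eq_mul] at h1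

/-- Domination compares integrals of nonnegative functions only, so `f` is split into positive and
negative parts; their errors add up to the integral of `|f|`. -/
theorem abs_integral_sub_integral_le {κ : ℝ} (hκ : 0 ≤ κ)
    (h : μ ≤ ENNReal.ofReal (1 + κ) • μ') (h' : μ' ≤ ENNReal.ofReal (1 + κ) • μ) {f : X → ℝ}
    (hf : Integrable f μ) (hf' : Integrable f μ') :
    |∫ y, f y ∂μ - ∫ y, f y ∂μ'| ≤ κ * ∫ y, |f y| ∂μ := by
  have key {u : X → ℝ} (hu0 : 0 ≤ u) (hu : Integrable u μ) (hu' : Integrable u μ') :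
      |∫ y, u y ∂μ - ∫ y, u y ∂μ'| ≤ κ * ∫ y, u y ∂μ := by
    rw [abs_sub_comm]
    exact abs_sub_le_mul_of_le hκ (integral_le_mul_of_le_smul (by positivity) h' hu0 hu)
      (integral_le_mul_of_le_smul (by positivity) h hu0 hu')
  have hp := key (u := fun y => max (f y) 0) (fun y => le_max_right _ _) hf.pos_part hf'.pos_part
  have hn := key (u := fun y => max (-f y) 0) (fun y => le_max_right _ _) hf.neg_part hf'.neg_part
  have e1 (y : X) : f y = max (f y) 0 - max (-f y) 0 := by
    rcases le_total (f y) 0 with h | h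
    · rw [max_eq_right h, max_eq_left (by linarith)]; ring
    · rw [max_eq_left h, max_eq_right (by linarith)]; ring
  have e2 (y : X) : |f y| = max (f y) 0 + max (-f y) 0 := by
    rcases le_total (f y) 0 with h | h
    · rw [max_eq_right h, max_eq_left (by linarith), abs_of_nonpos h]; ring
    · rw [max_eq_left h, max_eq_right (by linarith), abs_of_nonneg h]; ring
  have i1 : ∫ y, f y ∂μ = ∫ y, max (f y) 0 ∂μ - ∫ y, max (-f y) 0 ∂μ := by
    rw [← integral_sub hf.pos_part hf.neg_part]
    exact integral_congr_ae (ae_of_all _ e1)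
  have i1' : ∫ y, f y ∂μ' = ∫ y, max (f y) 0 ∂μ' - ∫ y, max (-f y) 0 ∂μ' := by
    rw [← integral_sub hf'.pos_part hf'.neg_part]
    exact integral_congr_ae (ae_of_all _ e1)
  have i2 : ∫ y, |f y| ∂μ = ∫ y, max (f y) 0 ∂μ + ∫ y, max (-f y) 0 ∂μ := by
    rw [← integral_add hf.pos_part hf.neg_part]
    exact integral_congr_ae (ae_of_all _ e2)
  rw [i1, i1', i2, mul_add]
  rw [abs_le] at hp hn ⊢
  constructor <;> linarith [hp.1, hp.2, hn.1, hn.2]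

end Integrals

/-! ### Limit measures: domination, conformality and harmonic integrals -/

section LimitFamily

variable {W G : Type*} [Countable W] [TopologicalSpace W] [DiscreteTopology W]
  [MeasurableSpace W] [DiscreteMeasurableSpace W]
  [Group G] [Countable G] [TopologicalSpace G] [DiscreteTopology G]
  [MeasurableSpace G] [DiscreteMeasurableSpace G]
  {A : W → W → Prop} {ψ : W → G} {φ : Chain A → ℝ} {ξ : Chain A}
  {b s : ℕ → ℝ} {r C : ℝ} {M : ℝ≥0} {ν : Ext A G → Measure (Ext A G)}

theorem lintegral_approxMeasure (t : ℝ) (ζ : Ext A G) (F : Ext A G → ℝ≥0∞) :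
    ∫⁻ y, F y ∂(approxMeasure ψ φ ξ b t ζ) = avg ψ φ ξ b t F ζ := by
  simp only [approxMeasure, lintegral_smul_measure, lintegral_sum_measure, lintegral_dirac,
    smul_eq_mul]
  rfl

theorem setLIntegral_approxMeasure (t : ℝ) (ζ : Ext A G) (g : G) (F : Ext A G → ℝ≥0∞) :
    ∫⁻ y in fibre A g, F y ∂(approxMeasure ψ φ ξ b t ζ) =
      avg ψ φ ξ b t ((fibre A g).indicator F) ζ := by
  rw [← lintegral_indicator (measurableSet_fibre g), lintegral_approxMeasure]

/-- The indicator function of a clopen set with values in `ℝ≥0`. -/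
def clopenIndicator {E : Set (Ext A G)} (hE : IsClopen E) : Ext A G →ᵇ ℝ≥0 :=
  BoundedContinuousFunction.mkOfBound
    ⟨E.indicator 1, continuous_indicator (by simp [hE]) continuous_const.continuousOn⟩ 1
    fun x y => by
      by_cases hx : x ∈ E <;> by_cases hy : y ∈ E <;> simp [hx, hy, NNReal.dist_eq]

theorem coe_clopenIndicator {E : Set (Ext A G)} (hE : IsClopen E) (y : Ext A G) :
    ((clopenIndicator hE y : ℝ≥0) : ℝ≥0∞) = E.indicator 1 y := by
  change ((E.indicator 1 y : ℝ≥0) : ℝ≥0∞) = _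
  by_cases hy : y ∈ E <;> simp [hy]

/-- Sets depending on finitely many letters are clopen, so their indicators are admissible test
functions. -/
theorem IsLimitFamily.tendsto_avg (hν : IsLimitFamily ψ φ ξ b s ν) {N : ℕ} {g : G}
    {E : Set (Ext A G)} (hE : IsCyl N E) (hEg : E ⊆ fibre A g) (ζ : Ext A G) :
    Tendsto (fun k => avg ψ φ ξ b (s k) (E.indicator 1) ζ) atTop (𝓝 (ν ζ E)) := by
  have h := hν.conv ζ g (clopenIndicator hE.isClopen)
  simp only [setLIntegral_approxMeasure, coe_clopenIndicator] at h
  rw [lintegral_indicator_one hE.measurableSet, Measure.restrict_apply hE.measurableSet,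
    Set.inter_eq_left.2 hEg] at h
  have h2 : (fibre A g).indicator (fun y => (E.indicator 1 y : ℝ≥0∞)) = E.indicator 1 := by
    rw [show (fun y => (E.indicator 1 y : ℝ≥0∞)) = E.indicator 1 from rfl,
      Set.indicator_indicator, Set.inter_eq_right.2 hEg]
  rwa [h2] at h

theorem IsLimitFamily.le_mul (hν : IsLimitFamily ψ φ ξ b s ν) (hS : IsRegular ψ φ ξ b r C M)
    {N : ℕ} {g : G} {E : Set (Ext A G)} (hE : IsCyl N E) (hEg : E ⊆ fibre A g)
    {z z' : Ext A G} {R K : ℝ≥0∞} (hR : R ≠ ⊤) (hK : K ≠ ⊤)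
    (h : ∀ k, avg ψ φ ξ b (s k) (E.indicator 1) z ≤ (poincareSeries ψ φ ξ b (s k))⁻¹ * R +
      K * avg ψ φ ξ b (s k) (E.indicator 1) z') :
    ν z E ≤ K * ν z' E := by
  refine le_of_tendsto_of_tendsto' (hν.tendsto_avg hE hEg z) ?_ h
  have h1 := (hS.tendsto_inv_mul hν.decreases hR).add
    (ENNReal.Tendsto.const_mul (hν.tendsto_avg hE hEg z') (Or.inr hK))
  rwa [zero_add] at h1

theorem DecreasesTo.le_zero {t : ℝ} (hs : DecreasesTo s t) (k : ℕ) : s k ≤ s 0 :=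
  hs.anti (Nat.zero_le k)

theorem IsRegular.avg_fibre_translate (hS : IsRegular ψ φ ξ b r C M) {t : ℝ}
    (ht : specRad ψ φ ξ < t) (g : G) :
    avg ψ φ ξ b t ((fibre A g).indicator 1) (ξ, g) = 1 := by
  have h : ((ξ, g) : Ext A G) = translate g (ξ, 1) := by simp [translate]
  have h2 : (fun y => ((fibre A g).indicator 1 (translate g y) : ℝ≥0∞)) =
      (fibre A (1 : G)).indicator 1 := by
    classical
    funext y
    simp [Set.indicator_apply, fibre, translate]
  rw [h, avg_translate, h2, hS.avg_fibre_base ht]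

/-- The approximating measures at `(ξ, g)` give `X_g` mass exactly 1 by normalisation and
translation; Harnack transfers finiteness to every `z`. -/
theorem IsLimitFamily.fibre_lt_top (hν : IsLimitFamily ψ φ ξ b s ν)
    (hS : IsRegular ψ φ ξ b r C M) (z : Ext A G) (g : G) : ν z (fibre A g) < ⊤ := by
  obtain ⟨K, hK, h⟩ := hS.exists_avg_le_mul (s 0) z (ξ, g)
  obtain ⟨R, hR, h⟩ := h 0
  have h1 := hν.le_mul hS (isCyl_fibre 0 g) subset_rfl hR hK fun k =>
    h (s k) (hν.decreases.gt k).le (hν.decreases.le_zero k) _ (isCyl_fibre 0 g)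
  have h2 : ν (ξ, g) (fibre A g) = 1 := by
    refine tendsto_nhds_unique (hν.tendsto_avg (isCyl_fibre 0 g) subset_rfl (ξ, g)) ?_
    simp only [fun k => hS.avg_fibre_translate (hν.decreases.gt k) g]
    exact tendsto_const_nhds
  rw [h2, mul_one] at h1
  exact h1.trans_lt hK.lt_top

theorem IsLimitFamily.exists_le_smul (hν : IsLimitFamily ψ φ ξ b s ν)
    (hS : IsRegular ψ φ ξ b r C M) (z z' : Ext A G) :
    ∃ K : ℝ≥0∞, K ≠ ⊤ ∧ ν z ≤ K • ν z' := by
  obtain ⟨K, hK, h⟩ := hS.exists_avg_le_mul (s 0) z z'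
  refine ⟨K, hK, measure_le_of_isCyl hK (hν.fibre_lt_top hS z') fun g N E hE hEg => ?_⟩
  obtain ⟨R, hR, h⟩ := h N
  exact hν.le_mul hS hE hEg hR hK fun k =>
    h (s k) (hν.decreases.gt k).le (hν.decreases.le_zero k) _ hE

theorem IsLimitFamily.le_smul_of_agree (hν : IsLimitFamily ψ φ ξ b s ν)
    (hS : IsRegular ψ φ ξ b r C M) {k : ℕ} (hk : 1 ≤ k) {x x' : Chain A}
    (hag : ∀ i < k, x.1 i = x'.1 i) (e : G) :
    ν (x, e) ≤ ENNReal.ofReal (Real.exp (C * r ^ k)) • ν (x', e) := by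
  refine measure_le_of_isCyl ENNReal.ofReal_ne_top (hν.fibre_lt_top hS _) fun g N E hE hEg => ?_
  obtain ⟨R, hR, h⟩ := hS.exists_avg_le_of_agree N
  exact hν.le_mul hS hE hEg hR ENNReal.ofReal_ne_top fun j =>
    h (s j) (hν.decreases.gt j).le E hE k x x' e hk hag

theorem finite_preimage_first_letter (ζ : Ext A G) (F : Finset W) :
    {y : {y : Ext A G // (extMap ψ)^[1] y = ζ} | y.1.1.1 0 ∈ F}.Finite := by
  refine Set.Finite.of_finite_image (f := fun y => y.1.1.1 0)
    (F.finite_toSet.subset (by rintro _ ⟨y, hy, rfl⟩; exact hy)) fun y _ y' _ h => ?_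
  have h0 : y.1.1.1 0 = y'.1.1.1 0 := h
  have h1 : y.1.1 = y'.1.1 := by
    refine eq_of_shift_iterate_eq (n := 1) (fun i hi => ?_) ?_
    · obtain rfl : i = 0 := by omega
      exact h0
    · rw [← extMap_iterate_fst (ψ := ψ), ← extMap_iterate_fst (ψ := ψ), y.2, y'.2]
  have h2 : y.1.2 * ψ (y.1.1.1 0) = ζ.2 := congrArg Prod.snd y.2
  have h3 : y'.1.2 * ψ (y'.1.1.1 0) = ζ.2 := congrArg Prod.snd y'.2
  rw [← h0, ← h2] at h3
  exact Subtype.ext (Prod.ext h1 (mul_right_cancel h3).symm)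

theorem IsLimitFamily.tendsto_finset_sum (hν : IsLimitFamily ψ φ ξ b s ν) {N : ℕ} {g : G}
    {E : Set (Ext A G)} (hE : IsCyl N E) (hEg : E ⊆ fibre A g) {ζ : Ext A G}
    (Y : Finset {y : Ext A G // (extMap ψ)^[1] y = ζ}) :
    Tendsto (fun k => ∑ y ∈ Y, ENNReal.ofReal (birkhoffProd φ 1 y.1.1) *
      avg ψ φ ξ b (s k) (E.indicator 1) y.1) atTop
      (𝓝 (∑ y ∈ Y, ENNReal.ofReal (birkhoffProd φ 1 y.1.1) * ν y.1 E)) :=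
  tendsto_finsetSum _ fun y _ => ENNReal.Tendsto.const_mul (hν.tendsto_avg hE hEg y.1)
    (Or.inr ENNReal.ofReal_ne_top)

/-- Fatou: finite partial sums converge termwise and are bounded by the almost invariant averages.
-/
theorem IsLimitFamily.ruelle_measure_le (hν : IsLimitFamily ψ φ ξ b s ν)
    (hS : IsRegular ψ φ ξ b r C M) {N : ℕ} {g : G} {E : Set (Ext A G)} (hE : IsCyl N E)
    (hEg : E ⊆ fibre A g) (ζ : Ext A G) :
    ruelle ψ φ 1 (fun y => ν y E) ζ ≤ ENNReal.ofReal (specRad ψ φ ξ) * ν ζ E := by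
  rw [ruelle, ENNReal.tsum_eq_iSup_sum]
  refine iSup_le fun Y => ?_
  refine le_of_tendsto_of_tendsto' (hν.tendsto_finset_sum hE hEg Y)
    (ENNReal.Tendsto.mul (ENNReal.tendsto_ofReal hν.decreases.lim) (Or.inl ?_)
      (hν.tendsto_avg hE hEg ζ) (Or.inr ENNReal.ofReal_ne_top)) fun k => ?_
  · simpa using hS.specRad_pos
  · have h := hS.ruelle_avg_le (hS.specRad_pos.trans (hν.decreases.gt k)) 1 (E.indicator 1) ζ
    rw [pow_one] at h
    exact (ENNReal.sum_le_tsum Y).trans h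

theorem IsLimitFamily.tendsto_first_letter (hν : IsLimitFamily ψ φ ξ b s ν)
    (hS : IsRegular ψ φ ξ b r C M) :
    Tendsto (fun F : Finset W => ν (ξ, 1) {u : Ext A G | u.1.1 0 ∈ (F : Set W)ᶜ ∧ u.2 = 1})
      atTop (𝓝 0) := by
  set B : W → Set (Ext A G) := fun w => {u | u.1.1 0 = w ∧ u.2 = 1} with hB
  have hBcyl (w : W) : IsCyl 1 (B w) := fun z z' h2 h hz =>
    ⟨(h 0 one_pos).symm.trans hz.1, h2.symm.trans hz.2⟩
  have hfin : ∑' w, ν (ξ, 1) (B w) ≠ ⊤ := by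
    rw [← measure_iUnion _ fun w => (hBcyl w).measurableSet]
    · refine ((measure_mono ?_).trans_lt (hν.fibre_lt_top hS (ξ, 1) 1)).ne
      exact Set.iUnion_subset fun w u hu => hu.2
    · intro w w' hne
      exact Set.disjoint_left.2 fun u hu hu' => hne (hu.1.symm.trans hu'.1)
  refine tendsto_of_tendsto_of_tendsto_of_le_of_le tendsto_const_nhds
    (ENNReal.tendsto_tsum_compl_atTop_zero hfin) (fun _ => zero_le) fun F => ?_
  refine (measure_mono ?_).trans (measure_iUnion_le fun w : {w // w ∉ F} => B w.1)
  exact fun u hu => Set.mem_iUnion.2 ⟨⟨u.1.1 0, by simpa using hu.1⟩, rfl, hu.2⟩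

/-- Preimages of `ζ` with first letter in a finite set `F` are finitely many, so their contribution
passes to the limit. The rest is controlled by the mass of first letters outside `F` at `(ξ, 1)`,
which tends to 0 as `F` grows. The loss `c` in the almost invariance is removed last. -/
theorem IsLimitFamily.le_ruelle_measure (hν : IsLimitFamily ψ φ ξ b s ν)
    (hS : IsRegular ψ φ ξ b r C M) {N : ℕ} {g : G} {E : Set (Ext A G)} (hE : IsCyl N E)
    (hEg : E ⊆ fibre A g) (ζ : Ext A G) :
    ENNReal.ofReal (specRad ψ φ ξ) * ν ζ E ≤ ruelle ψ φ 1 (fun y => ν y E) ζ := by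
  obtain ⟨K, hK, htail⟩ := hS.exists_ruelle_avg_le (s 0) ζ g
  set S : Finset W → Set (Ext A G) := fun F => {u | u.1.1 0 ∈ (F : Set W)ᶜ ∧ u.2 = 1} with hSdef
  have hScyl (F : Finset W) : IsCyl 1 (S F) := fun z z' h2 h hz =>
    ⟨by rw [← h 0 one_pos]; exact hz.1, h2.symm.trans hz.2⟩
  have hSsub (F : Finset W) : S F ⊆ fibre A (1 : G) := fun u hu => hu.2
  have hstep (c : ℝ) (hc : 1 < c) (F : Finset W) :
      ENNReal.ofReal (specRad ψ φ ξ) * ν ζ E ≤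
        ENNReal.ofReal c * (ruelle ψ φ 1 (fun y => ν y E) ζ + K * ν (ξ, 1) (S F)) := by
    obtain ⟨R, hR, hinv⟩ := hS.exists_mul_avg_le (s 0) hc
    set Y := (finite_preimage_first_letter (ψ := ψ) ζ F).toFinset with hY
    have hk (k : ℕ) : ENNReal.ofReal (s k) * avg ψ φ ξ b (s k) (E.indicator 1) ζ ≤
        (poincareSeries ψ φ ξ b (s k))⁻¹ * R + ENNReal.ofReal c *
          (∑ y ∈ Y, ENNReal.ofReal (birkhoffProd φ 1 y.1.1) *
            avg ψ φ ξ b (s k) (E.indicator 1) y.1 +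
            K * avg ψ φ ξ b (s k) ((S F).indicator 1) (ξ, 1)) := by
      have hgt := hν.decreases.gt k
      refine (hinv (s k) hgt.le (hν.decreases.le_zero k) _ ζ (indicator_one_le_one E)).trans ?_
      gcongr
      refine le_trans ?_ (add_le_add le_rfl (htail (s k) (hS.specRad_pos.trans hgt)
        (hν.decreases.le_zero k) (F : Set W)ᶜ))
      have hsum : ∑ y ∈ Y, ENNReal.ofReal (birkhoffProd φ 1 y.1.1) *
          avg ψ φ ξ b (s k) (E.indicator 1) y.1 =
          ruelle ψ φ 1 ({u : Ext A G | u.1.1 0 ∈ F}.indicator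
            (avg ψ φ ξ b (s k) (E.indicator 1))) ζ := by
        rw [ruelle, tsum_eq_sum (s := Y)]
        · refine Finset.sum_congr rfl fun y hy => ?_
          have : y.1 ∈ {u : Ext A G | u.1.1 0 ∈ F} := 
            (Set.Finite.mem_toFinset (finite_preimage_first_letter ζ F)).1 hy
          rw [Set.indicator_of_mem this]
        · intro y hy
          have : y.1 ∉ {u : Ext A G | u.1.1 0 ∈ F} := fun h =>
            hy ((Set.Finite.mem_toFinset (finite_preimage_first_letter ζ F)).2 h)
          rw [Set.indicator_of_notMem this, mul_zero]
      -- Each preimage is charged to the finite part or to the tail; in the tail `E` is enlarged to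
      -- its whole fibre.
      rw [hsum, ruelle, ruelle, ruelle, ← ENNReal.tsum_add]
      refine ENNReal.tsum_le_tsum fun y => ?_
      rw [← mul_add]
      gcongr
      by_cases hy : y.1.1.1 0 ∈ F
      · rw [Set.indicator_of_mem (by exact hy)]
        exact le_self_add
      · rw [Set.indicator_of_mem (s := {u : Ext A G | u.1.1 0 ∈ (F : Set W)ᶜ}) (by simpa using hy)]
        refine le_trans (avg_mono _ (fun u => ?_) _) le_add_self
        exact Set.indicator_le_indicator_of_subset hEg (fun _ => zero_le) u
    have hlim₁ : Tendsto (fun k => ENNReal.ofReal (s k) *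
        avg ψ φ ξ b (s k) (E.indicator 1) ζ) atTop
        (𝓝 (ENNReal.ofReal (specRad ψ φ ξ) * ν ζ E)) :=
      ENNReal.Tendsto.mul (ENNReal.tendsto_ofReal hν.decreases.lim)
        (Or.inl (by simpa using hS.specRad_pos)) (hν.tendsto_avg hE hEg ζ)
        (Or.inr ENNReal.ofReal_ne_top)
    have hlim₂ := (hS.tendsto_inv_mul hν.decreases hR).add
      (ENNReal.Tendsto.const_mul ((hν.tendsto_finset_sum hE hEg Y).add
        (ENNReal.Tendsto.const_mul (hν.tendsto_avg (hScyl F) (hSsub F) (ξ, 1)) (Or.inr hK)))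
        (Or.inr (ENNReal.ofReal_ne_top (r := c))))
    rw [zero_add] at hlim₂
    refine (le_of_tendsto_of_tendsto' hlim₁ hlim₂ hk).trans ?_
    gcongr
    exact ENNReal.sum_le_tsum Y
  have hstep' (c : ℝ) (hc : 1 < c) : ENNReal.ofReal (specRad ψ φ ξ) * ν ζ E ≤
      ENNReal.ofReal c * ruelle ψ φ 1 (fun y => ν y E) ζ := by
    have hlim := ENNReal.Tendsto.const_mul (tendsto_const_nhds.add (ENNReal.Tendsto.const_mul
      (hν.tendsto_first_letter hS) (Or.inr hK)) :
        Tendsto (fun F => ruelle ψ φ 1 (fun y => ν y E) ζ + K * ν (ξ, 1) (S F)) atTop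
          (𝓝 (ruelle ψ φ 1 (fun y => ν y E) ζ + K * 0)))
      (Or.inr (ENNReal.ofReal_ne_top (r := c)))
    rw [mul_zero, add_zero] at hlim
    exact ge_of_tendsto' hlim (hstep c hc)
  have hlim : Tendsto (fun c : ℝ => ENNReal.ofReal c * ruelle ψ φ 1 (fun y => ν y E) ζ)
      (𝓝[>] 1) (𝓝 (ENNReal.ofReal 1 * ruelle ψ φ 1 (fun y => ν y E) ζ)) :=
    ENNReal.Tendsto.mul_const (ENNReal.tendsto_ofReal (tendsto_id.mono_left nhdsWithin_le_nhds))
      (Or.inl (by simp))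
  rw [ENNReal.ofReal_one, one_mul] at hlim
  exact ge_of_tendsto hlim (eventually_nhdsWithin_of_forall hstep')

/-- The family of limit measures is invariant under the dual of the Ruelle operator, up to the
factor `ρ`. -/
theorem IsLimitFamily.sum_smul_eq (hν : IsLimitFamily ψ φ ξ b s ν)
    (hS : IsRegular ψ φ ξ b r C M) (ζ : Ext A G) :
    Measure.sum (fun y : {y : Ext A G // extMap ψ y = ζ} => ENNReal.ofReal (φ y.1.1) • ν y.1) =
      ENNReal.ofReal (specRad ψ φ ξ) • ν ζ := by
  have happ (E : Set (Ext A G)) (hE : MeasurableSet E) :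
      Measure.sum (fun y : {y : Ext A G // extMap ψ y = ζ} =>
        ENNReal.ofReal (φ y.1.1) • ν y.1) E = ruelle ψ φ 1 (fun y => ν y E) ζ := by
    rw [Measure.sum_apply _ hE]
    simp only [ruelle, birkhoffProd_one, Measure.smul_apply, smul_eq_mul]
    rfl
  have hfin (g : G) : (ENNReal.ofReal (specRad ψ φ ξ) • ν ζ) (fibre A g) < ⊤ := by
    rw [Measure.smul_apply, smul_eq_mul]
    exact ENNReal.mul_lt_top ENNReal.ofReal_lt_top (hν.fibre_lt_top hS ζ g)
  refine le_antisymm ?_ ?_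
  · rw [← one_smul ℝ≥0∞ (ENNReal.ofReal (specRad ψ φ ξ) • ν ζ)]
    refine measure_le_of_isCyl ENNReal.one_ne_top hfin fun g N E hE hEg => ?_
    rw [happ E hE.measurableSet, one_mul, Measure.smul_apply, smul_eq_mul]
    exact hν.ruelle_measure_le hS hE hEg ζ
  · rw [← one_smul ℝ≥0∞ (Measure.sum _)]
    refine measure_le_of_isCyl ENNReal.one_ne_top (fun g => ?_) fun g N E hE hEg => ?_
    · rw [happ _ (measurableSet_fibre g)]
      exact (hν.ruelle_measure_le hS (isCyl_fibre 0 g) subset_rfl ζ).trans_lt (hfin g)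
    · rw [happ E hE.measurableSet, one_mul, Measure.smul_apply, smul_eq_mul]
      exact hν.le_ruelle_measure hS hE hEg ζ

/-- Integrability against the sum measure, which is ρ ν_ζ, yields at once the identity and the
unconditional convergence of the series. -/
theorem IsLimitFamily.isHarmonic_integral (hν : IsLimitFamily ψ φ ξ b s ν)
    (hS : IsRegular ψ φ ξ b r C M) {f : Ext A G → ℝ} (hf : ∀ z, Integrable f (ν z)) :
    IsHarmonic ψ φ (specRad ψ φ ξ) fun z => ∫ y, f y ∂(ν z) := by
  intro ζ
  have hint : Integrable f (Measure.sum (fun y : {y : Ext A G // extMap ψ y = ζ} =>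
      ENNReal.ofReal (φ y.1.1) • ν y.1)) := by
    rw [hν.sum_smul_eq hS ζ]
    exact (hf ζ).smul_measure ENNReal.ofReal_ne_top
  have h := hasSum_integral_measure hint
  rw [hν.sum_smul_eq hS ζ] at h
  simpa only [integral_smul_measure, ENNReal.toReal_ofReal (hS.pos _).le,
    ENNReal.toReal_ofReal hS.specRad_pos.le, smul_eq_mul] using h

/-- Needed for measurability, which is not part of the definition of `logUnifCont`. -/
theorem continuous_of_mem_logUnifCont {νo : Measure (Ext A G)} {f : Ext A G → ℝ}
    (hf : f ∈ logUnifCont νo) : Continuous f := by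
  refine continuous_iff_continuousAt.2 fun z => Metric.tendsto_nhds.2 fun ε hε => ?_
  have hδ : 0 < ENNReal.ofReal (ε / (|f z| + 1)) := by
    rw [ENNReal.ofReal_pos]
    positivity
  obtain ⟨n, hn⟩ := (hf.2.eventually (gt_mem_nhds hδ)).exists
  rw [oscConst, sInf_lt_iff] at hn
  obtain ⟨c, hc, hcδ⟩ := hn
  filter_upwards [eventually_agree n z] with z' hz'
  have h1 := hc z z' hz'.1 hz'.2
  have h2 : ENNReal.ofReal |f z - f z'| ≤ ENNReal.ofReal (ε / (|f z| + 1) * |f z|) := by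
    rw [ENNReal.ofReal_mul (by positivity)]
    refine h1.trans ?_
    gcongr
  rw [ENNReal.ofReal_le_ofReal_iff (by positivity)] at h2
  rw [Real.dist_eq, abs_sub_comm]
  refine h2.trans_lt ?_
  rw [div_mul_eq_mul_div, div_lt_iff₀ (by positivity)]
  nlinarith [abs_nonneg (f z)]

theorem IsLimitFamily.integrable (hν : IsLimitFamily ψ φ ξ b s ν)
    (hS : IsRegular ψ φ ξ b r C M) {o : Ext A G} {f : Ext A G → ℝ}
    (hf : f ∈ logUnifCont (ν o)) (z : Ext A G) : Integrable f (ν z) := by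
  have ho : Integrable f (ν o) := by
    refine ⟨(continuous_of_mem_logUnifCont hf).aestronglyMeasurable, ?_⟩
    rw [hasFiniteIntegral_iff_norm]
    exact hf.1
  obtain ⟨K, hK, hle⟩ := hν.exists_le_smul hS z o
  exact (ho.smul_measure hK).mono_measure hle

/-- Domination with constant 1 + D d in both directions bounds the variation of z ↦ ν_z(f) by D d
ν_z(|f|). The majorant z ↦ D ν_z(|f|) is harmonic as an integral and has `logLip` at most D by the
same domination. -/
theorem IsLimitFamily.integral_mem_harmonicLip (hν : IsLimitFamily ψ φ ξ b s ν)
    (hS : IsRegular ψ φ ξ b r C M) {f : Ext A G → ℝ} (hf : ∀ z, Integrable f (ν z)) :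
    (fun z => ∫ y, f y ∂(ν z)) ∈ harmonicLip ψ φ r ξ := by
  have hC := hS.dist.1
  set D := C * Real.exp C with hD
  have hD0 : 0 ≤ D := by positivity
  have hcomp {x x' : Chain A} (e : G) (hne : x ≠ x') (hd : dShift r x x' < 1) :
      ν (x, e) ≤ ENNReal.ofReal (1 + D * dShift r x x') • ν (x', e) := by
    obtain ⟨k, hk, hag, hdk⟩ := exists_agree_of_dShift_lt_one hne hd
    refine (hν.le_smul_of_agree hS hk hag e).trans ?_
    rw [hdk]
    have := exp_le_one_add_mul (pow_nonneg hS.r_pos.le k)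
      (pow_le_one₀ hS.r_pos.le hS.r_lt_one.le) hC
    exact Measure.le_iff.2 fun B _ => by
      simp only [Measure.smul_apply, smul_eq_mul]
      gcongr
  have habs (z : Ext A G) : Integrable (fun y => |f y|) (ν z) := (hf z).abs
  have hh0 (z : Ext A G) : 0 ≤ ∫ y, |f y| ∂(ν z) := integral_nonneg fun y => abs_nonneg _
  have hhD : IsHarmonic ψ φ (specRad ψ φ ξ) fun z => ∫ y, D * |f y| ∂(ν z) :=
    hν.isHarmonic_integral hS fun z => (habs z).const_mul D
  simp only [integral_const_mul] at hhD
  refine ⟨hν.isHarmonic_integral hS hf, fun z => D * ∫ y, |f y| ∂(ν z),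
    ⟨fun z => mul_nonneg hD0 (hh0 z), hhD, ?_⟩, ?_⟩
  · refine (logLip_le_of_le_mul hS.r_pos (fun z => mul_nonneg hD0 (hh0 z)) hD0
      fun x x' e hne hd => ?_).trans_lt (ENNReal.ofReal_lt_top (r := D))
    have hd0 := dShift_pos hS.r_pos hne
    have h1 := integral_le_mul_of_le_smul (by positivity) (hcomp e hne hd)
      (f := fun y => |f y|) (fun y => abs_nonneg _) (habs _)
    rw [mul_left_comm]
    gcongr
  · rintro ⟨x, e⟩
    simp only [locLip, iSup_le_iff]
    rintro ⟨x', e'⟩ hd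
    obtain rfl : e = e' := snd_eq_of_dExt_lt_one hd
    rw [dExt_of_snd_eq (z₁ := (x, e)) (z₂ := (x', e)) rfl] at hd ⊢
    by_cases hne : x = x'
    · subst hne
      simp
    have hd0 := dShift_pos hS.r_pos hne
    refine ENNReal.div_le_of_le_mul ?_
    rw [← ENNReal.ofReal_mul (mul_nonneg hD0 (hh0 _))]
    refine ENNReal.ofReal_le_ofReal ?_
    have h1 := abs_integral_sub_integral_le (by positivity) (hcomp e hne hd)
      (by rw [dShift_comm]; exact hcomp e (Ne.symm hne) (by rwa [dShift_comm])) (hf _) (hf _)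
    refine h1.trans (le_of_eq ?_)
    ring

/-- The Martin kernel represents the integrals with respect to the limit measures. -/
theorem IsLimitFamily.theta_eq (hν : IsLimitFamily ψ φ ξ b s ν)
    (hS : IsRegular ψ φ ξ b r C M) (o z : Ext A G) {f : Ext A G → ℝ} (hf : Integrable f (ν z)) :
    ν z ≪ ν o ∧ Integrable (fun y => martinKernel ν o z y * f y) (ν o) ∧
      Theta ν o f z = ∫ y, f y ∂(ν z) := by
  have := sigmaFinite_of_fibre (hν.fibre_lt_top hS z)
  have := sigmaFinite_of_fibre (hν.fibre_lt_top hS o)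
  obtain ⟨K, -, hle⟩ := hν.exists_le_smul hS z o
  have hac : ν z ≪ ν o := (Measure.absolutelyContinuous_of_le hle).trans
    (Measure.smul_absolutelyContinuous)
  exact ⟨hac, (integrable_toReal_rnDeriv_mul_iff hac).2 hf, integral_toReal_rnDeriv_mul hac⟩

end LimitFamily

/-! ### Existence of the limit measures -/

section Existence

variable {W G : Type*} [Countable W] [TopologicalSpace W] [DiscreteTopology W]
  [MeasurableSpace W] [DiscreteMeasurableSpace W]
  [Group G] [Countable G] [TopologicalSpace G] [DiscreteTopology G]
  [MeasurableSpace G] [DiscreteMeasurableSpace G]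
  {A : W → W → Prop} {ψ : W → G} {φ : Chain A → ℝ} {ξ : Chain A}
  {b s : ℕ → ℝ} {r C : ℝ} {M : ℝ≥0}

/-- The set of points in `X_g` whose first letters are given by `w`. -/
def wordCyl (A : W → W → Prop) (g : G) (w : Σ N : ℕ, Fin N → W) : Set (Ext A G) :=
  {z | z.2 = g ∧ ∀ i : Fin w.1, z.1.1 i = w.2 i}

theorem isCyl_wordCyl (g : G) (w : Σ N : ℕ, Fin N → W) : IsCyl w.1 (wordCyl A g w) :=
  fun _ _ h2 h hz => ⟨h2.symm.trans hz.1, fun i => (h i i.2).symm.trans (hz.2 i)⟩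

theorem wordCyl_subset (g : G) (w : Σ N : ℕ, Fin N → W) : wordCyl A g w ⊆ fibre A g :=
  fun _ hz => hz.1

theorem wordCyl_zero (g : G) (w : Fin 0 → W) : wordCyl A g ⟨0, w⟩ = fibre A g :=
  subset_antisymm (wordCyl_subset g _) fun _ hz => ⟨hz, fun i => i.elim0⟩

theorem exists_tendsto_ultrafilter (𝒰 : Ultrafilter ℕ) (u : ℕ → ℝ≥0∞) :
    ∃ l, Tendsto u 𝒰 (𝓝 l) :=
  ⟨(𝒰.map u).lim, (𝒰.map u).le_nhds_lim⟩

/-! ### Weak convergence on a fibre from convergence on word cylinders -/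

section WeakConvergence

variable {m : ℕ → Measure (Ext A G)} {μ : Measure (Ext A G)} {g : G}

/-- There may be infinitely many words of length N, so termwise convergence over them gives only a
Fatou inequality. -/
theorem measure_le_liminf_of_isCyl
    (h : ∀ w, Tendsto (fun k => m k (wordCyl A g w)) atTop (𝓝 (μ (wordCyl A g w))))
    {N : ℕ} {E : Set (Ext A G)} (hE : IsCyl N E) (hEg : E ⊆ fibre A g) :
    μ E ≤ liminf (fun k => m k E) atTop := by
  have hcases (w : Fin N → W) :
      E ∩ wordCyl A g ⟨N, w⟩ = wordCyl A g ⟨N, w⟩ ∨ E ∩ wordCyl A g ⟨N, w⟩ = ∅ := by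
    rcases (E ∩ wordCyl A g ⟨N, w⟩).eq_empty_or_nonempty with h0 | ⟨z, hzE, hz⟩
    · exact Or.inr h0
    · refine Or.inl (Set.inter_eq_right.2 fun z' hz' => hE z z' (hz.1.trans hz'.1.symm) ?_ hzE)
      exact fun i hi => (hz.2 ⟨i, hi⟩).trans (hz'.2 ⟨i, hi⟩).symm
  have hlim (w : Fin N → W) : Tendsto (fun k => m k (E ∩ wordCyl A g ⟨N, w⟩)) atTop
      (𝓝 (μ (E ∩ wordCyl A g ⟨N, w⟩))) := by
    rcases hcases w with h0 | h0
    · simpa only [h0] using h ⟨N, w⟩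
    · simp only [h0, measure_empty, tendsto_const_nhds]
  have hmeas (w : Fin N → W) : MeasurableSet (E ∩ wordCyl A g ⟨N, w⟩) :=
    hE.measurableSet.inter (isCyl_wordCyl g _).measurableSet
  have hdisj : Pairwise (Function.onFun Disjoint fun w : Fin N → W => E ∩ wordCyl A g ⟨N, w⟩) := by
    intro w w' hne
    refine Set.disjoint_left.2 fun z hz hz' => hne (funext fun i => ?_)
    exact (hz.2.2 i).symm.trans (hz'.2.2 i)
  have hunion : ⋃ w : Fin N → W, E ∩ wordCyl A g ⟨N, w⟩ = E := by
    refine subset_antisymm (Set.iUnion_subset fun _ => Set.inter_subset_left) fun z hz => ?_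
    exact Set.mem_iUnion.2 ⟨fun i => z.1.1 i, hz, hEg hz, fun _ => rfl⟩
  have hsum (μ' : Measure (Ext A G)) : μ' E = ∑' w : Fin N → W, μ' (E ∩ wordCyl A g ⟨N, w⟩) := by
    rw [← measure_iUnion hdisj hmeas, hunion]
  rw [hsum μ, ENNReal.tsum_eq_iSup_sum]
  refine iSup_le fun Y => ?_
  have hY : Tendsto (fun k => ∑ w ∈ Y, m k (E ∩ wordCyl A g ⟨N, w⟩)) atTop
      (𝓝 (∑ w ∈ Y, μ (E ∩ wordCyl A g ⟨N, w⟩))) := tendsto_finsetSum _ fun w _ => hlim w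
  rw [← hY.liminf_eq]
  refine liminf_le_liminf (Eventually.of_forall fun k => ?_)
  rw [hsum (m k)]
  exact ENNReal.sum_le_tsum Y

theorem restrict_le_liminf_of_isOpen
    (h : ∀ w, Tendsto (fun k => m k (wordCyl A g w)) atTop (𝓝 (μ (wordCyl A g w))))
    {U : Set (Ext A G)} (hU : IsOpen U) :
    μ.restrict (fibre A g) U ≤ liminf (fun k => (m k).restrict (fibre A g) U) atTop := by
  simp only [Measure.restrict_apply hU.measurableSet]
  have hUg : IsOpen (U ∩ fibre A g) := hU.inter (isCyl_fibre 0 g).isOpen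
  conv_lhs => rw [← iUnion_cylInterior hUg]
  rw [(cylInterior_mono _).measure_iUnion]
  refine iSup_le fun N => ?_
  refine (measure_le_liminf_of_isCyl h (isCyl_cylInterior N _)
    ((cylInterior_subset N _).trans Set.inter_subset_right)).trans ?_
  exact liminf_le_liminf (Eventually.of_forall fun k => measure_mono (cylInterior_subset N _))

/-- Portmanteau: lower semicontinuity holds for both `f` and `B - f`, and their integrals add up to
`B` times the fibre mass, which converges. Neither inequality can then be strict. -/
theorem tendsto_setLIntegral_of_wordCyl (hμ : μ (fibre A g) ≠ ⊤)
    (h : ∀ w, Tendsto (fun k => m k (wordCyl A g w)) atTop (𝓝 (μ (wordCyl A g w))))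
    (f : Ext A G →ᵇ ℝ≥0) :
    Tendsto (fun k => ∫⁻ y in fibre A g, f y ∂(m k)) atTop
      (𝓝 (∫⁻ y in fibre A g, f y ∂μ)) := by
  set B : ℝ≥0 := nndist f 0 with hB
  have hfB (y : Ext A G) : f y ≤ B := BoundedContinuousFunction.NNReal.upper_bound f y
  have hlow {u : Ext A G → ℝ≥0} (hu : Continuous u) :
      ∫⁻ y in fibre A g, u y ∂μ ≤ liminf (fun k => ∫⁻ y in fibre A g, u y ∂(m k)) atTop := by
    have := lintegral_le_liminf_lintegral_of_forall_isOpen_measure_le_liminf_measure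
      (μ := μ.restrict (fibre A g)) (μs := fun k => (m k).restrict (fibre A g))
      (f := fun y => (u y : ℝ)) (NNReal.continuous_coe.comp hu) (fun y => (u y).2)
      fun U hU => restrict_le_liminf_of_isOpen h hU
    simpa only [ENNReal.ofReal_coe_nnreal] using this
  have hu : Continuous fun y => B - f y := continuous_const.sub f.continuous
  have hadd (μ' : Measure (Ext A G)) : ∫⁻ y in fibre A g, f y ∂μ' +
      ∫⁻ y in fibre A g, ((B - f y : ℝ≥0) : ℝ≥0∞) ∂μ' = B * μ' (fibre A g) := by
    rw [← lintegral_add_left f.continuous.measurable.coe_nnreal_ennreal]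
    have (y : Ext A G) : (f y : ℝ≥0∞) + ((B - f y : ℝ≥0) : ℝ≥0∞) = B := by
      rw [← ENNReal.coe_add, add_tsub_cancel_of_le (hfB y)]
    simp only [this, lintegral_const, Measure.restrict_apply_univ]
  rw [tendsto_iff_ultrafilter]
  intro 𝒰 h𝒰
  obtain ⟨a, ha⟩ : ∃ a, Tendsto (fun k => ∫⁻ y in fibre A g, f y ∂(m k)) 𝒰 (𝓝 a) :=
    exists_tendsto_ultrafilter _ _
  obtain ⟨c, hc⟩ : ∃ c, Tendsto
      (fun k => ∫⁻ y in fibre A g, ((B - f y : ℝ≥0) : ℝ≥0∞) ∂(m k)) 𝒰 (𝓝 c) :=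
    exists_tendsto_ultrafilter _ _
  have h1 : ∫⁻ y in fibre A g, f y ∂μ ≤ a := by
    rw [← ha.liminf_eq]
    exact (hlow f.continuous).trans (liminf_le_liminf_of_le h𝒰)
  have h2 : ∫⁻ y in fibre A g, ((B - f y : ℝ≥0) : ℝ≥0∞) ∂μ ≤ c := by
    rw [← hc.liminf_eq]
    exact (hlow hu).trans (liminf_le_liminf_of_le h𝒰)
  have h3 : a + c = B * μ (fibre A g) := by
    refine tendsto_nhds_unique (ha.add hc) ?_
    simp only [hadd]
    -- The empty word gives the whole fibre, hence convergence of the total mass.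
    by_cases hW : Nonempty (Fin 0 → W)
    · obtain ⟨w⟩ := hW
      have := h ⟨0, w⟩
      rw [wordCyl_zero] at this
      exact ENNReal.Tendsto.const_mul (this.mono_left h𝒰) (Or.inr ENNReal.coe_ne_top)
    · exact absurd ⟨fun i => i.elim0⟩ hW
  have h4 : ∫⁻ y in fibre A g, f y ∂μ + ∫⁻ y in fibre A g, ((B - f y : ℝ≥0) : ℝ≥0∞) ∂μ ≠ ⊤ := by
    rw [hadd]
    exact ENNReal.mul_ne_top ENNReal.coe_ne_top hμ
  have h5 : a ≤ ∫⁻ y in fibre A g, f y ∂μ := by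
    have h6 : a + ∫⁻ y in fibre A g, ((B - f y : ℝ≥0) : ℝ≥0∞) ∂μ ≤
        ∫⁻ y in fibre A g, f y ∂μ + ∫⁻ y in fibre A g, ((B - f y : ℝ≥0) : ℝ≥0∞) ∂μ := by
      rw [hadd, ← h3]
      gcongr
    exact (ENNReal.add_le_add_iff_right (ENNReal.add_ne_top.1 h4).2).1 h6
  rwa [le_antisymm h5 h1] at ha

end WeakConvergence

/-! ### From finitely additive limits to measures -/

section Content

theorem isSetRing_isCyl : IsSetRing {E : Set (Ext A G) | ∃ N, IsCyl N E} where
  empty_mem := ⟨0, fun _ _ _ _ hz => hz⟩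
  union_mem := by
    rintro E F ⟨N, hE⟩ ⟨N', hF⟩
    exact ⟨max N N', (hE.mono (le_max_left _ _)).union (hF.mono (le_max_right _ _))⟩
  sdiff_mem := by
    rintro E F ⟨N, hE⟩ ⟨N', hF⟩
    exact ⟨max N N', (hE.mono (le_max_left _ _)).inter (hF.mono (le_max_right _ _)).compl⟩

theorem le_generateFrom_isCyl :
    (inferInstance : MeasurableSpace (Ext A G)) ≤
      MeasurableSpace.generateFrom {E : Set (Ext A G) | ∃ N, IsCyl N E} := by
  rw [BorelSpace.measurable_eq (α := Ext A G)]
  refine MeasurableSpace.generateFrom_le fun U hU => ?_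
  rw [← iUnion_cylInterior hU]
  exact MeasurableSet.iUnion fun N =>
    MeasurableSpace.measurableSet_generateFrom ⟨N, isCyl_cylInterior N U⟩

/-- An additive function on the sets depending on finitely many letters which is dominated by a
finite measure extends to a measure. -/
theorem exists_measure_of_content {μ : Measure (Ext A G)} [IsFiniteMeasure μ] {K : ℝ≥0∞}
    (hK : K ≠ ⊤) (L : Set (Ext A G) → ℝ≥0∞) (h0 : L ∅ = 0)
    (hadd : ∀ E F, Disjoint E F → L (E ∪ F) = L E + L F)
    (hle : ∀ N E, IsCyl N E → L E ≤ K * μ E) :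
    ∃ ν : Measure (Ext A G), ∀ N E, IsCyl N E → ν E = L E := by
  set m : AddContent ℝ≥0∞ {E : Set (Ext A G) | ∃ N, IsCyl N E} :=
    isSetRing_isCyl.addContent_of_union L h0 fun _ _ hd => hadd _ _ hd with hm
  have hmL (E : Set (Ext A G)) : m E = L E := rfl
  have hsub : m.IsSigmaSubadditive := by
    refine isSigmaSubadditive_of_addContent_iUnion_eq_tsum isSetRing_isCyl fun f hf hUf hd =>
      addContent_iUnion_eq_sum_of_tendsto_zero isSetRing_isCyl m ?_ ?_ hf hUf hd
    · rintro E ⟨N, hE⟩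
      exact ne_top_of_le_ne_top (ENNReal.mul_ne_top hK (measure_ne_top μ E)) (hle N E hE)
    -- Continuity at the empty set is inherited from the dominating finite measure.
    · intro E hE hanti hempty
      have h1 : Tendsto (fun n => μ (E n)) atTop (𝓝 0) := by
        have := tendsto_measure_iInter_atTop (μ := μ) (s := E)
          (fun n => (hE n).choose_spec.measurableSet.nullMeasurableSet) hanti
          ⟨0, measure_ne_top μ _⟩
        rwa [hempty, measure_empty] at this
      have h2 := ENNReal.Tendsto.const_mul h1 (Or.inr hK)
      rw [mul_zero] at h2
      refine tendsto_of_tendsto_of_tendsto_of_le_of_le tendsto_const_nhds h2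
        (fun _ => zero_le) fun n => ?_
      obtain ⟨N, hN⟩ := hE n
      exact hle N _ hN
  refine ⟨m.measure isSetRing_isCyl.isSetSemiring le_generateFrom_isCyl hsub, fun N E hE => ?_⟩
  rw [← hmL E]
  refine AddContent.measure_eq m isSetRing_isCyl.isSetSemiring
    (le_antisymm le_generateFrom_isCyl (MeasurableSpace.generateFrom_le ?_)) hsub ⟨N, hE⟩
  rintro F ⟨N', hF⟩
  exact hF.measurableSet

end Content

theorem measurable_translate (g : G) : Measurable (translate g : Ext A G → Ext A G) :=
  measurable_fst.prodMk ((measurable_of_countable fun h : G => g * h).comp measurable_snd)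

/-- Property (C) for a given choice of the weight and of the sequence. -/
structure HasBaseLimit (ψ : W → G) (φ : Chain A → ℝ) (ξ : Chain A) (b s : ℕ → ℝ)
    (m : Measure (Ext A G)) : Prop where
  decreases : DecreasesTo s (specRad ψ φ ξ)
  prob : IsProbabilityMeasure m
  conv : ∀ f : Ext A G →ᵇ ℝ≥0,
    Tendsto (fun k => ∫⁻ y in fibre A (1 : G), f y ∂(approxMeasure ψ φ ξ b (s k) (ξ, 1)))
      atTop (𝓝 (∫⁻ y, f y ∂m))

variable {m : Measure (Ext A G)}

/-- Property (C) concerns `X_id` seen from `(ξ, 1)`; left translation gives the same limit for `X_g`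
seen from `(ξ, g)`. -/
theorem HasBaseLimit.tendsto_avg (hm : HasBaseLimit ψ φ ξ b s m) (g : G) {N : ℕ}
    {E : Set (Ext A G)} (hE : IsCyl N E) :
    Tendsto (fun k => avg ψ φ ξ b (s k) ((E ∩ fibre A g).indicator 1) (ξ, g)) atTop
      (𝓝 (m.map (translate g) E)) := by
  have hE' : IsCyl N (translate g ⁻¹' E) := fun z z' h2 h hz =>
    hE (translate g z) (translate g z') (congrArg (g * ·) h2) h hz
  have h := hm.conv (clopenIndicator hE'.isClopen)
  simp only [setLIntegral_approxMeasure, coe_clopenIndicator] at h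
  rw [lintegral_indicator_one hE'.measurableSet,
    ← Measure.map_apply (measurable_translate g) hE.measurableSet] at h
  refine h.congr fun k => ?_
  have h1 : ((ξ, g) : Ext A G) = translate g (ξ, 1) := by simp [translate]
  rw [h1, avg_translate]
  congr 1
  classical
  funext y
  have h2 : translate g y ∈ fibre A g ↔ y ∈ fibre A (1 : G) := by
    simp [fibre, translate]
  simp only [Set.indicator_apply, Set.mem_inter_iff, h2, Set.mem_preimage]
  by_cases h3 : y ∈ fibre A (1 : G) <;> by_cases h4 : translate g y ∈ E <;> simp [h3, h4]

theorem avg_add (t : ℝ) (F F' : Ext A G → ℝ≥0∞) (ζ : Ext A G) :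
    avg ψ φ ξ b t (fun y => F y + F' y) ζ = avg ψ φ ξ b t F ζ + avg ψ φ ξ b t F' ζ := by
  simp only [avg, ruelle, mul_add, ENNReal.tsum_add]

/-- Limits along an ultrafilter of the approximating measures are measures. -/
theorem HasBaseLimit.exists_measure (hm : HasBaseLimit ψ φ ξ b s m)
    (hS : IsRegular ψ φ ξ b r C M) (𝒰 : Ultrafilter ℕ) (h𝒰 : (𝒰 : Filter ℕ) ≤ atTop)
    (z : Ext A G) (g : G) :
    ∃ ν : Measure (Ext A G), ν (fibre A g) ≠ ⊤ ∧ ∀ N E, IsCyl N E →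
      Tendsto (fun k => avg ψ φ ξ b (s k) ((E ∩ fibre A g).indicator 1) z) 𝒰 (𝓝 (ν E)) := by
  have := hm.prob
  have : IsProbabilityMeasure (m.map (translate g)) :=
    Measure.isProbabilityMeasure_map (measurable_translate g).aemeasurable
  have hlim (E : Set (Ext A G)) : ∃ l, Tendsto
      (fun k => avg ψ φ ξ b (s k) ((E ∩ fibre A g).indicator 1) z) 𝒰 (𝓝 l) :=
    exists_tendsto_ultrafilter _ _
  choose L hL using hlim
  obtain ⟨K, hK, hbound⟩ := hS.exists_avg_le_mul (s 0) z (ξ, g)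
  have hle (N : ℕ) (E : Set (Ext A G)) (hE : IsCyl N E) : L E ≤ K * m.map (translate g) E := by
    obtain ⟨R, hR, hR'⟩ := hbound N
    have h1 := ((hS.tendsto_inv_mul hm.decreases hR).add
      (ENNReal.Tendsto.const_mul (hm.tendsto_avg g hE) (Or.inr hK))).mono_left h𝒰
    rw [zero_add] at h1
    exact le_of_tendsto_of_tendsto' (hL E) h1 fun k => hR' (s k) (hm.decreases.gt k).le
      (hm.decreases.le_zero k) _ (hE.inter (isCyl_fibre N g))
  have hempty : L ∅ = 0 := by
    refine tendsto_nhds_unique (hL ∅) ?_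
    have h0 (t : ℝ) : avg ψ φ ξ b t ((∅ ∩ fibre A g).indicator 1) z = 0 := by
      simp [avg, ruelle]
    simp only [h0, tendsto_const_nhds]
  have hadd (E F : Set (Ext A G)) (hd : Disjoint E F) : L (E ∪ F) = L E + L F := by
    refine tendsto_nhds_unique (hL (E ∪ F)) (((hL E).add (hL F)).congr fun k => ?_)
    rw [← avg_add]
    congr 1
    rw [Set.union_inter_distrib_right, Set.indicator_union_of_disjoint
      (hd.mono Set.inter_subset_left Set.inter_subset_left)]
  obtain ⟨ν, hν⟩ := exists_measure_of_content (μ := m.map (translate g)) hK L hempty hadd hle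
  refine ⟨ν, ?_, fun N E hE => ?_⟩
  · rw [hν 0 _ (isCyl_fibre 0 g)]
    exact ne_top_of_le_ne_top (ENNReal.mul_ne_top hK (measure_ne_top _ _))
      (hle 0 _ (isCyl_fibre 0 g))
  · rw [hν N E hE]
    exact hL E

/-- Two cluster values at `z` are compared through the genuine limit at a dense point sharing j + 1
letters with `z`. Each passage costs exp(C r^(j + 1)), which tends to 1. -/
theorem IsRegular.ultrafilter_limit_le (hS : IsRegular ψ φ ξ b r C M)
    (hs : DecreasesTo s (specRad ψ φ ξ)) {D : ℕ → Ext A G} (hD : DenseRange D) {N : ℕ}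
    {E : Set (Ext A G)} (hE : IsCyl N E)
    (hconv : ∀ i, ∃ l, Tendsto (fun k => avg ψ φ ξ b (s k) (E.indicator 1) (D i)) atTop (𝓝 l))
    (z : Ext A G) {𝒰 𝒱 : Ultrafilter ℕ} (h𝒰 : (𝒰 : Filter ℕ) ≤ atTop)
    (h𝒱 : (𝒱 : Filter ℕ) ≤ atTop) {l l' : ℝ≥0∞}
    (hl : Tendsto (fun k => avg ψ φ ξ b (s k) (E.indicator 1) z) 𝒰 (𝓝 l))
    (hl' : Tendsto (fun k => avg ψ φ ξ b (s k) (E.indicator 1) z) 𝒱 (𝓝 l')) :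
    l ≤ l' := by
  obtain ⟨x, e⟩ := z
  obtain ⟨R, hR, hbound⟩ := hS.exists_avg_le_of_agree N
  have hstep (j : ℕ) : l ≤ ENNReal.ofReal (Real.exp (C * r ^ (j + 1))) *
      (ENNReal.ofReal (Real.exp (C * r ^ (j + 1))) * l') := by
    obtain ⟨i, hi2, hi⟩ := hD.mem_nhds (eventually_agree (j + 1) (x, e))
    obtain ⟨a, ha⟩ := hconv i
    set y := D i with hy
    obtain ⟨x', e'⟩ := y
    obtain rfl : e = e' := hi2
    have hlim {𝒲 : Ultrafilter ℕ} (h𝒲 : (𝒲 : Filter ℕ) ≤ atTop) {u : ℕ → ℝ≥0∞} {q : ℝ≥0∞}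
        (hu : Tendsto u 𝒲 (𝓝 q)) :
        Tendsto (fun k => (poincareSeries ψ φ ξ b (s k))⁻¹ * R +
          ENNReal.ofReal (Real.exp (C * r ^ (j + 1))) * u k) 𝒲
          (𝓝 (ENNReal.ofReal (Real.exp (C * r ^ (j + 1))) * q)) := by
      have h1 := ((hS.tendsto_inv_mul hs hR).mono_left h𝒲).add
        (ENNReal.Tendsto.const_mul hu
          (Or.inr (ENNReal.ofReal_ne_top (r := Real.exp (C * r ^ (j + 1))))))
      rwa [zero_add] at h1
    have h1 : l ≤ ENNReal.ofReal (Real.exp (C * r ^ (j + 1))) * a :=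
      le_of_tendsto_of_tendsto' hl (hlim h𝒰 (ha.mono_left h𝒰)) fun k =>
        hbound (s k) (hs.gt k).le E hE (j + 1) x x' e (by omega) hi
    have h2 : a ≤ ENNReal.ofReal (Real.exp (C * r ^ (j + 1))) * l' :=
      le_of_tendsto_of_tendsto' (ha.mono_left h𝒱) (hlim h𝒱 hl') fun k =>
        hbound (s k) (hs.gt k).le E hE (j + 1) x' x e (by omega) fun i' h' => (hi i' h').symm
    exact h1.trans (by gcongr)
  have hexp : Tendsto (fun j : ℕ => ENNReal.ofReal (Real.exp (C * r ^ (j + 1)))) atTop (𝓝 1) := by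
    have h1 : Tendsto (fun j : ℕ => r ^ (j + 1)) atTop (𝓝 0) :=
      (tendsto_pow_atTop_nhds_zero_of_lt_one hS.r_pos.le hS.r_lt_one).comp (tendsto_add_atTop_nat 1)
    have h2 := ENNReal.tendsto_ofReal ((Real.continuous_exp.tendsto _).comp (h1.const_mul C))
    simpa using h2
  have h3 := ENNReal.Tendsto.mul hexp (Or.inl one_ne_zero)
    (ENNReal.Tendsto.mul_const (b := l') hexp (Or.inl one_ne_zero)) (Or.inr ENNReal.one_ne_top)
  rw [one_mul, one_mul] at h3
  exact ge_of_tendsto' h3 hstep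

theorem HasBaseLimit.comp (hm : HasBaseLimit ψ φ ξ b s m) {θ : ℕ → ℕ} (hθ : StrictMono θ) :
    HasBaseLimit ψ φ ξ b (s ∘ θ) m where
  decreases :=
    { anti := hm.decreases.anti.comp_monotone hθ.monotone
      gt := fun k => hm.decreases.gt (θ k)
      lim := hm.decreases.lim.comp hθ.tendsto_atTop }
  prob := hm.prob
  conv := fun f => (hm.conv f).comp hθ.tendsto_atTop

/-- Property (C) implies the existence of the limit measures along a subsequence. -/
theorem HasBaseLimit.exists_isLimitFamily (hm : HasBaseLimit ψ φ ξ b s m)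
    (hS : IsRegular ψ φ ξ b r C M) :
    ∃ (s' : ℕ → ℝ) (ν : Ext A G → Measure (Ext A G)), IsLimitFamily ψ φ ξ b s' ν := by
  have : Nonempty (Ext A G) := ⟨(ξ, 1)⟩
  set D := TopologicalSpace.denseSeq (Ext A G) with hD
  -- The pairs of a dense point and a word cylinder are countable, so a countable product of copies
  -- of `[0, ∞]` yields one subsequence for all of them.
  obtain ⟨a, θ, hθ, ha⟩ := CompactSpace.tendsto_subseq
    fun (k : ℕ) (i : ℕ × G × Σ N : ℕ, Fin N → W) =>
      avg ψ φ ξ b (s k) ((wordCyl A i.2.1 i.2.2).indicator 1) (D i.1)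
  rw [tendsto_pi_nhds] at ha
  have hm' := hm.comp hθ
  set s' := s ∘ θ with hs'
  choose ν' hfin hν' using hm'.exists_measure hS (hyperfilter ℕ) Nat.hyperfilter_le_atTop
  have hword (z : Ext A G) (g : G) (w : Σ N : ℕ, Fin N → W) :
      Tendsto (fun k => approxMeasure ψ φ ξ b (s' k) z (wordCyl A g w)) atTop
        (𝓝 (ν' z g (wordCyl A g w))) := by
    have h1 (k : ℕ) : approxMeasure ψ φ ξ b (s' k) z (wordCyl A g w) =
        avg ψ φ ξ b (s' k) ((wordCyl A g w).indicator 1) z := by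
      rw [← lintegral_approxMeasure, lintegral_indicator_one (isCyl_wordCyl g w).measurableSet]
    simp only [h1]
    have h2 := hν' z g _ _ (isCyl_wordCyl g w)
    rw [Set.inter_eq_left.2 (wordCyl_subset g w)] at h2
    rw [tendsto_iff_ultrafilter]
    intro 𝒰 h𝒰
    obtain ⟨l, hl⟩ : ∃ l, Tendsto
        (fun k => avg ψ φ ξ b (s' k) ((wordCyl A g w).indicator 1) z) 𝒰 (𝓝 l) :=
      exists_tendsto_ultrafilter _ _
    have hconv (i : ℕ) : ∃ l, Tendsto
        (fun k => avg ψ φ ξ b (s' k) ((wordCyl A g w).indicator 1) (D i)) atTop (𝓝 l) :=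
      ⟨_, ha (i, g, w)⟩
    have hle := hS.ultrafilter_limit_le hm'.decreases (TopologicalSpace.denseRange_denseSeq _)
      (isCyl_wordCyl g w) hconv z h𝒰 Nat.hyperfilter_le_atTop hl h2
    have hge := hS.ultrafilter_limit_le hm'.decreases (TopologicalSpace.denseRange_denseSeq _)
      (isCyl_wordCyl g w) hconv z Nat.hyperfilter_le_atTop h𝒰 h2 hl
    rwa [le_antisymm hle hge] at hl
  -- Each fibre has its own ultrafilter limit; ν_z is glued from their restrictions to the
  -- respective fibres.
  refine ⟨s', fun z => Measure.sum fun g => (ν' z g).restrict (fibre A g),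
    hS.weight, hm'.decreases, fun z g f => ?_⟩
  have h1 : (Measure.sum fun g' => (ν' z g').restrict (fibre A g')).restrict (fibre A g) =
      (ν' z g).restrict (fibre A g) := by
    rw [Measure.restrict_sum _ (measurableSet_fibre g)]
    ext B hB
    rw [Measure.sum_apply _ hB, tsum_eq_single g]
    · rw [Measure.restrict_restrict (measurableSet_fibre g), Set.inter_self]
    · intro g' hg'
      have : fibre A g ∩ fibre A g' = ∅ := by
        ext u
        simp only [fibre, Set.mem_inter_iff, Set.mem_ofPred_eq, Set.mem_empty_iff_false, iff_false]
        rintro ⟨h, h'⟩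
        exact hg' (h'.symm.trans h)
      rw [Measure.restrict_restrict (measurableSet_fibre g), this, Measure.restrict_empty]
      rfl
  rw [h1]
  exact tendsto_setLIntegral_of_wordCyl (hfin z g) (hword z g) f

end Existence

end GroupExt

end

theorem mainTheorem4 {W G : Type*}
    [Countable W] [TopologicalSpace W] [DiscreteTopology W]
    [MeasurableSpace W] [DiscreteMeasurableSpace W]
    [Group G] [Countable G] [TopologicalSpace G] [DiscreteTopology G]
    [MeasurableSpace G] [DiscreteMeasurableSpace G]
    (A : W → W → Prop) (hA : GroupExt.NoZeroLines A)
    (hmix : GroupExt.TopMixing A) (hbip : GroupExt.BigImagesPreimages A)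
    (ψ : W → G) (htrans : GroupExt.TopTransitiveExt A ψ)
    (φ : GroupExt.Chain A → ℝ) (hφ : ∀ x, 0 < φ x)
    (r : ℝ) (hr₀ : 0 < r) (hr₁ : r < 1) (hHol : GroupExt.LogLocallyHolder r φ)
    (hL : GroupExt.BoundedRuelleOne φ)
    (ξ : GroupExt.Chain A) (hC : GroupExt.PropertyC ψ φ ξ) :
    -- the measures `ν_z` exist
    (∃ (b s : ℕ → ℝ) (ν : GroupExt.Ext A G → Measure (GroupExt.Ext A G)),
      GroupExt.IsLimitFamily ψ φ ξ b s ν) ∧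
    -- for every such family and every base point `o ∈ X_id`, `Θ : 𝓒 → 𝓗` is well defined
    (∀ (b s : ℕ → ℝ) (ν : GroupExt.Ext A G → Measure (GroupExt.Ext A G)),
      GroupExt.IsLimitFamily ψ φ ξ b s ν →
      ∀ ξ₀ : GroupExt.Chain A,
        (∀ z : GroupExt.Ext A G,
          (∀ g : G, ν z (GroupExt.fibre A g) < ⊤) ∧ ν z ≪ ν (ξ₀, 1)) ∧
        ∀ f ∈ GroupExt.logUnifCont (ν (ξ₀, 1)),
          (∀ z : GroupExt.Ext A G,
            Integrable f (ν z) ∧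
            Integrable (fun y => GroupExt.martinKernel ν (ξ₀, 1) z y * f y) (ν (ξ₀, 1)) ∧
            GroupExt.Theta ν (ξ₀, 1) f z = ∫ y, f y ∂(ν z)) ∧
          GroupExt.Theta ν (ξ₀, 1) f ∈ GroupExt.harmonicLip ψ φ r ξ) ∧
    -- the bound on `LD` for nonnegative elements of `𝓗`
    GroupExt.distortionConst r φ < ⊤ ∧
    (∀ f ∈ GroupExt.harmonicLip ψ φ r ξ, (∀ z, 0 ≤ f z) →
      GroupExt.logLip r f ≤ GroupExt.distortionConst r φ ∧
      f ∈ GroupExt.harmonicPos ψ φ r ξ) := by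
  obtain ⟨C, hD⟩ := hHol.exists_hasDistortion hφ hr₀ hr₁
  obtain ⟨M, hM⟩ := hL
  have hreg {b : ℕ → ℝ} (hb : GroupExt.IsWeight ψ φ ξ b) : GroupExt.IsRegular ψ φ ξ b r C M :=
    ⟨hφ, hr₀, hr₁, hD, hM, hbip, htrans, hb⟩
  have hCφ := hD.distortionConst_lt_top hφ hr₀ hr₁
  refine ⟨?_, fun b s ν hν ξ₀ => ?_, hCφ, fun f hf hf0 => ?_⟩
  · obtain ⟨b, s, m, hb, hs, hprob, hconv⟩ := hC
    have hm : GroupExt.HasBaseLimit ψ φ ξ b s m := ⟨hs, hprob, hconv⟩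
    exact ⟨b, hm.exists_isLimitFamily (hreg hb)⟩
  · have hS := hreg hν.weight
    refine ⟨fun z => ⟨fun g => hν.fibre_lt_top hS z g, ?_⟩, fun f hf => ?_⟩
    -- Absolute continuity does not involve the integrand, so the zero function serves.
    · exact (hν.theta_eq hS (ξ₀, 1) z (integrable_zero _ ℝ _)).1
    · have hint := hν.integrable hS hf
      have heq := fun z => (hν.theta_eq hS (ξ₀, 1) z (hint z)).2
      refine ⟨fun z => ⟨hint z, heq z⟩, ?_⟩
      rw [funext fun z => (heq z).2]
      exact hν.integral_mem_harmonicLip hS hint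
  · exact GroupExt.logLip_le_distortionConst hφ hr₀ hr₁ (hD.specRad_pos hφ hM htrans ξ) hCφ hf hf0
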